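/- Let $p\ge 1$, $q,m,\nu\ge 0$, and let $J^m$ be the space of $m$-jets $(x,u^{(m)})$ of functions $u=u(x)$, $x\in\mathbb R^p$, $u\in\mathbb R^q$, where $u^{(m)}$ denotes $u$ with its partial derivatives up to order $m$. Let $X=\sum_i\xi_i\,\partial/\partial x_i+\sum_\alpha\varphi_\alpha(x,u)\,\partial/\partial u_\alpha$ be a smooth vector field on an open set $W\subseteq\mathbb R^p\times\mathbb R^q$ which is projectable, i.e. the functions $\xi_i$ do not depend on $u$, and let $X^*$ be its prolongation to $J^m$. Let $\Delta=(\Delta_1,\dots,\Delta_\nu)$ be smooth functions of $(x,u^{(m)})$ on an open set $M\subseteq J^m$ lying over $W$, such that the system $\Delta=0$ is nondegenerate (the Jacobian matrix of $\Delta$ with respect to all variables $(x,u^{(m)})$ has rank $\nu$ at every point of $M$ where $\Delta=0$) and symmetric under $X$ (that is, $X^*(\Delta)=0$ at every point of $M$ where $\Delta=0$). (i) Near every point $(x_0,u_0)\in W$ with $\xi(x_0)\neq 0$ there is a smooth invertible change of variables $(x,u)\mapsto(s,z,v)$, $s\in\mathbb R$, $z\in\mathbb R^{p-1}$, $v\in\mathbb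 R^q$, in which $s,z$ are functions of $x$ only and $X=\partial/\partial s$, and which has the following property $(\ast)$ at every jet $j_0\in M$ lying over its domain. $(\ast)$ The change of variables prolongs to a smooth invertible change of variables $(x,u^{(m)})\mapsto(s,z,v^{(m)})$ on a neighbourhood of $j_0$ in $M$, where $v^{(m)}$ denotes $v=v(s,z)$ with its derivatives with respect to $s$ and $z$ up to order $m$. If $\tilde\Delta(s,z,v^{(m)})$ denotes $\Delta$ expressed in the new variables, there are a smooth invertible $\nu\times\nu$ matrix $S_{ab}(s,z,v^{(m)})$ and smooth functions $$K_a=\sum_b S_{ab}(s,z,v^{(m)})\,\tilde\Delta_b(s,z,v^{(m)})$$ on the image of this neighbourhood, so that $K=0$ is locally equivalent to $\Delta=0$, such that $K=0$ is invariant under $X=\partial/\partial s$: $X^*(K)=0$ identically, i.e. $K_a=K_a(z,v^{(m)})$ does not depend explicitly on $s$. (ii) For every jet $j_0\in M$ over a point $(x_0,u_0)$ with $X(x_0,u_0)\ne0$ (where $\xi(x_0)=0$ is allowed) there is a smooth invertible change of variables $(x,u)\mapsto(s,z,v)$ near $(x_0,u_0)$ in which $X=\partial/\partial s$ and which has property $(\ast)$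 at $j_0$; here $s,z$ may depend on both $x$ and $u$. -/

import Mathlib

open scoped ContDiff Topology

noncomputable section

namespace PDESymmetry

/-- The space `ℝ^p × ℝ^q` of independent and dependent variables `(x, u)`. -/
abbrev Base (p q : ℕ) : Type := (Fin p → ℝ) × (Fin q → ℝ)

/-- Multi-indices `J = (J_1, …, J_p)` of order `|J| = ∑ J_i ≤ m`. -/
abbrev MultiIdx (p m : ℕ) : Type := {J : Fin p → Fin (m + 1) // ∑ i, (J i : ℕ) ≤ m}

/-- The multi-index of order zero. -/
def MultiIdx.none (p m : ℕ) : MultiIdx p m := ⟨fun _ => 0, by simp⟩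

/-- The underlying family of exponents of a multi-index. -/
def MultiIdx.exps {p m : ℕ} (J : MultiIdx p m) : Fin p → ℕ := fun i => (J.1 i : ℕ)

/-- The jet space of order `m`, with coordinates `x_i` and `u_{α,J}` for `|J| ≤ m`;
a point of it is the datum `(x, u^{(m)})`. -/
abbrev Jet (p q m : ℕ) : Type := (Fin p → ℝ) × (Fin q → MultiIdx p m → ℝ)

/-- The projection `(x, u^{(m)}) ↦ (x, u)`. -/
def Jet.base {p q m : ℕ} (j : Jet p q m) : Base p q :=
  (j.1, fun α => j.2 α (MultiIdx.none p m))

/-- The partial derivative `∂f/∂x_i`. -/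
def pderiv {p : ℕ} (i : Fin p) (f : (Fin p → ℝ) → ℝ) : (Fin p → ℝ) → ℝ :=
  fun x => fderiv ℝ f x (Pi.single i 1)

/-- The iterated partial derivative `∂_J f = ∂_1^{J_1} ⋯ ∂_p^{J_p} f`. -/
def mderiv {p : ℕ} (J : Fin p → ℕ) (f : (Fin p → ℝ) → ℝ) : (Fin p → ℝ) → ℝ :=
  (List.finRange p).foldr (fun i g => (pderiv i)^[J i] g) f

/-- The `m`-jet at `x` of a function `u = f(x)`. -/
def jet {p q : ℕ} (m : ℕ) (f : (Fin p → ℝ) → (Fin q → ℝ)) (x : Fin p → ℝ) : Jet p q m :=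
  (x, fun α J => mderiv J.exps (fun y => f y α) x)

/-- The polynomial function of degree at most `m` whose `m`-jet at the point `j.1` is `j`. -/
def Jet.rep {p q m : ℕ} (j : Jet p q m) : (Fin p → ℝ) → (Fin q → ℝ) :=
  fun y α => ∑ J : MultiIdx p m,
    j.2 α J * ∏ i, (y i - j.1 i) ^ J.exps i / (Nat.factorial (J.exps i) : ℝ)

/-- The characteristic `Q_α = φ_α(x, f(x)) - ∑ i, ξ_i(x, f(x)) ∂_i f_α(x)` of the vector field
`X = ∑ i, ξ_i ∂/∂x_i + ∑ α, φ_α ∂/∂u_α`, evaluated along the function `u = f(x)`. A vector field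
is given by its components `X (x, u) = (ξ (x, u), φ (x, u))`. -/
def characteristic {p q : ℕ} (X : Base p q → Base p q) (f : (Fin p → ℝ) → (Fin q → ℝ))
    (α : Fin q) : (Fin p → ℝ) → ℝ :=
  fun x => (X (x, f x)).2 α - ∑ i, (X (x, f x)).1 i * pderiv i (fun y => f y α) x

/-- The `m`-th prolongation `X^*` of `X`, a vector field on the jet space: its `x`-components are
`ξ_i`, and its `u_{α,J}`-component is `D_J Q_α + ∑ i, ξ_i u_{α,J,i}`, where `Q` is the
characteristic and `D_J` the total derivative. This expression does not involve the derivatives of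
order `m + 1`, hence it may be computed on any function having the given `m`-jet. -/
def prolong {p q m : ℕ} (X : Base p q → Base p q) (j : Jet p q m) : Jet p q m :=
  ((X j.base).1, fun α J =>
    mderiv J.exps (characteristic X j.rep α) j.1
      + ∑ i, (X j.base).1 i * mderiv J.exps (pderiv i (fun y => j.rep y α)) j.1)

/-- `X^*(Δ)` for a system `Δ = (Δ_1, …, Δ_ν)` of functions on the jet space. -/
def prolongApply {p q m ν : ℕ} (X : Base p q → Base p q) (Δ : Jet p q m → (Fin ν → ℝ))
    (j : Jet p q m) : Fin ν → ℝ :=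
  fderiv ℝ Δ j (prolong X j)

/-- `Δ = 0` is nondegenerate on `M`: the Jacobian matrix of `Δ` with respect to all the variables
`(x, u^{(m)})` has rank `ν` at every point of `M` where `Δ = 0`. -/
def Nondegenerate {p q m ν : ℕ} (Δ : Jet p q m → (Fin ν → ℝ)) (M : Set (Jet p q m)) : Prop :=
  ∀ j ∈ M, Δ j = 0 → Function.Surjective (fderiv ℝ Δ j)

/-- `Δ = 0` is symmetric under `X` on `M`: `X^*(Δ)` vanishes where `Δ = 0`. -/
def IsSymmetric {p q m ν : ℕ} (X : Base p q → Base p q) (Δ : Jet p q m → (Fin ν → ℝ))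
    (M : Set (Jet p q m)) : Prop :=
  ∀ j ∈ M, Δ j = 0 → prolongApply X Δ j = 0

/-- `Δ = 0` is invariant under `X` on `M`: `X^*(Δ) = 0` identically. -/
def IsInvariant {p q m ν : ℕ} (X : Base p q → Base p q) (Δ : Jet p q m → (Fin ν → ℝ))
    (M : Set (Jet p q m)) : Prop :=
  ∀ j ∈ M, prolongApply X Δ j = 0

/-- `X` is projectable on `W`: the functions `ξ_i` do not depend on `u`. -/
def Projectable {p q : ℕ} (X : Base p q → Base p q) (W : Set (Base p q)) : Prop :=
  ∀ b ∈ W, ∀ b' ∈ W, b.1 = b'.1 → (X b).1 = (X b').1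

/-- A smooth local diffeomorphism: a homeomorphism from the open set `Φ.source` onto the open set
`Φ.target` that is smooth with smooth inverse. -/
def IsSmoothChange {E : Type*} [NormedAddCommGroup E] [NormedSpace ℝ E]
    (Φ : OpenPartialHomeomorph E E) : Prop :=
  ContDiffOn ℝ ∞ Φ Φ.source ∧ ContDiffOn ℝ ∞ Φ.symm Φ.target

/-- The vector field `∂/∂s`. The new independent variables `(s, z) ∈ ℝ × ℝ^n` are the coordinates
of `Fin (n + 1) → ℝ`, `s` being the coordinate of index `0`. -/
def dds (n q : ℕ) : Base (n + 1) q → Base (n + 1) q := fun _ => (Pi.single 0 1, 0)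

/-- The change of variables `(x, u) ↦ (s, z, v)` given by `Φ` transforms `X` into `∂/∂s`,
that is `X s = 1`, `X z_k = 0`, `X v_α = 0`. -/
def Rectifies {n q : ℕ} (Φ : OpenPartialHomeomorph (Base (n + 1) q) (Base (n + 1) q))
    (X : Base (n + 1) q → Base (n + 1) q) : Prop :=
  ∀ b ∈ Φ.source, fderiv ℝ Φ b (X b) = dds n q (Φ b)

/-- The new independent variables are functions of the old independent variables only. -/
def FibrePreserving {p q : ℕ} (Φ : OpenPartialHomeomorph (Base p q) (Base p q)) : Prop :=
  ∀ b ∈ Φ.source, ∀ b' ∈ Φ.source, b.1 = b'.1 → (Φ b).1 = (Φ b').1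

/-- The new independent variables, restricted to the graph of `u = f(x)`, are local coordinates
on this graph near `(x, f(x))`; that is, the graph is again, in the new variables and locally, the
graph of a function of the new independent variables. -/
def Transversal {p q : ℕ} (Φ : OpenPartialHomeomorph (Base p q) (Base p q))
    (f : (Fin p → ℝ) → (Fin q → ℝ)) (x : Fin p → ℝ) : Prop :=
  Function.Bijective (fderiv ℝ (fun y => (Φ (y, f y)).1) x)

/-- Near `x` the change of variables `Φ` maps the graph of `f` into the graph of `g`. -/
def MapsGraph {p q : ℕ} (Φ : OpenPartialHomeomorph (Base p q) (Base p q))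
    (f g : (Fin p → ℝ) → (Fin q → ℝ)) (x : Fin p → ℝ) : Prop :=
  ∀ᶠ y in 𝓝 x, (Φ (y, f y)).2 = g (Φ (y, f y)).1

/-- `P` is (a restriction to an open set of) the prolongation of the change of variables `Φ` to
the jet space: if a function `f` with jet `j` is transformed by `Φ` into the function `g`, then
`P j` is the jet of `g`. The domain of `P` contains only jets of functions that `Φ` transforms
into functions. -/
def IsProlongation {p q m : ℕ} (Φ : OpenPartialHomeomorph (Base p q) (Base p q))
    (P : OpenPartialHomeomorph (Jet p q m) (Jet p q m)) : Prop :=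
  ∀ j ∈ P.source, j.base ∈ Φ.source ∧
    (∃ f : (Fin p → ℝ) → (Fin q → ℝ),
      ContDiffAt ℝ ∞ f j.1 ∧ jet m f j.1 = j ∧ Transversal Φ f j.1) ∧
    ∀ f : (Fin p → ℝ) → (Fin q → ℝ),
      ContDiffAt ℝ ∞ f j.1 → jet m f j.1 = j → Transversal Φ f j.1 →
        ∃ g : (Fin p → ℝ) → (Fin q → ℝ), ContDiffAt ℝ ∞ g (Φ j.base).1 ∧
          MapsGraph Φ f g j.1 ∧ P j = jet m g (Φ j.base).1

/-- In the new variables `(s, z, v)` given by `Φ`, near the jet `j₀`, the system `Δ = 0` is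
equivalent to a system `K = 0` with `K_a = ∑ b, S_{ab} Δ̃_b`, where `Δ̃` is `Δ` in the new variables
and `S` is a smooth invertible matrix, and `K` is invariant under `∂/∂s`, i.e. it does not depend
explicitly on `s`. -/
def HasInvariantForm {n q m ν : ℕ} (Δ : Jet (n + 1) q m → (Fin ν → ℝ))
    (M : Set (Jet (n + 1) q m)) (Φ : OpenPartialHomeomorph (Base (n + 1) q) (Base (n + 1) q))
    (j₀ : Jet (n + 1) q m) : Prop :=
  ∃ P : OpenPartialHomeomorph (Jet (n + 1) q m) (Jet (n + 1) q m),
    j₀ ∈ P.source ∧ P.source ⊆ M ∧ IsSmoothChange P ∧ IsProlongation Φ P ∧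
    ∃ (S : Jet (n + 1) q m → Matrix (Fin ν) (Fin ν) ℝ) (K : Jet (n + 1) q m → (Fin ν → ℝ)),
      (∀ a b, ContDiffOn ℝ ∞ (fun j => S j a b) P.target) ∧
      (∀ j ∈ P.target, IsUnit (S j)) ∧
      ContDiffOn ℝ ∞ K P.target ∧
      (∀ j ∈ P.target, ∀ a, K j a = ∑ b, S j a b * Δ (P.symm j) b) ∧
      (∀ j ∈ P.source, Δ j = 0 ↔ K (P j) = 0) ∧
      IsInvariant (dds n q) K P.target ∧
      (∀ j ∈ P.target, ∀ j' ∈ P.target,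
        (∀ k : Fin n, j.1 k.succ = j'.1 k.succ) → j.2 = j'.2 → K j = K j')

end PDESymmetry

end

/-! Straighten the symmetry, then remove the remaining dependence on `s` by sliding along it. If `Φ`
rectifies `X` and the graphs under consideration are transversal to the new fibres, then `Φ` acts on
jets, and this action carries `X^*` to `∂/∂s`, which has no component along `v^{(m)}`
(`fderiv_jetMap_symm`, `prolong_dds`). The transported system `T` is then nondegenerate, and the
derivative of `T` along a constant vector `e` vanishes wherever `T = 0`.

What remains is a statement about such a `T` on a vector space (`exists_invariant_form`). Near a
point `p` with `T p ≠ 0`, a rank-one perturbation of the identity turns `T` into the constant `T p`.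
Near a zero `p`, Hadamard's lemma for submersions (`exists_factor_submersion`) gives `∂_e T = Λ T`,
a linear differential equation along lines parallel to `e`, so by Gronwall the zero set is locally a
union of segments of such lines. Let `K` be `T` composed with the projection along `e` onto the
hyperplane through `p`. It vanishes where `T` does, so `K = R T` by Hadamard's lemma again.
Comparing differentials at `p` gives `R p = 1`, so `R` is invertible nearby.

The action on jets is well defined because having the same `m`-jet means contact `O(|y - x|^{m+1})`
(`jet_eq_iff_isBigO`), a notion that a change of variables preserves. Its smoothness comes from the
inverse function theorem with parameters (`exists_transformed_family`).

Rectification is the flow box theorem with prescribed differential at the base point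
(`exists_flowBox`). If `ξ ≠ 0`, projectability allows `(s, z)` to be built from `x` alone, and then
every graph is transversal. If `ξ = 0` at the base point, the differential is chosen so that the
graph of the representative of the given jet is transversal (`exists_rectifies_transversal`). -/

noncomputable section

namespace PDESymmetry

/-! ### Smoothness of composition operators on spaces of continuous functions. -/

section Superposition

variable {K E F : Type} [TopologicalSpace K] [CompactSpace K] [NormedAddCommGroup E]
  [NormedSpace ℝ E] [NormedAddCommGroup F] [NormedSpace ℝ F]

/-- Pointwise application, as a continuous bilinear map on spaces of continuous functions. -/
def pointwiseApply (K E F : Type) [TopologicalSpace K] [CompactSpace K] [NormedAddCommGroup E]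
    [NormedSpace ℝ E] [NormedAddCommGroup F] [NormedSpace ℝ F] :
    C(K, E →L[ℝ] F) →L[ℝ] C(K, E) →L[ℝ] C(K, F) :=
  LinearMap.mkContinuous₂
    (LinearMap.mk₂ ℝ (fun (A : C(K, E →L[ℝ] F)) (h : C(K, E)) =>
        (⟨fun t => A t (h t), by fun_prop⟩ : C(K, F)))
      (fun A A' h => by ext; simp) (fun c A h => by ext; simp)
      (fun A h h' => by ext; simp) (fun c A h => by ext; simp)) 1
    (fun A h => by
      rw [one_mul, ContinuousMap.norm_le _ (by positivity)]
      intro t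
      exact ((A t).le_opNorm (h t)).trans
        (mul_le_mul (A.norm_coe_le_norm t) (h.norm_coe_le_norm t) (by positivity) (by positivity)))

@[simp] lemma pointwiseApply_apply (A : C(K, E →L[ℝ] F)) (h : C(K, E)) (t : K) :
    pointwiseApply K E F A h t = A t (h t) := rfl

/-- The superposition operator `α ↦ G ∘ α` is differentiable when `G` is `C^1`. -/
lemma hasFDerivAt_superposition {G : E → F} (hG : ContDiff ℝ 1 G) (α : C(K, E)) :
    HasFDerivAt (fun α : C(K, E) => (⟨G, hG.continuous⟩ : C(E, F)).comp α)
      (pointwiseApply K E F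
        ((⟨fderiv ℝ G, hG.continuous_fderiv one_ne_zero⟩ : C(E, E →L[ℝ] F)).comp α)) α := by
  rw [hasFDerivAt_iff_isLittleO, Asymptotics.isLittleO_iff]
  intro ε hε
  have hcpt : IsCompact (Set.range α) := isCompact_range α.continuous
  -- `E` need not be locally compact. Compactness of the range of `α` still gives one `δ` for all
  -- pairs whose first point lies in that range.
  have huc := hcpt.uniformContinuousAt_of_continuousAt (fderiv ℝ G)
    (fun x _ => (hG.continuous_fderiv one_ne_zero).continuousAt) (Metric.dist_mem_uniformity hε)
  obtain ⟨δ, hδ, hδ'⟩ := Metric.mem_uniformity_dist.1 huc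
  filter_upwards [Metric.ball_mem_nhds α hδ] with β hβ
  rw [ContinuousMap.norm_le _ (by positivity)]
  intro t
  have hd : dist (β t) (α t) < δ := (ContinuousMap.dist_apply_le_dist t).trans_lt hβ
  have key := (convex_ball (α t) δ).norm_image_sub_le_of_norm_fderiv_le' (𝕜 := ℝ) (f := G)
    (φ := fderiv ℝ G (α t)) (C := ε) (x := α t) (y := β t)
    (fun x _ => (hG.differentiable one_ne_zero) x)
    (fun x hx => by
      rw [← dist_eq_norm, dist_comm]
      exact le_of_lt (hδ' (by rw [dist_comm]; exact hx) ⟨t, rfl⟩))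
    (Metric.mem_ball_self hδ) hd
  refine key.trans ?_
  gcongr
  exact (β - α).norm_coe_le_norm t

/-- The superposition operator `α ↦ G ∘ α` is `C^n` when `G` is. -/
lemma contDiff_superposition_nat (n : ℕ) : ∀ {F : Type} [NormedAddCommGroup F] [NormedSpace ℝ F]
    {G : E → F} (hG : ContDiff ℝ n G),
    ContDiff ℝ n (fun α : C(K, E) => (⟨G, hG.continuous⟩ : C(E, F)).comp α) := by
  induction n with
  | zero =>
    intro F _ _ G hG
    exact contDiff_zero.2 (ContinuousMap.continuous_postcomp _)
  | succ n ih =>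
    intro F _ _ G hG
    have hG1 : ContDiff ℝ 1 G := hG.of_le (by exact_mod_cast Nat.le_add_left 1 n)
    have hG' : ContDiff ℝ n (fderiv ℝ G) := hG.fderiv_right (by norm_cast)
    suffices h : ContDiff ℝ ((n : WithTop ℕ∞) + 1)
        (fun α : C(K, E) => (⟨G, hG.continuous⟩ : C(E, F)).comp α) from h.of_le (by push_cast; rfl)
    rw [contDiff_succ_iff_fderiv]
    refine ⟨fun α => (hasFDerivAt_superposition hG1 α).differentiableAt, by simp, ?_⟩
    -- The derivative is again a superposition operator, that of `fderiv ℝ G`, followed by a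
    -- continuous linear map. Its target space differs from `F`, hence the induction over all `F`.
    have : fderiv ℝ (fun α : C(K, E) => (⟨G, hG.continuous⟩ : C(E, F)).comp α) =
        fun α => pointwiseApply K E F ((⟨fderiv ℝ G, hG'.continuous⟩ : C(E, E →L[ℝ] F)).comp α) :=
      funext fun α => (hasFDerivAt_superposition hG1 α).fderiv
    rw [this]
    exact (pointwiseApply K E F).contDiff.comp (ih hG')

lemma contDiff_superposition {G : E → F} (hG : ContDiff ℝ ∞ G) :
    ContDiff ℝ ∞ (fun α : C(K, E) => (⟨G, hG.continuous⟩ : C(E, F)).comp α) :=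
  contDiff_infty.2 fun n => contDiff_superposition_nat n (hG.of_le (by exact_mod_cast le_top))

end Superposition

/-! ### Extension of smooth germs to globally smooth functions. -/

section Cutoff

variable {E F : Type} [NormedAddCommGroup E] [NormedSpace ℝ E] [FiniteDimensional ℝ E]
  [NormedAddCommGroup F] [NormedSpace ℝ F]

/-- A function smooth on a neighbourhood of a point agrees near this point with a function smooth
everywhere. -/
lemma exists_contDiff_eventuallyEq {f : E → F} {U : Set E} {x : E} (hU : U ∈ 𝓝 x)
    (hf : ContDiffOn ℝ ∞ f U) : ∃ g : E → F, ContDiff ℝ ∞ g ∧ g =ᶠ[𝓝 x] f := by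
  obtain ⟨V, hVU, hV, hxV⟩ := mem_nhds_iff.1 hU
  obtain ⟨W, hW, hWc, hWV⟩ := exists_mem_nhds_isClosed_subset (hV.mem_nhds hxV)
  let χ : ContDiffBump x :=
    ⟨(Metric.mem_nhds_iff.1 hW).choose / 4, (Metric.mem_nhds_iff.1 hW).choose / 2,
      by have := (Metric.mem_nhds_iff.1 hW).choose_spec.1; simp only [gt_iff_lt] at this; linarith,
      by have := (Metric.mem_nhds_iff.1 hW).choose_spec.1; simp only [gt_iff_lt] at this; linarith⟩
  have hsupp : tsupport χ ⊆ V := by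
    rw [χ.tsupport_eq]
    refine subset_trans ?_ ((Metric.mem_nhds_iff.1 hW).choose_spec.2.trans hWV)
    apply Metric.closedBall_subset_ball
    have := (Metric.mem_nhds_iff.1 hW).choose_spec.1
    simp only [gt_iff_lt] at this
    change (Metric.mem_nhds_iff.1 hW).choose / 2 < _
    linarith
  refine ⟨fun y => χ y • f y, ?_, ?_⟩
  · rw [contDiff_iff_contDiffAt]
    intro y
    by_cases hy : y ∈ V
    · exact χ.contDiffAt.smul ((hf.mono hVU).contDiffAt (hV.mem_nhds hy))
    · have : (fun y => χ y • f y) =ᶠ[𝓝 y] fun _ => 0 := by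
        have hy' : y ∉ tsupport χ := fun h => hy (hsupp h)
        filter_upwards [(isClosed_tsupport χ).isOpen_compl.mem_nhds hy'] with z hz
        rw [image_eq_zero_of_notMem_tsupport hz, zero_smul]
      exact contDiffAt_const.congr_of_eventuallyEq this
  · filter_upwards [χ.eventuallyEq_one] with y hy
    rw [hy]; simp

end Cutoff

/-! ### The inverse function theorem on a neighbourhood. -/

section InverseFunction

variable {E F : Type} [NormedAddCommGroup E] [NormedSpace ℝ E] [CompleteSpace E]
  [NormedAddCommGroup F] [NormedSpace ℝ F]

/-- The inverse function theorem, with pointwise control of the smoothness of the inverse on a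
whole neighbourhood. -/
lemma exists_openPartialHomeomorph {f : E → F} {a : E} (hf : ContDiffAt ℝ ∞ f a)
    {e : E ≃L[ℝ] F} (he : fderiv ℝ f a = e) {U : Set E} (hU : U ∈ 𝓝 a) :
    ∃ Ψ : OpenPartialHomeomorph E F, a ∈ Ψ.source ∧ Ψ.source ⊆ U ∧ (Ψ : E → F) = f ∧
      (∀ z ∈ Ψ.source, ContDiffAt ℝ ∞ f z → ContDiffAt ℝ ∞ Ψ.symm (f z)) ∧
      (∀ z ∈ Ψ.source, DifferentiableAt ℝ f z ∧ ∃ e' : E ≃L[ℝ] F, fderiv ℝ f z = e') := by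
  have hf1 : ContDiffAt ℝ 1 f a := hf.of_le (by exact_mod_cast le_top)
  have hd : HasFDerivAt f (e : E →L[ℝ] F) a := by
    rw [← he]; exact (hf1.differentiableAt one_ne_zero).hasFDerivAt
  let Ψ₀ := hf1.toOpenPartialHomeomorph f hd one_ne_zero
  have hc : ContinuousAt (fderiv ℝ f) a :=
    (hf.fderiv_right (m := 0) (by simp)).continuousAt
  have hev : ∀ᶠ z in 𝓝 a, z ∈ U ∧ DifferentiableAt ℝ f z ∧
      ∃ e' : E ≃L[ℝ] F, fderiv ℝ f z = e' := by
    refine Filter.Eventually.and hU (Filter.Eventually.and ?_ ?_)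
    · exact (hf1.eventually (by simp)).mono fun z hz => hz.differentiableAt one_ne_zero
    · have : Set.range ((↑) : (E ≃L[ℝ] F) → (E →L[ℝ] F)) ∈ 𝓝 (fderiv ℝ f a) := by
        rw [he]; exact ContinuousLinearEquiv.nhds e
      filter_upwards [hc this] with z hz
      obtain ⟨e', he'⟩ := hz
      exact ⟨e', he'.symm⟩
  let V := {z | z ∈ U ∧ DifferentiableAt ℝ f z ∧ ∃ e' : E ≃L[ℝ] F, fderiv ℝ f z = e'}
  have hsub : (Ψ₀.restr V).source ⊆ V := by
    rw [Ψ₀.restr_source]; exact Set.inter_subset_right.trans interior_subset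
  refine ⟨Ψ₀.restr V, ?_, fun z hz => (hsub hz).1, rfl, fun z hz hfz => ?_,
    fun z hz => (hsub hz).2⟩
  · rw [Ψ₀.restr_source]
    exact ⟨hf1.mem_toOpenPartialHomeomorph_source hd one_ne_zero, mem_interior_iff_mem_nhds.2 hev⟩
  · obtain ⟨-, hdz, e', he'⟩ := hsub hz
    have hz' : (Ψ₀.restr V).symm (f z) = z := (Ψ₀.restr V).left_inv hz
    refine OpenPartialHomeomorph.contDiffAt_symm (f₀' := e') _ ((Ψ₀.restr V).map_source hz) ?_ ?_
    · rw [hz', ← he']; exact hdz.hasFDerivAt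
    · rw [hz']; exact hfz

end InverseFunction

set_option linter.unusedSectionVars false

/-! ### Integration as a bounded operator on `C([-1, 1], E)`. -/

section Primitive

/-- The interval `[-1, 1]`. -/
abbrev SymmIcc : Type := Set.Icc (-1 : ℝ) 1

variable {E F : Type} [NormedAddCommGroup E] [NormedSpace ℝ E]
  [NormedAddCommGroup F] [NormedSpace ℝ F]

/-- The extension of a function on `[-1, 1]` to `ℝ` by constants. -/
def extend (α : C(SymmIcc, E)) : ℝ → E := Set.IccExtend (by norm_num : (-1 : ℝ) ≤ 1) α

lemma continuous_extend (α : C(SymmIcc, E)) : Continuous (extend α) := α.continuous.Icc_extend'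

lemma extend_of_mem (α : C(SymmIcc, E)) {t : ℝ} (ht : t ∈ Set.Icc (-1 : ℝ) 1) :
    extend α t = α ⟨t, ht⟩ := Set.IccExtend_of_mem _ _ ht

lemma norm_extend_le (α : C(SymmIcc, E)) (t : ℝ) : ‖extend α t‖ ≤ ‖α‖ :=
  α.norm_coe_le_norm _

/-- The primitive vanishing at `0`, as an operator on the continuous functions on `[-1, 1]`. -/
def primitive (E : Type) [NormedAddCommGroup E] [NormedSpace ℝ E] :
    C(SymmIcc, E) →L[ℝ] C(SymmIcc, E) :=
  LinearMap.mkContinuous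
    { toFun := fun α => ⟨fun t => ∫ s in (0 : ℝ)..t, extend α s,
        (intervalIntegral.continuous_primitive
          (fun a b => (continuous_extend α).intervalIntegrable a b) 0).comp continuous_subtype_val⟩
      map_add' := fun α β => by
        ext t
        exact intervalIntegral.integral_add ((continuous_extend α).intervalIntegrable _ _)
          ((continuous_extend β).intervalIntegrable _ _)
      map_smul' := fun c α => by
        ext t
        exact intervalIntegral.integral_smul c _ } 1
    (fun α => by
      rw [one_mul, ContinuousMap.norm_le _ (norm_nonneg _)]
      intro t
      refine (intervalIntegral.norm_integral_le_of_norm_le_const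
        (fun s _ => norm_extend_le α s)).trans ?_
      have : |(t : ℝ) - 0| ≤ 1 := by rw [sub_zero]; exact abs_le.2 t.2
      exact mul_le_of_le_one_right (norm_nonneg _) this)

lemma contDiff_primitive_apply (t : SymmIcc) :
    ContDiff ℝ ∞ (fun α : C(SymmIcc, E) => primitive E α t) :=
  ((ContinuousMap.evalCLM ℝ t).comp (primitive E)).contDiff

/-- Constant functions, as a continuous linear map. -/
def constantCLM (K E : Type) [TopologicalSpace K] [CompactSpace K] [NormedAddCommGroup E]
    [NormedSpace ℝ E] : E →L[ℝ] C(K, E) :=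
  LinearMap.mkContinuous
    { toFun := fun b => ContinuousMap.const K b
      map_add' := fun _ _ => rfl
      map_smul' := fun _ _ => rfl } 1
    (fun b => by
      rw [one_mul, ContinuousMap.norm_le _ (norm_nonneg _)]
      intro t
      exact le_rfl)

@[simp] lemma constantCLM_apply {K : Type} [TopologicalSpace K] [CompactSpace K] (b : E) (t : K) :
    constantCLM K E b t = b := rfl

end Primitive

/-! ### Hadamard's lemma for projections and for submersions. -/

section Factorization

variable {E F Y : Type} [NormedAddCommGroup E] [NormedSpace ℝ E] [FiniteDimensional ℝ E]
  [NormedAddCommGroup F] [NormedSpace ℝ F] [CompleteSpace F]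
  [NormedAddCommGroup Y] [NormedSpace ℝ Y]

/-- Hadamard's lemma: a smooth function vanishing on the kernel of a projection factors smoothly
through this projection. -/
lemma exists_factor_projection {G : E → F} (hG : ContDiff ℝ ∞ G) (Q : E →L[ℝ] E) :
    ∃ S : E → (E →L[ℝ] F), ContDiff ℝ ∞ S ∧ ∀ y, G y - G (y - Q y) = S y (Q y) := by
  have hG' : ContDiff ℝ ∞ (fderiv ℝ G) := hG.fderiv_right (by simp)
  -- `γ y` is the path `t ↦ y - (1 - t) Q y`, which runs from `y - Q y` at `t = 0` to `y` at `t =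
  -- 1`, and `S y` is the integral of `fderiv ℝ G` over this part. Building `S` from superposition
  -- and primitive operators makes its smoothness in `y` a matter of composition.
  let A : C(SymmIcc, E →L[ℝ] E) :=
    ⟨fun t => ContinuousLinearMap.id ℝ E - (1 - (t : ℝ)) • Q, by fun_prop⟩
  let γ : E →L[ℝ] C(SymmIcc, E) := (pointwiseApply SymmIcc E E A).comp (constantCLM SymmIcc E)
  let N : E → C(SymmIcc, E →L[ℝ] F) := fun y =>
    (⟨fderiv ℝ G, hG'.continuous⟩ : C(E, E →L[ℝ] F)).comp (γ y)
  have hN : ContDiff ℝ ∞ N := (contDiff_superposition hG').comp γ.contDiff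
  let ev := fun α => primitive (E →L[ℝ] F) α ⟨1, by norm_num⟩
  refine ⟨fun y => ev (N y), (contDiff_primitive_apply _).comp hN, ?_⟩
  intro y
  have h1 : ∀ t : ℝ, HasDerivAt (fun t : ℝ => G (y - (1 - t) • Q y))
      (fderiv ℝ G (y - (1 - t) • Q y) (Q y)) t := by
    intro t
    have hl : HasDerivAt (fun t : ℝ => y - (1 - t) • Q y) (Q y) t := by
      have := (((hasDerivAt_id t).const_sub 1).smul_const (Q y)).const_sub y
      simpa using this
    exact ((hG.differentiable (by simp)) _).hasFDerivAt.comp_hasDerivAt t hl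
  have hcont : Continuous fun t : ℝ => fderiv ℝ G (y - (1 - t) • Q y) :=
    hG'.continuous.comp (by fun_prop)
  have h2 := intervalIntegral.integral_eq_sub_of_hasDerivAt (a := 0) (b := 1)
    (fun t _ => h1 t) ((hcont.clm_apply continuous_const).intervalIntegrable _ _)
  have h3 : ev (N y) = ∫ t in (0 : ℝ)..1, fderiv ℝ G (y - (1 - t) • Q y) := by
    change ∫ s in (0 : ℝ)..1, extend (N y) s = _
    refine intervalIntegral.integral_congr fun t ht => ?_
    rw [Set.uIcc_of_le zero_le_one] at ht
    rw [extend_of_mem _ (⟨by linarith [ht.1], ht.2⟩ : t ∈ Set.Icc (-1 : ℝ) 1)]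
    simp [N, γ, A]
  change _ = ev (N y) (Q y)
  rw [h3, ContinuousLinearMap.intervalIntegral_apply (hcont.intervalIntegrable _ _), h2]
  simp

/-- A smooth function vanishing on the zero set of a submersion `T` is, locally, a smooth linear
function of `T`. -/
lemma exists_factor_submersion [FiniteDimensional ℝ Y] {T : E → Y} {G : E → F} {p : E} {U : Set E}
    (hU : U ∈ 𝓝 p) (hT : ContDiffOn ℝ ∞ T U) (hTp : T p = 0)
    (hsurj : Function.Surjective (fderiv ℝ T p)) (hG : ContDiffOn ℝ ∞ G U)
    (hzero : ∀ j ∈ U, T j = 0 → G j = 0) :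
    ∃ S : E → (Y →L[ℝ] F), ∃ V ∈ 𝓝 p, ContDiffOn ℝ ∞ S V ∧ ∀ j ∈ V, G j = S j (T j) := by
  obtain ⟨O, hOU, hO, hpO⟩ := mem_nhds_iff.1 hU
  have hTp' : ContDiffAt ℝ ∞ T p := hT.contDiffAt hU
  set L := fderiv ℝ T p with hL
  obtain ⟨R, hR⟩ := L.exists_rightInverse_of_surjective (LinearMap.range_eq_top.2 hsurj)
  have hLR : ∀ y, L (R y) = y := fun y => by
    have := congrArg (fun A => A y) hR
    simpa using this
  -- These coordinates linearise `T`: since `L ∘ R = id`, one has `L (f j) = T j`, and the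
  -- differential of `f` at `p` is the identity. In them, `w - R (L w)` lies in the kernel of `L`,
  -- that is, on the zero set of `T`.
  let f : E → E := fun j => R (T j) + (j - p) - R (L (j - p))
  have hfO : ∀ j ∈ O, ContDiffAt ℝ ∞ f j := fun j hj => by
    have h1 : ContDiffAt ℝ ∞ T j := hT.contDiffAt (Filter.mem_of_superset (hO.mem_nhds hj) hOU)
    have h2 : ContDiffAt ℝ ∞ (fun j => R (T j)) j := R.contDiff.contDiffAt.comp j h1
    have h3 : ContDiff ℝ ∞ (fun j => R (L (j - p))) :=
      R.contDiff.comp (L.contDiff.comp (contDiff_id.sub contDiff_const))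
    exact (h2.add (contDiff_id.sub contDiff_const).contDiffAt).sub h3.contDiffAt
  have hfd : fderiv ℝ f p = (ContinuousLinearEquiv.refl ℝ E : E →L[ℝ] E) := by
    have h1 : HasFDerivAt T L p := (hTp'.differentiableAt (by simp)).hasFDerivAt
    have h2 : HasFDerivAt (fun j => R (T j)) (R.comp L) p := R.hasFDerivAt.comp p h1
    have h0 : HasFDerivAt (fun j : E => j - p) (ContinuousLinearMap.id ℝ E) p :=
      (hasFDerivAt_id p).sub_const p
    have h3 : HasFDerivAt (fun j => R (L (j - p))) (R.comp L) p := by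
      exact (R.comp L).hasFDerivAt.comp (f := fun j : E => j - p) p h0
    have h4 := ((h2.add h0).sub h3).fderiv
    have h5 : fderiv ℝ f p = R.comp L + ContinuousLinearMap.id ℝ E - R.comp L := h4
    rw [h5, add_sub_cancel_left]; rfl
  have hLf : ∀ j, L (f j) = T j := fun j => by simp [f, hLR]
  obtain ⟨Ψ, hpΨ, hΨO, hΨf, hΨs, -⟩ :=
    exists_openPartialHomeomorph (hfO p hpO) hfd (hO.mem_nhds hpO)
  have hfp : f p = 0 := by simp [f, hTp]
  have hsm : ContDiffOn ℝ ∞ (G ∘ Ψ.symm) Ψ.target := by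
    intro w hw
    have hz := Ψ.map_target hw
    have e1 : f (Ψ.symm w) = w := by rw [← hΨf]; exact Ψ.right_inv hw
    have h1 := hΨs _ hz (hfO _ (hΨO hz))
    rw [e1] at h1
    refine (ContDiffAt.comp w ?_ h1).contDiffWithinAt
    exact hG.contDiffAt (Filter.mem_of_superset (hO.mem_nhds (hΨO hz)) hOU)
  have h0t : (0 : E) ∈ Ψ.target := by
    rw [← hfp, ← hΨf]; exact Ψ.map_source hpΨ
  obtain ⟨G', hG', hGG'⟩ := exists_contDiff_eventuallyEq (Ψ.open_target.mem_nhds h0t) hsm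
  obtain ⟨S, hS, hSG⟩ := exists_factor_projection hG' (R.comp L)
  have hev : ∀ᶠ w in 𝓝 (0 : E), G' w = G (Ψ.symm w) ∧ w ∈ Ψ.target :=
    hGG'.and (Ψ.open_target.mem_nhds h0t)
  have hev2 : ∀ᶠ w in 𝓝 (0 : E), G' (w - R (L w)) = G (Ψ.symm (w - R (L w))) ∧
      w - R (L w) ∈ Ψ.target := by
    have hc : Filter.Tendsto (fun w : E => w - R (L w)) (𝓝 0) (𝓝 0) := by
      have : Continuous fun w : E => w - R (L w) := by fun_prop
      simpa using this.tendsto 0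
    exact hc hev
  have hfc : Filter.Tendsto f (𝓝 p) (𝓝 0) := by
    have := (hfO p hpO).continuousAt.tendsto
    rwa [hfp] at this
  obtain ⟨V, hV, hVo, hpV⟩ := mem_nhds_iff.1
    (((hfc.eventually hev).and (hfc.eventually hev2)).and (Ψ.open_source.mem_nhds hpΨ))
  -- Hadamard's lemma with `Q = R ∘ L` gives `G j = S (f j) (R (L (f j)))`, and `L (f j) = T j`.
  refine ⟨fun j => (S (f j)).comp R, V, hVo.mem_nhds hpV, ?_, ?_⟩
  · intro j hj
    have h1 : ContDiffAt ℝ ∞ (fun j => S (f j)) j :=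
      hS.contDiffAt.comp j (hfO j (hΨO (hV hj).2))
    exact (h1.clm_comp contDiffAt_const).contDiffWithinAt
  · intro j hj
    obtain ⟨⟨⟨h1, -⟩, h2, h2'⟩, h3⟩ := hV hj
    have e1 : Ψ.symm (f j) = j := by rw [← hΨf]; exact Ψ.left_inv h3
    have e2 := hSG (f j)
    have e3 : G (Ψ.symm (f j - R (L (f j)))) = 0 := by
      apply hzero _ (hOU (hΨO (Ψ.map_target h2')))
      rw [← hLf]
      have : f (Ψ.symm (f j - R (L (f j)))) = f j - R (L (f j)) :=
        (congrFun hΨf _).symm.trans (Ψ.right_inv h2')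
      rw [this]; simp [hLR]
    have h1' : G' (f j) = G (Ψ.symm (f j)) := h1
    have h2'' : G' (f j - R (L (f j))) = G (Ψ.symm (f j - R (L (f j)))) := h2
    simp only [ContinuousLinearMap.comp_apply] at e2
    rw [h1', h2'', e3, e1, sub_zero] at e2
    rw [e2]; simp [hLf]

end Factorization

/-! ### Local flows through the inverse function theorem in `C([-1, 1], E)`. -/

section Flow

variable {E : Type} [NormedAddCommGroup E] [NormedSpace ℝ E] [CompleteSpace E]

/-- Near a trajectory of length zero, the integral equation `α = b + ε ∫ X ∘ α` has a unique
solution, which depends smoothly on `(ε, b)`. -/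
lemma exists_integralEquation_solution {X : E → E} (hX : ContDiff ℝ ∞ X) (b₀ : E) :
    ∃ (a : ℝ × E → C(SymmIcc, E)) (r : ℝ), 0 < r ∧
      (∀ ε b, |ε| < r → ‖b - b₀‖ < r → ContDiffAt ℝ ∞ a (ε, b) ∧
        ∀ t : SymmIcc, a (ε, b) t = b + ε • ∫ s in (0 : ℝ)..t, X (extend (a (ε, b)) s)) ∧
      (∀ ε b, |ε| < r → ‖b - b₀‖ < r → ∀ τ ∈ Set.Icc (-1 : ℝ) 1, ∀ β : C(SymmIcc, E),
        (∀ t : SymmIcc, β t = extend (a (ε, b)) (τ * t)) →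
        (∀ t : SymmIcc, β t = b + (ε * τ) • ∫ s in (0 : ℝ)..t, X (extend β s)) →
        a (ε * τ, b) = β) := by
  let N : C(SymmIcc, E) → C(SymmIcc, E) := fun α =>
    primitive E ((⟨X, hX.continuous⟩ : C(E, E)).comp α)
  have hN : ContDiff ℝ ∞ N := (primitive E).contDiff.comp (contDiff_superposition hX)
  have hNa : ∀ α t, N α t = ∫ s in (0 : ℝ)..t, X (extend α s) := fun α t => rfl
  -- The integral equation is the vanishing of the last component. At `ε = 0` the differential of
  -- this map is unipotent, hence invertible without any smallness condition on `X`.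
  let f : ℝ × E × C(SymmIcc, E) → ℝ × E × C(SymmIcc, E) := fun p =>
    (p.1, p.2.1, p.2.2 - constantCLM SymmIcc E p.2.1 - p.1 • N p.2.2)
  have hf : ContDiff ℝ ∞ f := by
    refine contDiff_fst.prodMk ((contDiff_fst.comp contDiff_snd).prodMk ?_)
    refine ((contDiff_snd.comp contDiff_snd).sub
      ((constantCLM SymmIcc E).contDiff.comp (contDiff_fst.comp contDiff_snd))).sub ?_
    exact contDiff_fst.smul (hN.comp (contDiff_snd.comp contDiff_snd))
  set p₀ : ℝ × E × C(SymmIcc, E) := (0, b₀, constantCLM SymmIcc E b₀) with hp₀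
  let c := N (constantCLM SymmIcc E b₀)
  let π₁ : ℝ × E × C(SymmIcc, E) →L[ℝ] ℝ := ContinuousLinearMap.fst ℝ ℝ (E × C(SymmIcc, E))
  let π₂ : ℝ × E × C(SymmIcc, E) →L[ℝ] E := (ContinuousLinearMap.fst ℝ E C(SymmIcc, E)).comp
    (ContinuousLinearMap.snd ℝ ℝ (E × C(SymmIcc, E)))
  let π₃ : ℝ × E × C(SymmIcc, E) →L[ℝ] C(SymmIcc, E) :=
    (ContinuousLinearMap.snd ℝ E C(SymmIcc, E)).comp
      (ContinuousLinearMap.snd ℝ ℝ (E × C(SymmIcc, E)))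
  let D : (ℝ × E × C(SymmIcc, E)) ≃L[ℝ] (ℝ × E × C(SymmIcc, E)) :=
    ContinuousLinearEquiv.equivOfInverse
      (π₁.prod (π₂.prod (π₃ - (constantCLM SymmIcc E).comp π₂ - π₁.smulRight c)))
      (π₁.prod (π₂.prod (π₃ + (constantCLM SymmIcc E).comp π₂ + π₁.smulRight c)))
      (fun p => by
        refine Prod.ext rfl (Prod.ext rfl ?_)
        simp [π₁, π₂, π₃]; abel)
      (fun p => by
        refine Prod.ext rfl (Prod.ext rfl ?_)
        simp [π₁, π₂, π₃]; abel)
  have hD : fderiv ℝ f p₀ = D := by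
    apply HasFDerivAt.fderiv
    have h1 : HasFDerivAt (fun p : ℝ × E × C(SymmIcc, E) => p.1) π₁ p₀ := π₁.hasFDerivAt
    have h2 : HasFDerivAt (fun p : ℝ × E × C(SymmIcc, E) => p.2.1) π₂ p₀ := π₂.hasFDerivAt
    have h3 : HasFDerivAt (fun p : ℝ × E × C(SymmIcc, E) => p.2.2) π₃ p₀ := π₃.hasFDerivAt
    have h4 : HasFDerivAt (fun p : ℝ × E × C(SymmIcc, E) => constantCLM SymmIcc E p.2.1)
        ((constantCLM SymmIcc E).comp π₂) p₀ :=
      (constantCLM SymmIcc E).hasFDerivAt.comp p₀ h2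
    have h5 := ((hN.differentiable (by simp)) p₀.2.2).hasFDerivAt.comp p₀ h3
    have h6 := h1.smul h5
    have h7 := h1.prodMk (h2.prodMk ((h3.sub h4).sub h6))
    refine h7.congr_fderiv ?_
    refine ContinuousLinearMap.ext fun p => Prod.ext rfl (Prod.ext rfl ?_)
    simp [D, hp₀, c, π₁, π₂, π₃]
  obtain ⟨Ψ, hpΨ, -, hΨf, hΨs, -⟩ :=
    exists_openPartialHomeomorph hf.contDiffAt hD Filter.univ_mem
  have hfp : f p₀ = (0, b₀, 0) := by simp [f, hp₀]
  let a : ℝ × E → C(SymmIcc, E) := fun q => (Ψ.symm (q.1, q.2, 0)).2.2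
  have hpt : ((0, b₀, 0) : ℝ × E × C(SymmIcc, E)) ∈ Ψ.target := by
    rw [← hfp, ← hΨf]; exact Ψ.map_source hpΨ
  have hi : Continuous fun q : ℝ × E => ((q.1, q.2, 0) : ℝ × E × C(SymmIcc, E)) := by fun_prop
  have hia : ContDiff ℝ ∞ fun q : ℝ × E => ((q.1, q.2, 0) : ℝ × E × C(SymmIcc, E)) :=
    contDiff_fst.prodMk (contDiff_snd.prodMk contDiff_const)
  have hsol : ∀ q : ℝ × E, ((q.1, q.2, 0) : ℝ × E × C(SymmIcc, E)) ∈ Ψ.target →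
      Ψ.symm (q.1, q.2, 0) = (q.1, q.2, a q) ∧ ContDiffAt ℝ ∞ a q ∧
      ∀ t : SymmIcc, a q t = q.2 + q.1 • ∫ s in (0 : ℝ)..t, X (extend (a q) s) := by
    intro q hq
    have h1 : f (Ψ.symm (q.1, q.2, 0)) = (q.1, q.2, 0) := by
      conv_lhs => rw [← hΨf]
      exact Ψ.right_inv hq
    have h2 : Ψ.symm (q.1, q.2, 0) = (q.1, q.2, a q) := by
      refine Prod.ext (congrArg (fun p => p.1) h1) (Prod.ext (congrArg (fun p => p.2.1) h1) rfl)
    refine ⟨h2, ?_, fun t => ?_⟩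
    · have h3 := hΨs _ (Ψ.map_target hq) hf.contDiffAt
      rw [h1] at h3
      have h4 := ContDiffAt.comp (f := fun q : ℝ × E => ((q.1, q.2, 0) : ℝ × E × C(SymmIcc, E))) q
        h3 hia.contDiffAt
      exact contDiffAt_snd.comp q (contDiffAt_snd.comp q h4)
    · rw [h2] at h1
      have h3 : a q - constantCLM SymmIcc E q.2 - q.1 • N (a q) = 0 :=
        congrArg (fun p => p.2.2) h1
      have h4 := congrArg (fun α => α t) h3
      have h5 : a q t - q.2 - q.1 • (∫ s in (0 : ℝ)..t, X (extend (a q) s)) = 0 := h4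
      rw [sub_sub, sub_eq_zero] at h5
      exact h5
  have ha0 : a (0, b₀) = constantCLM SymmIcc E b₀ := by
    have : Ψ.symm (0, b₀, 0) = p₀ := by rw [← hfp, ← hΨf]; exact Ψ.left_inv hpΨ
    change (Ψ.symm (0, b₀, 0)).2.2 = _
    rw [this]
  have hac : ContinuousAt a (0, b₀) := ((hsol (0, b₀) hpt).2.1).continuousAt
  obtain ⟨ρ, hρ, hρs⟩ := Metric.isOpen_iff.1 Ψ.open_source p₀ hpΨ
  have hev : ∀ᶠ q in 𝓝 ((0, b₀) : ℝ × E),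
      ((q.1, q.2, 0) : ℝ × E × C(SymmIcc, E)) ∈ Ψ.target ∧ dist (a q) (a (0, b₀)) < ρ :=
    (hi.continuousAt.eventually (Ψ.open_target.mem_nhds hpt)).and
      (hac.eventually (Metric.ball_mem_nhds _ hρ))
  obtain ⟨r, hr, hrs⟩ := Metric.eventually_nhds_iff_ball.1 hev
  have hball : ∀ ε b, |ε| < min r ρ → ‖b - b₀‖ < min r ρ →
      (ε, b) ∈ Metric.ball ((0, b₀) : ℝ × E) r := by
    intro ε b hε hb
    rw [Metric.mem_ball, Prod.dist_eq, max_lt_iff, dist_eq_norm, dist_eq_norm]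
    simp only [sub_zero, Real.norm_eq_abs]
    exact ⟨hε.trans_le (min_le_left _ _), hb.trans_le (min_le_left _ _)⟩
  refine ⟨a, min r ρ, lt_min hr hρ, fun ε b hε hb => ?_, fun ε b hε hb τ hτ β hβ1 hβ2 => ?_⟩
  · exact (hsol (ε, b) (hrs _ (hball ε b hε hb)).1).2
  -- Uniqueness is injectivity of `f` on the domain of the local inverse. The curve `β` takes only
  -- values of `a (ε, b)`, so it is as close to the constant `b₀` as that curve is.
  · have hmem : ((ε * τ, b, β) : ℝ × E × C(SymmIcc, E)) ∈ Ψ.source := by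
      apply hρs
      have hετ : |ε * τ| < ρ := by
        rw [abs_mul]
        exact (mul_le_of_le_one_right (abs_nonneg _) (abs_le.2 hτ)).trans_lt
          (hε.trans_le (min_le_right _ _))
      have hβ : dist β (constantCLM SymmIcc E b₀) < ρ := by
        rw [ContinuousMap.dist_lt_iff hρ]
        intro t
        rw [hβ1 t]
        refine lt_of_le_of_lt ?_ (hrs _ (hball ε b hε hb)).2
        rw [ha0]
        exact ContinuousMap.dist_apply_le_dist (f := a (ε, b)) (g := constantCLM SymmIcc E b₀) _
      rw [Metric.mem_ball, Prod.dist_eq, Prod.dist_eq, max_lt_iff, max_lt_iff]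
      refine ⟨?_, ?_, hβ⟩
      · rw [dist_eq_norm]; simpa [hp₀] using hετ
      · rw [dist_eq_norm]; exact hb.trans_le (min_le_right _ _)
    have h1 : f (ε * τ, b, β) = (ε * τ, b, 0) := by
      refine Prod.ext rfl (Prod.ext rfl ?_)
      ext t
      change β t - b - (ε * τ) • N β t = 0
      rw [hNa, sub_sub, sub_eq_zero]
      exact hβ2 t
    change (Ψ.symm (ε * τ, b, 0)).2.2 = β
    rw [← h1, ← hΨf, Ψ.left_inv hmem]

/-- Existence and smoothness of the local flow of a smooth vector field. -/
lemma exists_contDiff_flow {X : E → E} (hX : ContDiff ℝ ∞ X) (b₀ : E) :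
    ∃ (Fl : ℝ × E → E), ∀ᶠ q in 𝓝 ((0, b₀) : ℝ × E), ContDiffAt ℝ ∞ Fl q ∧
      Fl (0, q.2) = q.2 ∧ HasDerivAt (fun s => Fl (s, q.2)) (X (Fl q)) q.1 := by
  obtain ⟨a, r, hr, hsol, huniq⟩ := exists_integralEquation_solution hX b₀
  have h1mem : (1 : ℝ) ∈ Set.Icc (-1 : ℝ) 1 := by norm_num
  have h0mem : (0 : ℝ) ∈ Set.Icc (-1 : ℝ) 1 := by norm_num
  let one : SymmIcc := ⟨1, h1mem⟩
  -- The solution with parameter `ε` is the trajectory run at speed `ε`, so its value at time `1` is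
  -- the flow at time `ε`.
  let Fl : ℝ × E → E := fun q => a q one
  have hev : ∀ᶠ q in 𝓝 ((0, b₀) : ℝ × E), |q.1| < r / 2 ∧ ‖q.2 - b₀‖ < r := by
    have h1 : Continuous fun q : ℝ × E => |q.1| := by fun_prop
    have h2 : Continuous fun q : ℝ × E => ‖q.2 - b₀‖ := by fun_prop
    exact (h1.continuousAt.eventually_lt continuousAt_const (by simpa using hr)).and
      (h2.continuousAt.eventually_lt continuousAt_const (by simpa using hr))
  refine ⟨Fl, ?_⟩
  filter_upwards [hev] with ⟨s₀, b⟩ ⟨hs₀, hb⟩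
  simp only at hs₀ hb ⊢
  -- With `ε` fixed, rescaling and uniqueness give `Fl (ε * τ, b) = a (ε, b) τ`. All short times,
  -- negative ones included because the interval is `[-1, 1]`, are thus read off one curve, and the
  -- differential equation follows from the fundamental theorem of calculus.
  set ε := r / 2 with hε
  have hεpos : 0 < ε := by positivity
  have hεr : |ε| < r := by rw [abs_of_pos hεpos]; linarith
  have hcX : ∀ α : C(SymmIcc, E), Continuous fun s => X (extend α s) :=
    fun α => hX.continuous.comp (continuous_extend α)
  have hA : ∀ τ ∈ Set.Icc (-1 : ℝ) 1, extend (a (ε, b)) τ =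
      b + ε • ∫ s in (0 : ℝ)..τ, X (extend (a (ε, b)) s) := by
    intro τ hτ
    rw [extend_of_mem _ hτ]
    exact (hsol ε b hεr hb).2 ⟨τ, hτ⟩
  have key : ∀ τ ∈ Set.Icc (-1 : ℝ) 1, Fl (ε * τ, b) = extend (a (ε, b)) τ := by
    intro τ hτ
    have hmul : ∀ t ∈ Set.Icc (-1 : ℝ) 1, τ * t ∈ Set.Icc (-1 : ℝ) 1 := by
      intro t ht
      rw [Set.mem_Icc, ← abs_le, abs_mul]
      exact mul_le_one₀ (abs_le.2 hτ) (abs_nonneg _) (abs_le.2 ht)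
    let β : C(SymmIcc, E) := ⟨fun t => extend (a (ε, b)) (τ * t),
      (continuous_extend _).comp (by fun_prop)⟩
    have hβ : a (ε * τ, b) = β := by
      refine huniq ε b hεr hb τ hτ β (fun t => rfl) (fun t => ?_)
      change extend (a (ε, b)) (τ * t) = _
      rw [hA _ (hmul t t.2), mul_smul]
      congr 2
      have h1 := intervalIntegral.smul_integral_comp_mul_left
        (fun s => X (extend (a (ε, b)) s)) τ (a := 0) (b := (t : ℝ))
      rw [mul_zero] at h1
      rw [← h1]
      congr 1
      refine intervalIntegral.integral_congr fun s hs => ?_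
      have hs' : s ∈ Set.Icc (-1 : ℝ) 1 :=
        (Set.uIcc_subset_Icc h0mem t.2) hs
      change _ = X (extend β s)
      rw [extend_of_mem β hs']
      rfl
    change a (ε * τ, b) one = _
    rw [hβ]
    change extend (a (ε, b)) (τ * 1) = _
    rw [mul_one]
  have hs₀r : |s₀| < r := by linarith
  refine ⟨?_, ?_, ?_⟩
  · have := (ContinuousMap.evalCLM ℝ one : C(SymmIcc, E) →L[ℝ] E).contDiff (n := ∞)
    exact this.contDiffAt.comp (s₀, b) (hsol s₀ b hs₀r hb).1
  · have := key 0 h0mem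
    rw [mul_zero, hA 0 h0mem] at this
    simpa using this
  · have hin : ∀ s, |s| < ε → s / ε ∈ Set.Ioo (-1 : ℝ) 1 := by
      intro s hs
      rw [Set.mem_Ioo, ← abs_lt, abs_div, abs_of_pos hεpos, div_lt_one hεpos]
      exact hs
    have hform : ∀ s, |s| < ε → Fl (s, b) =
        b + ε • ∫ σ in (0 : ℝ)..(s / ε), X (extend (a (ε, b)) σ) := by
      intro s hs
      have h1 := Set.Ioo_subset_Icc_self (hin s hs)
      rw [← hA _ h1, ← key _ h1, mul_div_cancel₀ _ hεpos.ne']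
    have hFTC : HasDerivAt (fun τ => ∫ σ in (0 : ℝ)..τ, X (extend (a (ε, b)) σ))
        (X (extend (a (ε, b)) (s₀ / ε))) (s₀ / ε) :=
      intervalIntegral.integral_hasDerivAt_right ((hcX _).intervalIntegrable _ _)
        ((hcX _).stronglyMeasurableAtFilter _ _) (hcX _).continuousAt
    have hdiv : HasDerivAt (fun s : ℝ => s / ε) (1 / ε) s₀ := (hasDerivAt_id s₀).div_const ε
    have h2 := ((hFTC.scomp s₀ hdiv).const_smul ε).const_add b
    have hval : ε • (1 / ε) • X (extend (a (ε, b)) (s₀ / ε)) = X (Fl (s₀, b)) := by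
      rw [smul_smul, mul_one_div_cancel hεpos.ne', one_smul,
        ← key _ (Set.Ioo_subset_Icc_self (hin s₀ hs₀)), mul_div_cancel₀ _ hεpos.ne']
    rw [hval] at h2
    refine h2.congr_of_eventuallyEq ?_
    have hc : ContinuousAt (fun s : ℝ => |s|) s₀ := continuous_abs.continuousAt
    filter_upwards [hc (Iio_mem_nhds hs₀)] with s hs
    exact hform s hs

end Flow

set_option linter.unusedSectionVars false

/-! ### The flow box theorem. -/

section FlowBox

variable {E : Type} [NormedAddCommGroup E] [NormedSpace ℝ E] [FiniteDimensional ℝ E]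

/-- The flow box theorem with prescribed derivative at the base point. -/
lemma exists_flowBox {X : E → E} {b₀ : E} {U : Set E} (hU : U ∈ 𝓝 b₀) (hX : ContDiffOn ℝ ∞ X U)
    (A : E ≃L[ℝ] E) {e : E} (ℓ : E →L[ℝ] ℝ) (hℓ : ℓ e = 1) (hA : A (X b₀) = e) :
    ∃ Φ : E → E, fderiv ℝ Φ b₀ = A ∧
      ∀ᶠ b in 𝓝 b₀, ContDiffAt ℝ ∞ Φ b ∧ fderiv ℝ Φ b (X b) = e := by
  have : CompleteSpace E := FiniteDimensional.complete ℝ E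
  obtain ⟨X', hX', hXX'⟩ := exists_contDiff_eventuallyEq hU hX
  obtain ⟨Fl, hFl⟩ := exists_contDiff_flow hX' b₀
  -- `Θ w` starts at `b₀ + A⁻¹ (w - ℓ w • e)` and flows for the time `ℓ w`, so translation by `t •
  -- e` becomes the flow. The differential of `Θ` at `0` is `A⁻¹` on the kernel of `ℓ`, and it sends
  -- `e` to `X b₀ = A⁻¹ e`. The required map is the local inverse of `Θ`.
  let P : E →L[ℝ] E := (A.symm : E →L[ℝ] E).comp (ContinuousLinearMap.id ℝ E - ℓ.smulRight e)
  let i : E → ℝ × E := fun w => (ℓ w, b₀ + P w)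
  have hi : ContDiff ℝ ∞ i := ℓ.contDiff.prodMk (contDiff_const.add P.contDiff)
  have hPe : P e = 0 := by simp [P, hℓ]
  have hi0 : i 0 = (0, b₀) := by simp [i]
  let Θ : E → E := fun w => Fl (i w)
  have hev : ∀ᶠ w in 𝓝 (0 : E), ContDiffAt ℝ ∞ Θ w ∧ fderiv ℝ Θ w e = X' (Θ w) := by
    have h1 : Filter.Tendsto i (𝓝 0) (𝓝 (0, b₀)) := by
      rw [← hi0]; exact hi.continuous.tendsto 0
    filter_upwards [h1.eventually hFl] with w ⟨hw1, _, hw3⟩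
    have hΘ : ContDiffAt ℝ ∞ Θ w := hw1.comp w hi.contDiffAt
    refine ⟨hΘ, ?_⟩
    have h2 : HasDerivAt (fun t : ℝ => w + t • e) e 0 := by
      simpa using ((hasDerivAt_id (0 : ℝ)).smul_const e).const_add w
    have h3 : HasFDerivAt Θ (fderiv ℝ Θ w) (w + (0 : ℝ) • e) := by
      rw [zero_smul, add_zero]; exact (hΘ.differentiableAt (by simp)).hasFDerivAt
    have h4 := h3.comp_hasDerivAt (0 : ℝ) h2
    have h5 : (Θ ∘ fun t : ℝ => w + t • e) = fun t => Fl (t + ℓ w, b₀ + P w) := by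
      funext t
      simp [Θ, i, hPe, hℓ, add_comm]
    have h6 : HasDerivAt (fun t => Fl (t + ℓ w, b₀ + P w)) (X' (Θ w)) 0 := by
      have : HasDerivAt (fun s => Fl (s, b₀ + P w)) (X' (Θ w)) (0 + ℓ w) := by
        rw [zero_add]; exact hw3
      exact this.comp_add_const 0 (ℓ w)
    rw [h5] at h4
    exact h4.unique h6
  have hFl0 := hFl.self_of_nhds
  have hΘ0 : Θ 0 = b₀ := by
    change Fl (i 0) = b₀
    rw [hi0]; exact hFl0.2.1
  have hX0 : X' b₀ = X b₀ := hXX'.self_of_nhds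
  have hD : fderiv ℝ Θ 0 = (A.symm : E →L[ℝ] E) := by
    have h1 : HasFDerivAt i (ℓ.prod P) 0 := ℓ.hasFDerivAt.prodMk (P.hasFDerivAt.const_add b₀)
    have h2 : HasFDerivAt Fl (fderiv ℝ Fl (0, b₀)) (i 0) := by
      rw [hi0]; exact (hFl0.1.differentiableAt (by simp)).hasFDerivAt
    have h3 : fderiv ℝ Θ 0 = (fderiv ℝ Fl (0, b₀)).comp (ℓ.prod P) := (h2.comp 0 h1).fderiv
    have h4 : ∀ v : E, fderiv ℝ Fl (0, b₀) (0, v) = v := by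
      intro v
      have h5 : HasFDerivAt (fun b : E => Fl (0, b))
          ((fderiv ℝ Fl (0, b₀)).comp (ContinuousLinearMap.inr ℝ ℝ E)) b₀ :=
        (hFl0.1.differentiableAt (by simp)).hasFDerivAt.comp b₀ (hasFDerivAt_prodMk_right 0 b₀)
      have h6 : HasFDerivAt (fun b : E => Fl (0, b)) (ContinuousLinearMap.id ℝ E) b₀ := by
        refine (hasFDerivAt_id b₀).congr_of_eventuallyEq ?_
        have hc : ContinuousAt (fun b : E => ((0 : ℝ), b)) b₀ := by fun_prop
        filter_upwards [hc.eventually hFl] with b hb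
        exact hb.2.1
      have := congrArg (fun L => L v) (h5.unique h6)
      simpa using this
    have h7 : fderiv ℝ Θ 0 e = X b₀ := by
      rw [hev.self_of_nhds.2, hΘ0, hX0]
    refine ContinuousLinearMap.ext fun v => ?_
    have h8 : v = (v - ℓ v • e) + ℓ v • e := by abel
    have h9 : fderiv ℝ Θ 0 (v - ℓ v • e) = A.symm (v - ℓ v • e) := by
      rw [h3]
      have : (ℓ.prod P) (v - ℓ v • e) = (0, A.symm (v - ℓ v • e)) := by
        simp [P, hℓ]
      rw [ContinuousLinearMap.comp_apply, this, h4]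
    rw [h8, map_add, map_add, map_smul, map_smul, h7, h9, ← hA]
    simp
  have hX'ev : ∀ᶠ w in 𝓝 (0 : E), X' (Θ w) = X (Θ w) := by
    have hc : Filter.Tendsto Θ (𝓝 0) (𝓝 b₀) := by
      have := hev.self_of_nhds.1.continuousAt.tendsto
      rwa [hΘ0] at this
    exact hc.eventually hXX'
  obtain ⟨Ψ, h0Ψ, hΨU, hΨf, hΨs, -⟩ := exists_openPartialHomeomorph
    hev.self_of_nhds.1 hD (hev.and hX'ev)
  have hbt : b₀ ∈ Ψ.target := by rw [← hΘ0, ← hΨf]; exact Ψ.map_source h0Ψ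
  have hb0 : Ψ.symm b₀ = 0 := by rw [← hΘ0, ← hΨf]; exact Ψ.left_inv h0Ψ
  have hcomp : ∀ b ∈ Ψ.target, ContDiffAt ℝ ∞ Ψ.symm b ∧ ∀ v,
      fderiv ℝ Ψ.symm b (fderiv ℝ Θ (Ψ.symm b) v) = v := by
    intro b hb
    have hz := Ψ.map_target hb
    have e1 : Θ (Ψ.symm b) = b := (congrFun hΨf _).symm.trans (Ψ.right_inv hb)
    have h1 := hΨs _ hz (hΨU hz).1.1
    rw [e1] at h1
    refine ⟨h1, fun v => ?_⟩
    have h2 : HasFDerivAt Ψ.symm (fderiv ℝ Ψ.symm b) (Θ (Ψ.symm b)) := by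
      rw [e1]; exact (h1.differentiableAt (by simp)).hasFDerivAt
    have h3 := h2.comp (Ψ.symm b) ((hΨU hz).1.1.differentiableAt (by simp)).hasFDerivAt
    have h4 : HasFDerivAt (Ψ.symm ∘ Θ) (ContinuousLinearMap.id ℝ E) (Ψ.symm b) := by
      refine (hasFDerivAt_id _).congr_of_eventuallyEq ?_
      filter_upwards [Ψ.open_source.mem_nhds hz] with w hw
      change Ψ.symm (Θ w) = w
      rw [← hΨf]; exact Ψ.left_inv hw
    exact congrArg (fun L => L v) (h3.unique h4)
  refine ⟨Ψ.symm, ?_, ?_⟩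
  · refine ContinuousLinearMap.ext fun v => ?_
    have h1 := (hcomp b₀ hbt).2 (A v)
    rw [hb0, hD] at h1
    simpa using h1
  · filter_upwards [Ψ.open_target.mem_nhds hbt] with b hb
    have hz := Ψ.map_target hb
    have e1 : Θ (Ψ.symm b) = b := (congrFun hΨf _).symm.trans (Ψ.right_inv hb)
    refine ⟨(hcomp b hb).1, ?_⟩
    have h1 := (hcomp b hb).2 e
    have h2 := (hΨU hz).1.2
    have h3 : X' (Θ (Ψ.symm b)) = X (Θ (Ψ.symm b)) := (hΨU hz).2
    rw [h2, h3, e1] at h1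
    exact h1

end FlowBox

/-! ### Systems on a vector space whose zero set is tangent to a constant vector. -/

section InvariantForm

variable {E : Type} [NormedAddCommGroup E] [NormedSpace ℝ E] [FiniteDimensional ℝ E] {ν : ℕ}

lemma eventually_isUnit_matrix {S : E → Matrix (Fin ν) (Fin ν) ℝ} {p : E}
    (hS : ∀ a b, ContinuousAt (fun j => S j a b) p) (hp : S p = 1) :
    ∀ᶠ j in 𝓝 p, IsUnit (S j) := by
  have hc : ContinuousAt (fun j => S j) p :=
    continuousAt_pi.2 fun a => continuousAt_pi.2 fun b => hS a b
  have hd : ContinuousAt (fun j => (S j).det) p :=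
    (Continuous.matrix_det continuous_id).continuousAt.comp hc
  have : ∀ᶠ j in 𝓝 p, (S j).det ≠ 0 := hd.eventually_ne (by rw [hp]; simp)
  filter_upwards [this] with j hj
  rw [Matrix.isUnit_iff_isUnit_det]
  exact isUnit_iff_ne_zero.2 hj

/-- A system which does not vanish at a point can be made constant near this point. -/
lemma exists_constant_form {T : E → Fin ν → ℝ} {O : Set E} {p : E} (hO : IsOpen O) (hp : p ∈ O)
    (hT : ContDiffOn ℝ ∞ T O) (hTp : T p ≠ 0) :
    ∃ S : E → Matrix (Fin ν) (Fin ν) ℝ, ∀ᶠ j in 𝓝 p, (∀ a b, ContDiffAt ℝ ∞ (fun j => S j a b) j) ∧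
      IsUnit (S j) ∧ ∀ a, T p a = ∑ b, S j a b * T j b := by
  -- With `N = |T|²`, the matrix `1 + (T p - T) Tᵗ / |T|²` maps `T` to `T p` and equals `1` at `p`.
  let N : E → ℝ := fun j => ∑ i, T j i * T j i
  let S : E → Matrix (Fin ν) (Fin ν) ℝ := fun j =>
    Matrix.of fun a b => (1 : Matrix (Fin ν) (Fin ν) ℝ) a b + (T p a - T j a) * (T j b / N j)
  have hTa : ∀ j ∈ O, ∀ a, ContDiffAt ℝ ∞ (fun j => T j a) j := fun j hj =>
    contDiffAt_pi.1 (hT.contDiffAt (hO.mem_nhds hj))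
  have hN : ∀ j ∈ O, ContDiffAt ℝ ∞ N j := fun j hj =>
    ContDiffAt.sum fun i _ => (hTa j hj i).mul (hTa j hj i)
  have hNp : N p ≠ 0 := by
    intro h
    apply hTp
    funext i
    have := (Finset.sum_eq_zero_iff_of_nonneg (fun i _ => mul_self_nonneg (T p i))).1 h i
      (Finset.mem_univ i)
    simpa using this
  have hSs : ∀ j ∈ O, N j ≠ 0 → ∀ a b, ContDiffAt ℝ ∞ (fun j => S j a b) j := by
    intro j hj hNj a b
    exact contDiffAt_const.add ((contDiffAt_const.sub (hTa j hj a)).mul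
      ((hTa j hj b).div (hN j hj) hNj))
  refine ⟨S, ?_⟩
  have hSp : S p = 1 := by
    ext a b
    simp [S]
  filter_upwards [hO.mem_nhds hp, (hN p hp).continuousAt.eventually_ne hNp,
    eventually_isUnit_matrix (fun a b => (hSs p hp hNp a b).continuousAt) hSp] with j hj hNj hu
  refine ⟨hSs j hj hNj, hu, fun a => ?_⟩
  have h1 : ∑ b, (T p a - T j a) * (T j b / N j) * T j b = T p a - T j a := by
    have : ∀ b, (T p a - T j a) * (T j b / N j) * T j b =
        (T p a - T j a) / N j * (T j b * T j b) := fun b => by ring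
    rw [Finset.sum_congr rfl fun b _ => this b, ← Finset.mul_sum]
    change (T p a - T j a) / N j * N j = _
    field_simp
  simp only [S, Matrix.of_apply, add_mul, Finset.sum_add_distrib, h1]
  simp [Matrix.one_apply]

/-- Near a zero of a nondegenerate system `T = 0` whose zero set is tangent to `e`, the restriction
of `T` to a hyperplane transversal to `e`, extended constantly along `e`, is an equivalent
system. -/
lemma exists_projected_form {T : E → Fin ν → ℝ} {O : Set E} {p : E} (hO : IsOpen O) (hp : p ∈ O)
    (hT : ContDiffOn ℝ ∞ T O) (hTp : T p = 0) {e : E} (ℓ : E →L[ℝ] ℝ)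
    (hnd : Function.Surjective (fderiv ℝ T p))
    (hinv : ∀ j ∈ O, T j = 0 → fderiv ℝ T j e = 0) :
    ∃ S : E → Matrix (Fin ν) (Fin ν) ℝ, ∀ᶠ j in 𝓝 p, (∀ a b, ContDiffAt ℝ ∞ (fun j => S j a b) j) ∧
      IsUnit (S j) ∧ ∀ a, T (j - ℓ (j - p) • e) a = ∑ b, S j a b * T j b := by
  have hTs : ContDiffOn ℝ ∞ (fun j => fderiv ℝ T j e) O := fun j hj =>
    (((hT.contDiffAt (hO.mem_nhds hj)).fderiv_right (m := ∞) (by simp)).clm_apply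
      contDiffAt_const).contDiffWithinAt
  -- The derivative along `e` vanishes on the zero set, so it is `Λ T`: along lines parallel to `e`,
  -- `T` satisfies a linear equation. The bound `‖Λ p‖ + 1` on `Λ` will serve as Gronwall constant.
  obtain ⟨Λ, V₁, hV₁, hΛ, hΛT⟩ := exists_factor_submersion (hO.mem_nhds hp) hT hTp hnd hTs hinv
  have hΛc : ContinuousAt Λ p := (hΛ.contDiffAt hV₁).continuousAt
  have hgood : ∀ᶠ j in 𝓝 p, j ∈ O ∧ j ∈ V₁ ∧ ‖Λ j‖ < ‖Λ p‖ + 1 :=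
    (hO.eventually_mem hp).and (Filter.Eventually.and hV₁
      (hΛc.norm.eventually_lt continuousAt_const (by linarith)))
  obtain ⟨δ, hδ, hball⟩ := Metric.eventually_nhds_iff_ball.1 hgood
  let π : ℝ → E → E := fun t j => j - (t * ℓ (j - p)) • e
  have hπ : ∀ᶠ j in 𝓝 p, ∀ t ∈ Set.Icc (0 : ℝ) 1, π t j ∈ Metric.ball p δ := by
    have hc : Continuous fun j : E => ‖j - p‖ + |ℓ (j - p)| * ‖e‖ := by fun_prop
    have : ∀ᶠ j in 𝓝 p, ‖j - p‖ + |ℓ (j - p)| * ‖e‖ < δ :=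
      hc.continuousAt.eventually_lt continuousAt_const (by simpa using hδ)
    filter_upwards [this] with j hj t ht
    rw [Metric.mem_ball, dist_eq_norm]
    refine lt_of_le_of_lt ?_ hj
    have h1 : π t j - p = (j - p) - (t * ℓ (j - p)) • e := by simp only [π]; abel
    rw [h1]
    refine (norm_sub_le _ _).trans ?_
    rw [norm_smul, Real.norm_eq_abs, abs_mul, abs_of_nonneg ht.1]
    gcongr
    exact mul_le_of_le_one_left (abs_nonneg _) ht.2
  have hπ1 : ∀ j, π 1 j = j - ℓ (j - p) • e := fun j => by simp [π]
  let K : E → Fin ν → ℝ := fun j => T (j - ℓ (j - p) • e)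
  obtain ⟨U, hUsub, hUo, hpU⟩ := mem_nhds_iff.1
    (hπ.and (hO.eventually_mem hp))
  have hKs : ∀ j ∈ U, ContDiffAt ℝ ∞ K j := by
    intro j hj
    have h1 : j - ℓ (j - p) • e ∈ O := by
      rw [← hπ1]; exact (hball _ ((hUsub hj).1 1 (by norm_num))).1
    have h2 : ContDiff ℝ ∞ fun j : E => j - ℓ (j - p) • e :=
      contDiff_id.sub ((ℓ.contDiff.comp (contDiff_id.sub contDiff_const)).smul contDiff_const)
    exact ContDiffAt.comp (f := fun j : E => j - ℓ (j - p) • e) j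
      (hT.contDiffAt (hO.mem_nhds h1)) h2.contDiffAt
  -- Along the segment `t ↦ π t j` from `j` to its projection, `T` solves a linear equation with
  -- initial value zero, so it stays zero by Gronwall.
  have hK0 : ∀ j ∈ U, T j = 0 → K j = 0 := by
    intro j hj hTj
    let y : ℝ → Fin ν → ℝ := fun t => T (π t j)
    have hb : ∀ t ∈ Set.Icc (0 : ℝ) 1, π t j ∈ Metric.ball p δ := (hUsub hj).1
    have hd : ∀ t ∈ Set.Icc (0 : ℝ) 1, HasDerivAt y (-(ℓ (j - p)) • Λ (π t j) (y t)) t := by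
      intro t ht
      have h1 : HasDerivAt (fun t => π t j) (-(ℓ (j - p) • e)) t := by
        have := (((hasDerivAt_id t).mul_const (ℓ (j - p))).smul_const e).const_sub j
        rw [one_mul] at this
        exact this
      obtain ⟨hO', hV', -⟩ := hball _ (hb t ht)
      have h2 := ((hT.contDiffAt (hO.mem_nhds hO')).differentiableAt
        (by simp)).hasFDerivAt.comp_hasDerivAt t h1
      refine h2.congr_deriv ?_
      rw [map_neg, map_smul, hΛT _ hV', neg_smul]
    have hy := norm_le_gronwallBound_of_norm_deriv_right_le (f := y)
      (f' := fun t => -(ℓ (j - p)) • Λ (π t j) (y t)) (δ := 0)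
      (K := |ℓ (j - p)| * (‖Λ p‖ + 1)) (ε := 0) (a := 0) (b := 1)
      (fun t ht => (hd t ht).continuousAt.continuousWithinAt)
      (fun t ht => (hd t (Set.Ico_subset_Icc_self ht)).hasDerivWithinAt)
      (by simp [y, π, hTj])
      (fun t ht => by
        rw [add_zero, norm_smul, norm_neg, Real.norm_eq_abs, mul_assoc]
        gcongr
        refine ((Λ _).le_opNorm _).trans ?_
        gcongr
        exact (hball _ (hb t (Set.Ico_subset_Icc_self ht))).2.2.le)
      1 (by norm_num)
    rw [gronwallBound_ε0_δ0, norm_le_zero_iff] at hy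
    change T (j - ℓ (j - p) • e) = 0
    rw [← hπ1]; exact hy
  obtain ⟨R, V₂, hV₂, hR, hRT⟩ := exists_factor_submersion (hUo.mem_nhds hpU)
    (hT.mono fun j hj => (hUsub hj).2) hTp hnd (fun j hj => (hKs j hj).contDiffWithinAt) hK0
  -- Differentiate `K = R T` at `p`. The derivative of `R` drops out because `T p = 0`, and the
  -- projection along `e` is invisible to `fderiv ℝ T p`, which kills `e`. So `R p` fixes the range
  -- of `fderiv ℝ T p`, which is everything.
  have hRp : R p = ContinuousLinearMap.id ℝ (Fin ν → ℝ) := by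
    have hT' : HasFDerivAt T (fderiv ℝ T p) p :=
      ((hT.contDiffAt (hO.mem_nhds hp)).differentiableAt (by simp)).hasFDerivAt
    have h1 : HasFDerivAt K ((fderiv ℝ T p).comp (ContinuousLinearMap.id ℝ E - ℓ.smulRight e)) p := by
      have h2 : HasFDerivAt (fun j : E => j - ℓ (j - p) • e)
          (ContinuousLinearMap.id ℝ E - ℓ.smulRight e) p := by
        have h3 : HasFDerivAt (fun j : E => ℓ (j - p)) ℓ p := by
          exact ℓ.hasFDerivAt.comp p ((hasFDerivAt_id p).sub_const p)
        exact (hasFDerivAt_id p).sub (h3.smul_const e)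
      have h3 : HasFDerivAt T (fderiv ℝ T p) (p - ℓ (p - p) • e) := by simpa using hT'
      exact h3.comp p h2
    have h4 : HasFDerivAt (fun j => R j (T j)) ((R p).comp (fderiv ℝ T p)) p := by
      have h5 := ((hR.contDiffAt hV₂).differentiableAt (by simp)).hasFDerivAt.clm_apply hT'
      refine h5.congr_fderiv ?_
      ext v
      simp [hTp]
    have h6 : HasFDerivAt K ((R p).comp (fderiv ℝ T p)) p :=
      h4.congr_of_eventuallyEq (Filter.eventually_of_mem hV₂ hRT)
    have h7 := h6.unique h1
    refine ContinuousLinearMap.ext fun w => ?_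
    obtain ⟨v, rfl⟩ := hnd w
    have h8 := congrArg (fun L => L v) h7
    simpa [hinv p hp hTp] using h8
  let S : E → Matrix (Fin ν) (Fin ν) ℝ := fun j => LinearMap.toMatrix' (R j : (Fin ν → ℝ) →ₗ[ℝ] _)
  have hSab : ∀ j a b, S j a b = R j (Pi.single b 1) a := fun j a b => by
    simp [S, LinearMap.toMatrix'_apply]
  obtain ⟨V₃, hV₃, hV₃o, hpV₃⟩ := mem_nhds_iff.1 hV₂
  have hSs : ∀ j ∈ V₃, ∀ a b, ContDiffAt ℝ ∞ (fun j => S j a b) j := by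
    intro j hj a b
    have h1 : ContDiffAt ℝ ∞ (fun j => R j (Pi.single b 1)) j :=
      (hR.contDiffAt (Filter.mem_of_superset (hV₃o.mem_nhds hj) hV₃)).clm_apply contDiffAt_const
    have h2 := contDiffAt_pi.1 h1 a
    simpa only [hSab] using h2
  have hSp : S p = 1 := by
    simp only [S, hRp]
    exact LinearMap.toMatrix'_id
  refine ⟨S, ?_⟩
  filter_upwards [hV₃o.mem_nhds hpV₃,
    eventually_isUnit_matrix (fun a b => (hSs p hpV₃ a b).continuousAt) hSp] with j hj hu
  refine ⟨hSs j hj, hu, fun a => ?_⟩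
  have h1 : K j = R j (T j) := hRT j (hV₃ hj)
  have h2 : (S j).mulVec (T j) = R j (T j) := by
    simp only [S]
    rw [← Matrix.toLin'_apply, Matrix.toLin'_toMatrix']
    rfl
  change K j a = _
  rw [h1, ← h2]
  rfl

/-- A nondegenerate system whose zero set is tangent to a constant vector field `e` is locally
equivalent to a system which is constant along `e`. -/
theorem exists_invariant_form {T : E → Fin ν → ℝ} {O : Set E} {p : E} (hO : IsOpen O) (hp : p ∈ O)
    (hT : ContDiffOn ℝ ∞ T O) {e : E} (ℓ : E →L[ℝ] ℝ) (hℓ : ℓ e = 1)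
    (hnd : ∀ j ∈ O, T j = 0 → Function.Surjective (fderiv ℝ T j))
    (hinv : ∀ j ∈ O, T j = 0 → fderiv ℝ T j e = 0) :
    ∃ (U : Set E) (S : E → Matrix (Fin ν) (Fin ν) ℝ) (K : E → Fin ν → ℝ),
      IsOpen U ∧ p ∈ U ∧ U ⊆ O ∧ (∀ a b, ContDiffOn ℝ ∞ (fun j => S j a b) U) ∧
      (∀ j ∈ U, IsUnit (S j)) ∧ (∀ j ∈ U, ∀ a, K j a = ∑ b, S j a b * T j b) ∧
      ∀ j (c : ℝ), K (j + c • e) = K j := by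
  -- Constancy along `e` is obtained on the whole space: two points of a neighbourhood that differ
  -- by a multiple of `e` need not be joined inside it.
  obtain ⟨S, K, hS, hK⟩ : ∃ (S : E → Matrix (Fin ν) (Fin ν) ℝ) (K : E → Fin ν → ℝ),
      (∀ᶠ j in 𝓝 p, (∀ a b, ContDiffAt ℝ ∞ (fun j => S j a b) j) ∧
        IsUnit (S j) ∧ ∀ a, K j a = ∑ b, S j a b * T j b) ∧
      ∀ j (c : ℝ), K (j + c • e) = K j := by
    by_cases hTp : T p = 0
    · obtain ⟨S, hS⟩ := exists_projected_form hO hp hT hTp ℓ (hnd p hp hTp) hinv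
      refine ⟨S, fun j => T (j - ℓ (j - p) • e), hS, fun j c => ?_⟩
      simp only [map_sub, map_add, map_smul, hℓ, smul_eq_mul, mul_one]
      congr 1
      module
    · obtain ⟨S, hS⟩ := exists_constant_form hO hp hT hTp
      exact ⟨S, fun _ => T p, hS, fun _ _ => rfl⟩
  obtain ⟨U, hU, hUo, hpU⟩ := mem_nhds_iff.1 (hS.and (hO.eventually_mem hp))
  exact ⟨U, S, K, hUo, hpU, fun j hj => (hU hj).2,
    fun a b j hj => ((hU hj).1.1 a b).contDiffWithinAt, fun j hj => (hU hj).1.2.1,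
    fun j hj => (hU hj).1.2.2, hK⟩

end InvariantForm

/-! ### Calculus of iterated directional derivatives. -/

section DirectionalDerivatives

variable {C E F G : Type} [NormedAddCommGroup E] [NormedSpace ℝ E] [NormedAddCommGroup F]
  [NormedSpace ℝ F] [NormedAddCommGroup G] [NormedSpace ℝ G] [NormedAddCommGroup C]
  [NormedSpace ℝ C]

/-- The derivative of `f` in the direction `v`, as a function of the base point. -/
def dirDeriv (v : E) (f : E → F) : E → F := fun z => fderiv ℝ f z v

/-- Iterated directional derivatives. -/
def iterDir (l : List E) (f : E → F) : E → F := l.foldr dirDeriv f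

@[simp] lemma iterDir_nil (f : E → F) : iterDir [] f = f := rfl

@[simp] lemma iterDir_cons (v : E) (l : List E) (f : E → F) :
    iterDir (v :: l) f = dirDeriv v (iterDir l f) := rfl

lemma iterDir_append (l l' : List E) (f : E → F) :
    iterDir (l ++ l') f = iterDir l (iterDir l' f) := List.foldr_append

lemma _root_.ContDiffAt.dirDeriv {f : E → F} {z : E} (hf : ContDiffAt ℝ ∞ f z) (v : E) :
    ContDiffAt ℝ ∞ (dirDeriv v f) z :=
  (hf.fderiv_right (m := ∞) (by simp)).clm_apply contDiffAt_const

lemma _root_.ContDiffAt.iterDir {f : E → F} {z : E} (hf : ContDiffAt ℝ ∞ f z) (l : List E) :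
    ContDiffAt ℝ ∞ (iterDir l f) z := by
  induction l with
  | nil => exact hf
  | cons v l ih => exact ih.dirDeriv v

lemma _root_.ContDiffAt.eventually_differentiableAt {f : E → F} {z : E}
    (hf : ContDiffAt ℝ ∞ f z) : ∀ᶠ y in 𝓝 z, DifferentiableAt ℝ f y :=
  ((hf.of_le (by exact_mod_cast le_top : (1 : WithTop ℕ∞) ≤ ∞)).eventually (by simp)).mono
    fun _ h => h.differentiableAt one_ne_zero

lemma _root_.Filter.EventuallyEq.dirDeriv {f g : E → F} {z : E} (h : f =ᶠ[𝓝 z] g) (v : E) :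
    dirDeriv v f =ᶠ[𝓝 z] dirDeriv v g :=
  (h.fderiv (𝕜 := ℝ)).mono fun _ hy => congrArg (fun L : E →L[ℝ] F => L v) hy

lemma _root_.Filter.EventuallyEq.iterDir {f g : E → F} {z : E} (h : f =ᶠ[𝓝 z] g) (l : List E) :
    iterDir l f =ᶠ[𝓝 z] iterDir l g := by
  induction l with
  | nil => exact h
  | cons v l ih => exact ih.dirDeriv v

lemma dirDeriv_comm {f : E → F} {z : E} (hf : ContDiffAt ℝ ∞ f z) (v w : E) :
    dirDeriv v (dirDeriv w f) =ᶠ[𝓝 z] dirDeriv w (dirDeriv v f) := by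
  have h2 : ContDiffAt ℝ 2 f z := hf.of_le (WithTop.coe_le_coe.2 le_top)
  filter_upwards [h2.eventually (by simp)] with y hy
  have hd : DifferentiableAt ℝ (fderiv ℝ f) y :=
    (hy.fderiv_right (m := 1) (by norm_num)).differentiableAt one_ne_zero
  have key : ∀ a b : E, dirDeriv a (dirDeriv b f) y = fderiv ℝ (fderiv ℝ f) y a b := by
    intro a b
    have h1 := hd.hasFDerivAt.clm_apply (hasFDerivAt_const b y)
    change fderiv ℝ (fun z => fderiv ℝ f z b) y a = _
    rw [h1.fderiv]
    simp
  rw [key, key]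
  exact (hy.isSymmSndFDerivAt (by simp)).eq v w

/-- Equality of germs, not of values at `z`, is what survives a further differentiation in the
induction. The rules below have this form for the same reason. -/
lemma iterDir_perm {f : E → F} {z : E} (hf : ContDiffAt ℝ ∞ f z) {l l' : List E} (h : l.Perm l') :
    iterDir l f =ᶠ[𝓝 z] iterDir l' f := by
  induction h with
  | nil => exact Filter.EventuallyEq.rfl
  | cons v _ ih => exact ih.dirDeriv v
  | swap v w l => exact dirDeriv_comm (hf.iterDir l) w v
  | trans _ _ ih₁ ih₂ => exact ih₁.trans ih₂

lemma iterDir_clm_comp (A : F →L[ℝ] G) {f : E → F} {z : E} (hf : ContDiffAt ℝ ∞ f z) (l : List E) :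
    iterDir l (fun y => A (f y)) =ᶠ[𝓝 z] fun y => A (iterDir l f y) := by
  induction l with
  | nil => exact Filter.EventuallyEq.rfl
  | cons v l ih =>
    refine (ih.dirDeriv v).trans ?_
    filter_upwards [(hf.iterDir l).eventually_differentiableAt] with y hy
    exact congrArg (fun L => L v) (A.hasFDerivAt.comp y hy.hasFDerivAt).fderiv

lemma iterDir_add {f g : E → F} {z : E} (hf : ContDiffAt ℝ ∞ f z) (hg : ContDiffAt ℝ ∞ g z)
    (l : List E) : iterDir l (fun y => f y + g y) =ᶠ[𝓝 z] fun y => iterDir l f y + iterDir l g y := by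
  induction l with
  | nil => exact Filter.EventuallyEq.rfl
  | cons v l ih =>
    refine (ih.dirDeriv v).trans ?_
    filter_upwards [(hf.iterDir l).eventually_differentiableAt,
      (hg.iterDir l).eventually_differentiableAt] with y hy hy'
    exact congrArg (fun L => L v) (hy.hasFDerivAt.add hy'.hasFDerivAt).fderiv

lemma iterDir_sub {f g : E → F} {z : E} (hf : ContDiffAt ℝ ∞ f z) (hg : ContDiffAt ℝ ∞ g z)
    (l : List E) : iterDir l (fun y => f y - g y) =ᶠ[𝓝 z] fun y => iterDir l f y - iterDir l g y := by
  induction l with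
  | nil => exact Filter.EventuallyEq.rfl
  | cons v l ih =>
    refine (ih.dirDeriv v).trans ?_
    filter_upwards [(hf.iterDir l).eventually_differentiableAt,
      (hg.iterDir l).eventually_differentiableAt] with y hy hy'
    exact congrArg (fun L => L v) (hy.hasFDerivAt.sub hy'.hasFDerivAt).fderiv

lemma dirDeriv_zero (v : E) : dirDeriv v (fun _ : E => (0 : F)) = fun _ => 0 := by
  funext z
  simp [dirDeriv]

lemma iterDir_zero (l : List E) : iterDir l (fun _ : E => (0 : F)) = fun _ => 0 := by
  induction l with
  | nil => rfl
  | cons v l ih => rw [iterDir_cons, ih, dirDeriv_zero]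

lemma iterDir_sum {ι : Type} (s : Finset ι) {f : ι → E → F} {z : E}
    (hf : ∀ i, ContDiffAt ℝ ∞ (f i) z) (l : List E) :
    iterDir l (fun y => ∑ i ∈ s, f i y) =ᶠ[𝓝 z] fun y => ∑ i ∈ s, iterDir l (f i) y := by
  classical
  induction s using Finset.induction_on with
  | empty => simp [iterDir_zero]
  | insert a s ha ih =>
    simp only [Finset.sum_insert ha]
    refine (iterDir_add (hf a) (ContDiffAt.sum fun i _ => hf i) l).trans ?_
    filter_upwards [ih] with y hy
    rw [hy]

lemma iterDir_comp_add_const (f : E → F) (a : E) (l : List E) :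
    iterDir l (fun y => f (y + a)) = fun y => iterDir l f (y + a) := by
  induction l with
  | nil => rfl
  | cons v l ih =>
    rw [iterDir_cons, ih]
    funext y
    simp only [dirDeriv, iterDir_cons]
    rw [fderiv_comp_add_right]

/-- Derivatives of the slices of a function of two variables. -/
lemma iterDir_slice {f : C × E → F} {z : C × E} (hf : ContDiffAt ℝ ∞ f z) (l : List E) :
    ∀ᶠ w in 𝓝 z, iterDir l (fun y => f (w.1, y)) w.2 =
      iterDir (l.map fun v => ((0 : C), v)) f w := by
  induction l with
  | nil => exact Filter.Eventually.of_forall fun w => rfl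
  | cons v l ih =>
    filter_upwards [ih.eventually_nhds, (hf.iterDir _).eventually_differentiableAt] with w hw hd
    have hc : Continuous fun y : E => (w.1, y) := by fun_prop
    have h1 : iterDir l (fun y => f (w.1, y)) =ᶠ[𝓝 w.2]
        fun y => iterDir (l.map fun v => ((0 : C), v)) f (w.1, y) :=
      hc.continuousAt.eventually hw
    have h2 := HasFDerivAt.comp (f := fun y : E => (w.1, y)) w.2 hd.hasFDerivAt
      (hasFDerivAt_prodMk_right w.1 w.2)
    rw [List.map_cons, iterDir_cons, iterDir_cons]
    change fderiv ℝ _ w.2 v = fderiv ℝ _ w (0, v)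
    rw [h1.fderiv_eq]
    refine (congrArg (fun L => L v) h2.fderiv).trans ?_
    simp

end DirectionalDerivatives

/-! ### Multi-index derivatives as iterated directional derivatives. -/

section MultiIndices

variable {p : ℕ}

/-- The list of directions with respect to which `mderiv J` differentiates. -/
def MultiIdx.dirs (J : Fin p → ℕ) : List (Fin p → ℝ) :=
  ((List.finRange p).flatMap fun i => List.replicate (J i) i).map fun i => Pi.single i 1

/-- With a list of directions in place of exponents, commutation of derivatives is a permutation of
lists, and directions other than coordinate ones can be mixed in. -/
lemma mderiv_eq_iterDir (J : Fin p → ℕ) (f : (Fin p → ℝ) → ℝ) :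
    mderiv J f = iterDir (MultiIdx.dirs J) f := by
  have key : ∀ l : List (Fin p), l.foldr (fun i g => (pderiv i)^[J i] g) f =
      iterDir ((l.flatMap fun i => List.replicate (J i) i).map fun i => Pi.single i (1 : ℝ)) f := by
    intro l
    induction l with
    | nil => rfl
    | cons i l ih =>
      rw [List.foldr_cons, ih, List.flatMap_cons, List.map_append, iterDir_append]
      generalize iterDir _ f = g
      rw [List.map_replicate]
      induction J i with
      | zero => rfl
      | succ n ihn =>
        rw [Function.iterate_succ_apply', ihn, List.replicate_succ, iterDir_cons]
        rfl
  exact key _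

lemma mderiv_none (m : ℕ) (f : (Fin p → ℝ) → ℝ) : mderiv (MultiIdx.none p m).exps f = f := by
  rw [mderiv_eq_iterDir]
  have : MultiIdx.dirs (MultiIdx.none p m).exps = [] := by
    simp [MultiIdx.dirs, MultiIdx.exps, MultiIdx.none]
  rw [this, iterDir_nil]

/-- If all the derivatives `∂_J k` of order at most `m` vanish at a point, then so do all the
iterated partial derivatives of order at most `m`, in whatever order they are taken. -/
lemma iterDir_eq_zero_of_mderiv {m : ℕ} {k : (Fin p → ℝ) → ℝ} {x : Fin p → ℝ}
    (hk : ContDiffAt ℝ ∞ k x) (h : ∀ J : MultiIdx p m, mderiv J.exps k x = 0) (l : List (Fin p))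
    (hl : l.length ≤ m) : iterDir (l.map fun i => Pi.single i (1 : ℝ)) k x = 0 := by
  have hsum : ∑ i, l.count i = l.length := by
    have := Multiset.sum_count_eq_card (s := Finset.univ) (m := (l : Multiset (Fin p)))
      (fun a _ => Finset.mem_univ a)
    simpa using this
  have hlt : ∀ i, l.count i < m + 1 := fun i => by
    have := List.count_le_length (a := i) (l := l)
    omega
  let J : MultiIdx p m := ⟨fun i => ⟨l.count i, hlt i⟩, by simpa [hsum] using hl⟩
  have hperm : l.Perm ((List.finRange p).flatMap fun i => List.replicate (J.exps i) i) := by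
    rw [List.perm_iff_count]
    intro a
    rw [List.count_flatMap]
    have h1 : (List.count a ∘ fun i => List.replicate (J.exps i) i) =
        fun i => if i = a then l.count a else 0 := by
      funext i
      simp only [Function.comp, List.count_replicate]
      by_cases hia : i = a
      · subst hia; simp [J, MultiIdx.exps]
      · simp [hia]
    rw [h1, ← Fin.sum_univ_def]
    simp
  rw [(iterDir_perm hk (hperm.map _)).self_of_nhds]
  have := h J
  rwa [mderiv_eq_iterDir] at this

end MultiIndices

/-! ### Derivatives of monomials. -/

section Monomials

variable {p : ℕ}

/-- Only the factor of index `i` depends on `y i`. Writing the result as a product of the same shape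
allows iteration. -/
lemma pderiv_prod {φ : Fin p → ℝ → ℝ} (hφ : ∀ i, Differentiable ℝ (φ i)) (i : Fin p) :
    pderiv i (fun y => ∏ k, φ k (y k)) =
      fun y => ∏ k, (Function.update φ i (deriv (φ i))) k (y k) := by
  funext y
  have hd : Differentiable ℝ (fun y : Fin p → ℝ => ∏ k, φ k (y k)) := by
    have h1 : ∀ k, Differentiable ℝ fun y : Fin p → ℝ => φ k (y k) := fun k =>
      (hφ k).comp (differentiable_apply k)
    fun_prop
  have hl : HasDerivAt (fun t : ℝ => Function.update y i t) (Pi.single i 1) (y i) :=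
    hasDerivAt_update y i (y i)
  have h1 : HasFDerivAt (fun y : Fin p → ℝ => ∏ k, φ k (y k))
      (fderiv ℝ (fun y : Fin p → ℝ => ∏ k, φ k (y k)) y) (Function.update y i (y i)) := by
    rw [Function.update_eq_self]; exact (hd y).hasFDerivAt
  have h2 := h1.comp_hasDerivAt (y i) hl
  have h3 : ((fun y : Fin p → ℝ => ∏ k, φ k (y k)) ∘ fun t : ℝ => Function.update y i t) =
      fun t => φ i t * ∏ k ∈ Finset.univ.erase i, φ k (y k) := by
    funext t
    change ∏ k, φ k (Function.update y i t k) = _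
    rw [← Finset.mul_prod_erase _ _ (Finset.mem_univ i), Function.update_self]
    congr 1
    refine Finset.prod_congr rfl fun k hk => ?_
    rw [Function.update_of_ne (Finset.ne_of_mem_erase hk)]
  rw [h3] at h2
  have h4 := ((hφ i) (y i)).hasDerivAt.mul_const (∏ k ∈ Finset.univ.erase i, φ k (y k))
  refine (h2.unique h4).trans ?_
  rw [← Finset.mul_prod_erase _ _ (Finset.mem_univ i), Function.update_self]
  congr 1
  refine Finset.prod_congr rfl fun k hk => ?_
  rw [Function.update_of_ne (Finset.ne_of_mem_erase hk)]

lemma pderiv_iterate_prod {φ : Fin p → ℝ → ℝ} (hφ : ∀ i, ContDiff ℝ ∞ (φ i)) (i : Fin p) (n : ℕ) :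
    (pderiv i)^[n] (fun y => ∏ k, φ k (y k)) =
      fun y => ∏ k, (Function.update φ i (deriv^[n] (φ i))) k (y k) := by
  induction n with
  | zero => simp
  | succ n ih =>
    rw [Function.iterate_succ_apply', ih, pderiv_prod, Function.iterate_succ_apply']
    · simp
    · intro k
      by_cases hk : k = i
      · subst hk
        rw [Function.update_self]
        exact ((hφ k).iterate_deriv n).differentiable (by simp)
      · rw [Function.update_of_ne hk]
        exact (hφ k).differentiable (by simp)

lemma mderiv_prod {φ : Fin p → ℝ → ℝ} (hφ : ∀ i, ContDiff ℝ ∞ (φ i)) (J : Fin p → ℕ) :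
    mderiv J (fun y => ∏ k, φ k (y k)) = fun y => ∏ k, (deriv^[J k] (φ k)) (y k) := by
  have key : ∀ l : List (Fin p), l.Nodup →
      l.foldr (fun i g => (pderiv i)^[J i] g) (fun y => ∏ k, φ k (y k)) =
        fun y => ∏ k, (if k ∈ l then deriv^[J k] (φ k) else φ k) (y k) := by
    intro l
    induction l with
    | nil => intro _; simp
    | cons i l ih =>
      intro hnd
      obtain ⟨hil, hl⟩ := List.nodup_cons.1 hnd
      rw [List.foldr_cons, ih hl,
        pderiv_iterate_prod (φ := fun k => if k ∈ l then deriv^[J k] (φ k) else φ k)]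
      · funext y
        refine Finset.prod_congr rfl fun k _ => ?_
        by_cases hk : k = i
        · subst hk; simp [hil]
        · simp [hk]
      · intro k
        split_ifs
        · exact (hφ k).iterate_deriv _
        · exact hφ k
  have := key _ (List.nodup_finRange p)
  simpa [mderiv] using this

/-- Differentiation lowers the exponent of a divided power by one, and at `a` only the exponent zero
survives. -/
lemma iterate_deriv_monomial (a : ℝ) (j k : ℕ) :
    deriv^[j] (fun t => (t - a) ^ k / (Nat.factorial k : ℝ)) a = if j = k then 1 else 0 := by
  have hz : ∀ n, deriv^[n] (fun _ : ℝ => (0 : ℝ)) = fun _ => 0 := by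
    intro n
    induction n with
    | zero => rfl
    | succ n ih => rw [Function.iterate_succ_apply, deriv_const', ih]
  induction j generalizing k with
  | zero =>
    rw [Function.iterate_zero_apply]
    cases k <;> simp
  | succ j ih =>
    rw [Function.iterate_succ_apply]
    cases k with
    | zero =>
      have : deriv (fun t => (t - a) ^ 0 / (Nat.factorial 0 : ℝ)) = fun _ => 0 := by
        simp
      rw [this, hz]
      simp
    | succ k =>
      have : deriv (fun t => (t - a) ^ (k + 1) / (Nat.factorial (k + 1) : ℝ)) =
          fun t => (t - a) ^ k / (Nat.factorial k : ℝ) := by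
        funext t
        have h1 := (((hasDerivAt_id t).sub_const a).pow (k + 1)).div_const
          (Nat.factorial (k + 1) : ℝ)
        refine h1.deriv.trans ?_
        rw [Nat.factorial_succ]
        push_cast
        have : (Nat.factorial k : ℝ) ≠ 0 := by positivity
        simp
        field_simp
      rw [this, ih]
      simp

lemma mderiv_monomial (J K : Fin p → ℕ) (a : Fin p → ℝ) :
    mderiv J (fun y => ∏ i, (y i - a i) ^ K i / (Nat.factorial (K i) : ℝ)) a =
      if J = K then 1 else 0 := by
  rw [mderiv_prod (φ := fun i t => (t - a i) ^ K i / (Nat.factorial (K i) : ℝ))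
    (fun i => ((contDiff_id.sub contDiff_const).pow _).div_const _)]
  simp only [iterate_deriv_monomial]
  split_ifs with h
  · subst h; simp
  · obtain ⟨i, hi⟩ := Function.ne_iff.1 h
    exact Finset.prod_eq_zero (Finset.mem_univ i) (by simp [hi])

end Monomials

/-! ### Equality of jets as order of contact. -/

section Contact

variable {p q m : ℕ}

@[simp] lemma jet_fst (f : (Fin p → ℝ) → (Fin q → ℝ)) (x : Fin p → ℝ) : (jet m f x).1 = x := rfl

@[simp] lemma jet_base (f : (Fin p → ℝ) → (Fin q → ℝ)) (x : Fin p → ℝ) :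
    (jet m f x).base = (x, f x) := by
  refine Prod.ext rfl (funext fun α => ?_)
  simp only [Jet.base, jet]
  rw [mderiv_none]

lemma contDiff_rep (j : Jet p q m) : ContDiff ℝ ∞ j.rep := by
  unfold Jet.rep
  fun_prop

lemma _root_.ContDiffAt.jet_component {E : Type} [NormedAddCommGroup E] [NormedSpace ℝ E]
    {f : E → (Fin q → ℝ)} {x : E} (hf : ContDiffAt ℝ ∞ f x) (α : Fin q) :
    ContDiffAt ℝ ∞ (fun y => f y α) x := contDiffAt_pi.1 hf α

lemma MultiIdx.exps_injective {p m : ℕ} :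
    Function.Injective (MultiIdx.exps : MultiIdx p m → Fin p → ℕ) := by
  intro J K h
  refine Subtype.ext (funext fun i => Fin.ext ?_)
  exact congrFun h i

/-- The representative of a jet has the given jet. -/
lemma jet_rep (j : Jet p q m) : jet m j.rep j.1 = j := by
  refine Prod.ext rfl (funext fun α => funext fun J => ?_)
  change mderiv J.exps (fun y => j.rep y α) j.1 = j.2 α J
  have hs : ∀ K : MultiIdx p m, ContDiff ℝ ∞ fun y : Fin p → ℝ =>
      ∏ i, (y i - j.1 i) ^ K.exps i / (Nat.factorial (K.exps i) : ℝ) := fun K => by fun_prop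
  have h1 : iterDir (MultiIdx.dirs J.exps) (fun y => j.rep y α) j.1 =
      ∑ K : MultiIdx p m, j.2 α K * iterDir (MultiIdx.dirs J.exps) (fun y : Fin p → ℝ =>
        ∏ i, (y i - j.1 i) ^ K.exps i / (Nat.factorial (K.exps i) : ℝ)) j.1 := by
    refine (iterDir_sum Finset.univ
      (fun K => (contDiff_const.mul (hs K)).contDiffAt) _).self_of_nhds.trans ?_
    refine Finset.sum_congr rfl fun K _ => ?_
    exact (iterDir_clm_comp (ContinuousLinearMap.mul ℝ ℝ (j.2 α K)) (hs K).contDiffAt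
      _).self_of_nhds
  rw [mderiv_eq_iterDir, h1]
  simp only [← mderiv_eq_iterDir, mderiv_monomial, MultiIdx.exps_injective.eq_iff]
  simp

/-- Mean value inequality on the closed ball of radius `‖y - x‖`, where the derivative is at most `c
* ‖y - x‖ ^ n`. -/
lemma isBigO_pow_succ {E F : Type} [NormedAddCommGroup E] [NormedSpace ℝ E] [NormedAddCommGroup F]
    [NormedSpace ℝ F] {k : E → F} {x : E} {n : ℕ}
    (hk : ∀ᶠ y in 𝓝 x, DifferentiableAt ℝ k y) (hx : k x = 0)
    (hd : fderiv ℝ k =O[𝓝 x] fun y => ‖y - x‖ ^ n) : k =O[𝓝 x] fun y => ‖y - x‖ ^ (n + 1) := by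
  obtain ⟨c, hc, hcb⟩ := hd.exists_nonneg
  obtain ⟨r, hr, hball⟩ := Metric.eventually_nhds_iff_ball.1 (hk.and hcb.bound)
  refine Asymptotics.IsBigO.of_bound c ?_
  filter_upwards [Metric.ball_mem_nhds x hr] with y hy
  rw [Metric.mem_ball, dist_eq_norm] at hy
  have hsub : ∀ z ∈ Metric.closedBall x ‖y - x‖, z ∈ Metric.ball x r := fun z hz =>
    Metric.closedBall_subset_ball hy hz
  have h1 := (convex_closedBall x ‖y - x‖).norm_image_sub_le_of_norm_fderiv_le (𝕜 := ℝ) (f := k)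
    (C := c * ‖y - x‖ ^ n) (x := x) (y := y) (fun z hz => (hball z (hsub z hz)).1)
    (fun z hz => by
      refine (hball z (hsub z hz)).2.trans ?_
      rw [norm_pow, norm_norm]
      gcongr
      rw [← dist_eq_norm]
      exact hz)
    (Metric.mem_closedBall_self (norm_nonneg _)) (by simp [dist_eq_norm])
  rw [hx, sub_zero] at h1
  rw [norm_pow, norm_norm, pow_succ, ← mul_assoc]
  exact h1

lemma fderiv_isBigO {k : (Fin p → ℝ) → ℝ} {x : Fin p → ℝ} {n : ℕ}
    (h : ∀ i, pderiv i k =O[𝓝 x] fun y => ‖y - x‖ ^ n) :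
    fderiv ℝ k =O[𝓝 x] fun y => ‖y - x‖ ^ n := by
  have h1 : fderiv ℝ k = fun y => ∑ i, pderiv i k y • (ContinuousLinearMap.proj i :
      (Fin p → ℝ) →L[ℝ] ℝ) := by
    funext y
    refine ContinuousLinearMap.ext fun v => ?_
    have hv : v = ∑ i, v i • (Pi.single i 1 : Fin p → ℝ) := by
      funext l
      simp [Finset.sum_apply, Pi.single_apply]
    conv_lhs => rw [hv]
    simp [pderiv, mul_comm]
  rw [h1]
  have h2 : ∀ i ∈ Finset.univ, (fun y => pderiv i k y • (ContinuousLinearMap.proj i :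
      (Fin p → ℝ) →L[ℝ] ℝ)) =O[𝓝 x] fun y => ‖y - x‖ ^ n := fun i _ =>
    Asymptotics.IsBigO.trans (g := pderiv i k) (Asymptotics.IsBigO.of_bound
      ‖(ContinuousLinearMap.proj i : (Fin p → ℝ) →L[ℝ] ℝ)‖
      (Filter.Eventually.of_forall fun y => by rw [norm_smul, mul_comm])) (h i)
  simpa only [Finset.sum_fn] using Asymptotics.IsBigO.sum h2

/-- A function whose derivatives of order at most `m` vanish at `x` is `O(|y - x|^{m+1})`. -/
lemma isBigO_of_iterDir_eq_zero {x : Fin p → ℝ} (m : ℕ) : ∀ {k : (Fin p → ℝ) → ℝ},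
    ContDiffAt ℝ ∞ k x →
    (∀ l : List (Fin p), l.length ≤ m → iterDir (l.map fun i => Pi.single i (1 : ℝ)) k x = 0) →
    k =O[𝓝 x] fun y => ‖y - x‖ ^ (m + 1) := by
  induction m with
  | zero =>
    intro k hk h
    refine isBigO_pow_succ hk.eventually_differentiableAt (h [] le_rfl) ?_
    simp only [pow_zero]
    exact (hk.fderiv_right (m := 0) (by simp)).continuousAt.isBigO_one ℝ
  | succ m ih =>
    intro k hk h
    refine isBigO_pow_succ hk.eventually_differentiableAt (h [] (Nat.zero_le _))
      (fderiv_isBigO fun i => ?_)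
    refine ih (hk.dirDeriv _) fun l hl => ?_
    have := h (l ++ [i]) (by simpa using hl)
    rwa [List.map_append, iterDir_append] at this

/-- The constant term is the limit at `0`, hence zero; divide by `X` and induct. The punctured
neighbourhood permits the division. -/
lemma polynomial_eq_zero_of_isBigO (n : ℕ) : ∀ {P : Polynomial ℝ}, P.degree < n →
    (fun t => P.eval t) =O[𝓝[≠] 0] (fun t : ℝ => t ^ n) → P = 0 := by
  induction n with
  | zero =>
    intro P hP _
    exact Polynomial.degree_eq_bot.1 (by simpa using hP)
  | succ n ih =>
    intro P hP hO
    have h0 : P.eval 0 = 0 := by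
      have h1 : Filter.Tendsto (fun t => P.eval t) (𝓝[≠] 0) (𝓝 (P.eval 0)) :=
        P.continuous.continuousAt.tendsto.mono_left nhdsWithin_le_nhds
      have h2 : Filter.Tendsto (fun t : ℝ => t ^ (n + 1)) (𝓝[≠] 0) (𝓝 0) := by
        have : Filter.Tendsto (fun t : ℝ => t ^ (n + 1)) (𝓝 0) (𝓝 (0 ^ (n + 1))) :=
          (continuous_pow (n + 1)).continuousAt
        rw [zero_pow (Nat.succ_ne_zero n)] at this
        exact this.mono_left nhdsWithin_le_nhds
      exact tendsto_nhds_unique h1 (hO.trans_tendsto h2)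
    have hP' : P = P.divX * Polynomial.X := by
      have := P.divX_mul_X_add
      rw [Polynomial.coeff_zero_eq_eval_zero, h0] at this
      simpa using this.symm
    have hz : P.divX = 0 := by
      by_cases hne : P = 0
      · rw [hne]; simp
      refine ih ?_ ?_
      · have hd := Polynomial.degree_divX_lt hne
        have h3 : P.degree ≤ n := by
          rw [Polynomial.degree_eq_natDegree hne] at hP ⊢
          exact_mod_cast Nat.lt_succ_iff.1 (by exact_mod_cast hP)
        exact hd.trans_le h3
      · rw [Asymptotics.isBigO_iff] at hO ⊢
        obtain ⟨c, hc⟩ := hO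
        refine ⟨c, ?_⟩
        filter_upwards [hc, self_mem_nhdsWithin] with t ht ht0
        have ht0' : 0 < ‖t‖ := norm_pos_iff.2 ht0
        rw [hP', Polynomial.eval_mul, Polynomial.eval_X, norm_mul, pow_succ, norm_mul,
          ← mul_assoc] at ht
        exact le_of_mul_le_mul_right ht ht0'
    rw [hP', hz, zero_mul]

/-- On the line from `j.1` to `y`, the representative is a polynomial in `t` of degree at most `m`
and of order `t ^ (m + 1)`. -/
lemma rep_eq_zero_of_isBigO {j : Jet p q m}
    (h : j.rep =O[𝓝 j.1] fun y => ‖y - j.1‖ ^ (m + 1)) : j.rep = fun _ => 0 := by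
  funext y α
  let P : Polynomial ℝ := ∑ J : MultiIdx p m, Polynomial.monomial (∑ i, J.exps i)
    (j.2 α J * ∏ i, (y i - j.1 i) ^ J.exps i / (Nat.factorial (J.exps i) : ℝ))
  have hPe : ∀ t : ℝ, P.eval t = j.rep (j.1 + t • (y - j.1)) α := by
    intro t
    simp only [P, Jet.rep, Polynomial.eval_finsetSum, Polynomial.eval_monomial]
    refine Finset.sum_congr rfl fun J _ => ?_
    rw [← Finset.prod_pow_eq_pow_sum, mul_assoc, ← Finset.prod_mul_distrib]
    congr 1
    refine Finset.prod_congr rfl fun i _ => ?_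
    simp only [Pi.add_apply, Pi.smul_apply, Pi.sub_apply, smul_eq_mul, add_sub_cancel_left, mul_pow]
    ring
  have hP : P = 0 := by
    refine polynomial_eq_zero_of_isBigO (m + 1) ?_ ?_
    · refine lt_of_le_of_lt (Polynomial.degree_sum_le _ _) ?_
      rw [Finset.sup_lt_iff (WithBot.bot_lt_coe _)]
      intro J _
      refine lt_of_le_of_lt (Polynomial.degree_monomial_le _ _) ?_
      have := J.2
      exact_mod_cast Nat.lt_succ_of_le this
    · have hc : Filter.Tendsto (fun t : ℝ => j.1 + t • (y - j.1)) (𝓝[≠] 0) (𝓝 j.1) := by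
        have : Continuous fun t : ℝ => j.1 + t • (y - j.1) := by fun_prop
        have := this.tendsto 0
        simp only [zero_smul, add_zero] at this
        exact this.mono_left nhdsWithin_le_nhds
      have h1 := (Asymptotics.isBigO_pi.1 h α).comp_tendsto hc
      have h2 : (fun t => P.eval t) = (fun y => j.rep y α) ∘ fun t : ℝ => j.1 + t • (y - j.1) :=
        funext hPe
      rw [h2]
      refine h1.trans (Asymptotics.IsBigO.of_bound (‖y - j.1‖ ^ (m + 1))
        (Filter.Eventually.of_forall fun t => ?_))
      simp [norm_smul, mul_pow, mul_comm]
  have := hPe 1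
  rw [hP] at this
  simpa using this.symm

lemma jet_sub {f g : (Fin p → ℝ) → (Fin q → ℝ)} {x : Fin p → ℝ} (hf : ContDiffAt ℝ ∞ f x)
    (hg : ContDiffAt ℝ ∞ g x) :
    (jet m (fun y => f y - g y) x).2 = (jet m f x).2 - (jet m g x).2 := by
  funext α J
  change mderiv J.exps (fun y => f y α - g y α) x = mderiv J.exps (fun y => f y α) x
    - mderiv J.exps (fun y => g y α) x
  simp only [mderiv_eq_iterDir]
  exact (iterDir_sub (hf.jet_component α) (hg.jet_component α) _).self_of_nhds

lemma jet_zero (x : Fin p → ℝ) : (jet m (fun _ => (0 : Fin q → ℝ)) x).2 = 0 := by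
  funext α J
  change mderiv J.exps (fun _ => (0 : ℝ)) x = 0
  rw [mderiv_eq_iterDir, iterDir_zero]

lemma isBigO_of_jet_eq_zero {f : (Fin p → ℝ) → (Fin q → ℝ)} {x : Fin p → ℝ}
    (hf : ContDiffAt ℝ ∞ f x) (h : (jet m f x).2 = 0) :
    f =O[𝓝 x] fun y => ‖y - x‖ ^ (m + 1) :=
  Asymptotics.isBigO_pi.2 fun α =>
    isBigO_of_iterDir_eq_zero m (hf.jet_component α)
      (iterDir_eq_zero_of_mderiv (hf.jet_component α) fun J => congrFun (congrFun h α) J)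

/-- The Taylor polynomial differs from `f` by `O(|y - x|^{m+1})`, so it is itself of this order,
hence zero. -/
lemma jet_eq_zero_of_isBigO {f : (Fin p → ℝ) → (Fin q → ℝ)} {x : Fin p → ℝ}
    (hf : ContDiffAt ℝ ∞ f x) (h : f =O[𝓝 x] fun y => ‖y - x‖ ^ (m + 1)) :
    (jet m f x).2 = 0 := by
  set j := jet m f x with hj
  have h1 : (jet m (fun y => f y - j.rep y) x).2 = 0 := by
    rw [jet_sub hf (contDiff_rep j).contDiffAt, sub_eq_zero]
    exact (congrArg Prod.snd (jet_rep j)).symm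
  have h2 := isBigO_of_jet_eq_zero (hf.sub (contDiff_rep j).contDiffAt) h1
  have h3 : j.rep =O[𝓝 j.1] fun y => ‖y - j.1‖ ^ (m + 1) := by
    have := h.sub h2
    simp only [sub_sub_cancel] at this
    exact this
  have h4 := jet_rep j
  rw [rep_eq_zero_of_isBigO h3] at h4
  rw [← h4]
  exact jet_zero _

/-- Two functions have the same `m`-jet at `x` if and only if they have contact of order `m`. -/
lemma jet_eq_iff_isBigO {f g : (Fin p → ℝ) → (Fin q → ℝ)} {x : Fin p → ℝ}
    (hf : ContDiffAt ℝ ∞ f x) (hg : ContDiffAt ℝ ∞ g x) :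
    jet m f x = jet m g x ↔ (fun y => f y - g y) =O[𝓝 x] fun y => ‖y - x‖ ^ (m + 1) := by
  have h1 : jet m f x = jet m g x ↔ (jet m (fun y => f y - g y) x).2 = 0 := by
    rw [jet_sub hf hg, sub_eq_zero]
    exact ⟨fun h => congrArg Prod.snd h, fun h => Prod.ext rfl h⟩
  rw [h1]
  exact ⟨isBigO_of_jet_eq_zero (hf.sub hg), jet_eq_zero_of_isBigO (hf.sub hg)⟩

/-- The jets of the slices of a smooth family of functions. -/
lemma jet_slice {C : Type} [NormedAddCommGroup C] [NormedSpace ℝ C]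
    {f : C × (Fin p → ℝ) → (Fin q → ℝ)} {z : C × (Fin p → ℝ)} (hf : ContDiffAt ℝ ∞ f z) :
    ∀ᶠ w in 𝓝 z, jet m (fun y => f (w.1, y)) w.2 = (w.2, fun α (J : MultiIdx p m) =>
      iterDir ((MultiIdx.dirs J.exps).map fun v => ((0 : C), v)) (fun y => f y α) w) := by
  have h1 : ∀ᶠ w in 𝓝 z, ∀ (α : Fin q) (J : MultiIdx p m),
      iterDir (MultiIdx.dirs J.exps) (fun y => f (w.1, y) α) w.2 =
        iterDir ((MultiIdx.dirs J.exps).map fun v => ((0 : C), v)) (fun y => f y α) w := by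
    rw [Filter.eventually_all]
    intro α
    rw [Filter.eventually_all]
    intro J
    exact iterDir_slice (hf.jet_component α) _
  filter_upwards [h1] with w hw
  refine Prod.ext rfl (funext fun α => funext fun J => ?_)
  refine Eq.trans ?_ (hw α J)
  rw [← mderiv_eq_iterDir]
  rfl

lemma jet_comp_add_const (f : (Fin p → ℝ) → (Fin q → ℝ)) (a x : Fin p → ℝ) :
    (jet m (fun y => f (y + a)) x).2 = (jet m f (x + a)).2 := by
  funext α J
  change mderiv J.exps (fun y => f (y + a) α) x = mderiv J.exps (fun y => f y α) (x + a)
  rw [mderiv_eq_iterDir, mderiv_eq_iterDir]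
  exact congrFun (iterDir_comp_add_const (fun y => f y α) a _) x

end Contact

/-! ### Block triangular linear maps. -/

section LinearAlgebra

variable {C E F : Type} [NormedAddCommGroup C] [NormedSpace ℝ C] [NormedAddCommGroup E]
  [NormedSpace ℝ E] [NormedAddCommGroup F] [NormedSpace ℝ F]

lemma bijective_fst_prod_iff (a : C × E →L[ℝ] F) :
    Function.Bijective ((ContinuousLinearMap.fst ℝ C E).prod a) ↔
      Function.Bijective (a.comp (ContinuousLinearMap.inr ℝ C E)) := by
  have hz : ∀ z : C × E, a z = a (z.1, 0) + a (0, z.2) := fun z => by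
    rw [← map_add]; simp
  constructor
  · rintro ⟨hi, hs⟩
    refine ⟨fun x y hxy => ?_, fun w => ?_⟩
    · have : ((0 : C), x) = (0, y) := hi (Prod.ext rfl hxy)
      exact congrArg Prod.snd this
    · obtain ⟨⟨c, y⟩, hcy⟩ := hs (0, w)
      have h1 : c = 0 := congrArg Prod.fst hcy
      have h2 : a (c, y) = w := congrArg Prod.snd hcy
      subst h1
      exact ⟨y, h2⟩
  · rintro ⟨hi, hs⟩
    refine ⟨fun z z' h => ?_, fun w => ?_⟩
    · have h1 : z.1 = z'.1 := (Prod.ext_iff.1 h).1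
      have h2 : a z = a z' := (Prod.ext_iff.1 h).2
      rw [hz z, hz z', h1, add_right_inj] at h2
      exact Prod.ext h1 (hi h2)
    · obtain ⟨y, hy⟩ := hs (w.2 - a (w.1, 0))
      have hy' : a (0, y) = w.2 - a (w.1, 0) := hy
      refine ⟨(w.1, y), Prod.ext rfl ?_⟩
      change a (w.1, y) = w.2
      rw [hz, hy', add_sub_cancel]

lemma exists_equiv_of_bijective [CompleteSpace E] [CompleteSpace F] {a : E →L[ℝ] F}
    (ha : Function.Bijective a) : ∃ e : E ≃L[ℝ] F, a = e :=
  ⟨ContinuousLinearEquiv.ofBijective a (LinearMap.ker_eq_bot.2 ha.1) (LinearMap.range_eq_top.2 ha.2),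
    by ext; simp⟩

end LinearAlgebra

/-! ### The action of a change of variables on functions. -/

section Transform

variable {p q m : ℕ} {Φ : OpenPartialHomeomorph (Base p q) (Base p q)}

lemma IsSmoothChange.contDiffAt {E : Type} [NormedAddCommGroup E] [NormedSpace ℝ E]
    {Φ : OpenPartialHomeomorph E E} (hΦ : IsSmoothChange Φ) {b : E} (hb : b ∈ Φ.source) :
    ContDiffAt ℝ ∞ Φ b := hΦ.1.contDiffAt (Φ.open_source.mem_nhds hb)

lemma IsSmoothChange.symm {E : Type} [NormedAddCommGroup E] [NormedSpace ℝ E]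
    {Φ : OpenPartialHomeomorph E E} (hΦ : IsSmoothChange Φ) : IsSmoothChange Φ.symm :=
  ⟨hΦ.2, by simpa using hΦ.1⟩

/-- A smooth family of functions with transversal graphs is transformed by a change of variables
into a smooth family of functions. -/
lemma exists_transformed_family {C : Type} [NormedAddCommGroup C] [NormedSpace ℝ C]
    [CompleteSpace C] (hΦ : IsSmoothChange Φ) {h : C × (Fin p → ℝ) → (Fin q → ℝ)}
    {z₀ : C × (Fin p → ℝ)} (hh : ContDiffAt ℝ ∞ h z₀) (hs : (z₀.2, h z₀) ∈ Φ.source)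
    (ht : Transversal Φ (fun y => h (z₀.1, y)) z₀.2) :
    ∃ g : C × (Fin p → ℝ) → (Fin q → ℝ), ∀ᶠ z in 𝓝 z₀, (z.2, h z) ∈ Φ.source ∧
      (Φ (z.2, h z)).2 = g (z.1, (Φ (z.2, h z)).1) ∧
      (ContDiffAt ℝ ∞ h z → ContDiffAt ℝ ∞ g (z.1, (Φ (z.2, h z)).1)) ∧
      Transversal Φ (fun y => h (z.1, y)) z.2 := by
  let σ : C × (Fin p → ℝ) → (Fin p → ℝ) := fun z => (Φ (z.2, h z)).1
  -- Carrying the parameter along makes the differential block triangular, so it is invertible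
  -- exactly when the slice is transversal. The inverse expresses the old independent variables
  -- through the new ones, and invertibility at nearby points gives transversality of nearby slices.
  let f : C × (Fin p → ℝ) → C × (Fin p → ℝ) := fun z => (z.1, σ z)
  have hσs : ∀ z, ContDiffAt ℝ ∞ h z → (z.2, h z) ∈ Φ.source → ContDiffAt ℝ ∞ σ z := by
    intro z hz hzs
    exact contDiffAt_fst.comp z (ContDiffAt.comp (f := fun z : C × (Fin p → ℝ) => (z.2, h z)) z
      (hΦ.contDiffAt hzs) (contDiffAt_snd.prodMk hz))
  have hfs : ∀ z, ContDiffAt ℝ ∞ h z → (z.2, h z) ∈ Φ.source → ContDiffAt ℝ ∞ f z :=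
    fun z hz hzs => contDiffAt_fst.prodMk (hσs z hz hzs)
  have hfd : ∀ z, DifferentiableAt ℝ f z →
      fderiv ℝ f z = (ContinuousLinearMap.fst ℝ C (Fin p → ℝ)).prod (fderiv ℝ σ z) ∧
      fderiv ℝ (fun y => (Φ (y, h (z.1, y))).1) z.2 =
        (fderiv ℝ σ z).comp (ContinuousLinearMap.inr ℝ C (Fin p → ℝ)) := by
    intro z hz
    have hσ : DifferentiableAt ℝ σ z := hz.snd
    refine ⟨(hasFDerivAt_fst.prodMk hσ.hasFDerivAt).fderiv, ?_⟩
    exact (HasFDerivAt.comp (f := fun y : Fin p → ℝ => (z.1, y)) z.2 hσ.hasFDerivAt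
      (hasFDerivAt_prodMk_right z.1 z.2)).fderiv
  have hf₀ := hfs z₀ hh hs
  obtain ⟨h1, h2⟩ := hfd z₀ (hf₀.differentiableAt (by simp))
  have hbij : Function.Bijective (fderiv ℝ f z₀) := by
    rw [h1, bijective_fst_prod_iff, ← h2]
    exact ht
  obtain ⟨e, he⟩ := exists_equiv_of_bijective hbij
  have hU : ∀ᶠ z in 𝓝 z₀, (z.2, h z) ∈ Φ.source :=
    (continuousAt_snd.prodMk hh.continuousAt).eventually (Φ.open_source.mem_nhds hs)
  obtain ⟨Ψ, hzΨ, hΨU, hΨf, hΨs, hΨd⟩ := exists_openPartialHomeomorph hf₀ he hU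
  refine ⟨fun w => (Φ ((Ψ.symm w).2, h (Ψ.symm w))).2, ?_⟩
  filter_upwards [Ψ.open_source.mem_nhds hzΨ] with z hz
  have hzs : (z.2, h z) ∈ Φ.source := hΨU hz
  have hinv : Ψ.symm (z.1, (Φ (z.2, h z)).1) = z :=
    (congrArg Ψ.symm (congrFun hΨf z).symm).trans (Ψ.left_inv hz)
  refine ⟨hzs, ?_, fun hhz => ?_, ?_⟩
  · simp only [hinv]
  · have h3 : ContDiffAt ℝ ∞ Ψ.symm (z.1, (Φ (z.2, h z)).1) := hΨs z hz (hfs z hhz hzs)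
    have h4 : ContDiffAt ℝ ∞ (fun z : C × (Fin p → ℝ) => (Φ (z.2, h z)).2)
        (Ψ.symm (z.1, (Φ (z.2, h z)).1)) := by
      rw [hinv]
      exact contDiffAt_snd.comp z (ContDiffAt.comp (f := fun z : C × (Fin p → ℝ) => (z.2, h z)) z
        (hΦ.contDiffAt hzs) (contDiffAt_snd.prodMk hhz))
    exact h4.comp _ h3
  · obtain ⟨hdz, e', he'⟩ := hΨd z hz
    obtain ⟨h3, h4⟩ := hfd z hdz
    change Function.Bijective _
    rw [h4, ← bijective_fst_prod_iff, ← h3, he']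
    exact e'.bijective

/-- Every function with transversal graph is transformed into a function. -/
lemma exists_transformed (hΦ : IsSmoothChange Φ) {f : (Fin p → ℝ) → (Fin q → ℝ)} {x : Fin p → ℝ}
    (hf : ContDiffAt ℝ ∞ f x) (hs : (x, f x) ∈ Φ.source) (ht : Transversal Φ f x) :
    ∃ g : (Fin p → ℝ) → (Fin q → ℝ), MapsGraph Φ f g x ∧
      ∀ᶠ y in 𝓝 x, ContDiffAt ℝ ∞ f y → ContDiffAt ℝ ∞ g (Φ (y, f y)).1 := by
  have hf' : ContDiffAt ℝ ∞ (fun z : ℝ × (Fin p → ℝ) => f z.2) (0, x) :=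
    ContDiffAt.comp (f := fun z : ℝ × (Fin p → ℝ) => z.2) (0, x) hf contDiffAt_snd
  obtain ⟨g, hg⟩ := exists_transformed_family (C := ℝ) hΦ hf' hs ht
  have hc : ContinuousAt (fun y : Fin p → ℝ => ((0 : ℝ), y)) x := by fun_prop
  refine ⟨fun w => g (0, w), ?_, ?_⟩
  · filter_upwards [hc.eventually hg] with y hy
    exact hy.2.1
  · filter_upwards [hc.eventually hg] with y hy hfy
    have h1 : ContDiffAt ℝ ∞ g (0, (Φ (y, f y)).1) := hy.2.2.1
      (ContDiffAt.comp (f := fun z : ℝ × (Fin p → ℝ) => z.2) (0, y) hfy contDiffAt_snd)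
    exact h1.comp (f := fun w : Fin p → ℝ => ((0 : ℝ), w)) _ (contDiffAt_const.prodMk contDiffAt_id)

/-- The new independent variables are coordinates on a transversal graph. -/
lemma exists_graph_coordinates (hΦ : IsSmoothChange Φ) {f : (Fin p → ℝ) → (Fin q → ℝ)}
    {x : Fin p → ℝ} (hf : ContDiffAt ℝ ∞ f x) (hs : (x, f x) ∈ Φ.source) (ht : Transversal Φ f x) :
    ∃ (Ψ : OpenPartialHomeomorph (Fin p → ℝ) (Fin p → ℝ)) (e : (Fin p → ℝ) ≃L[ℝ] (Fin p → ℝ)),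
      x ∈ Ψ.source ∧ (∀ y, Ψ y = (Φ (y, f y)).1) ∧ (∀ y ∈ Ψ.source, (y, f y) ∈ Φ.source) ∧
      HasFDerivAt Ψ.symm (e : (Fin p → ℝ) →L[ℝ] (Fin p → ℝ)) (Φ (x, f x)).1 ∧
      (Φ (x, f x)).1 ∈ Ψ.target ∧ Ψ.symm (Φ (x, f x)).1 = x := by
  have hσ : ContDiffAt ℝ ∞ (fun y => (Φ (y, f y)).1) x :=
    contDiffAt_fst.comp x (ContDiffAt.comp (f := fun y : Fin p → ℝ => (y, f y)) x
      (hΦ.contDiffAt hs) (contDiffAt_id.prodMk hf))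
  obtain ⟨e, he⟩ := exists_equiv_of_bijective ht
  have hU : ∀ᶠ y in 𝓝 x, (y, f y) ∈ Φ.source :=
    (continuousAt_id.prodMk hf.continuousAt).eventually (Φ.open_source.mem_nhds hs)
  obtain ⟨Ψ, hxΨ, hΨU, hΨf, -, -⟩ := exists_openPartialHomeomorph hσ he hU
  have hΨf' : ∀ y, Ψ y = (Φ (y, f y)).1 := fun y => congrFun hΨf y
  have hinv : Ψ.symm (Φ (x, f x)).1 = x := by rw [← hΨf']; exact Ψ.left_inv hxΨ
  have hmem : (Φ (x, f x)).1 ∈ Ψ.target := by rw [← hΨf']; exact Ψ.map_source hxΨ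
  refine ⟨Ψ, e.symm, hxΨ, hΨf', fun y hy => hΨU hy, ?_, hmem, hinv⟩
  refine Ψ.hasFDerivAt_symm hmem ?_
  rw [hinv, hΨf, ← he]
  exact (hσ.differentiableAt (by simp)).hasFDerivAt

/-- Over `w`, the point `Φ.symm (w, g w)` is the point of the graph of `f` above `Ψ.symm w`, where
`Ψ` is the new coordinate on that graph. The map to test for transversality is therefore `Ψ.symm`.
-/
lemma mapsGraph_symm (hΦ : IsSmoothChange Φ) {f g : (Fin p → ℝ) → (Fin q → ℝ)}
    {x : Fin p → ℝ} (hf : ContDiffAt ℝ ∞ f x) (hs : (x, f x) ∈ Φ.source) (ht : Transversal Φ f x)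
    (hg : MapsGraph Φ f g x) :
    MapsGraph Φ.symm g f (Φ (x, f x)).1 ∧ Transversal Φ.symm g (Φ (x, f x)).1 := by
  obtain ⟨Ψ, e, hxΨ, hΨf, hΨs, hd, hmem, hinv⟩ := exists_graph_coordinates hΦ hf hs ht
  have hc : Filter.Tendsto Ψ.symm (𝓝 (Φ (x, f x)).1) (𝓝 x) := by
    have := hd.continuousAt.tendsto
    rwa [hinv] at this
  have hkey : ∀ᶠ w in 𝓝 (Φ (x, f x)).1, Φ.symm (w, g w) = (Ψ.symm w, f (Ψ.symm w)) := by
    filter_upwards [hc.eventually hg, Ψ.open_target.mem_nhds hmem] with w hw hwt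
    have h1 : (Φ (Ψ.symm w, f (Ψ.symm w))).1 = w := by rw [← hΨf, Ψ.right_inv hwt]
    have h2 : (w, g w) = Φ (Ψ.symm w, f (Ψ.symm w)) := by
      refine Prod.ext h1.symm ?_
      rw [hw, h1]
    rw [h2]
    exact Φ.left_inv (hΨs _ (Ψ.map_target hwt))
  constructor
  · filter_upwards [hkey] with w hw
    rw [hw]
  · have h1 : (fun w => (Φ.symm (w, g w)).1) =ᶠ[𝓝 (Φ (x, f x)).1] Ψ.symm :=
      hkey.mono fun w hw => congrArg Prod.fst hw
    change Function.Bijective _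
    rw [h1.fderiv_eq, hd.fderiv]
    exact e.bijective

/-- Contact of order `m` is preserved by changes of variables. -/
lemma jet_eq_of_mapsGraph (hΦ : IsSmoothChange Φ) {f h g g' : (Fin p → ℝ) → (Fin q → ℝ)}
    {x : Fin p → ℝ} (hf : ContDiffAt ℝ ∞ f x) (hh : ContDiffAt ℝ ∞ h x)
    (hfh : jet m f x = jet m h x) (hs : (x, f x) ∈ Φ.source) (ht : Transversal Φ f x)
    (hg : ContDiffAt ℝ ∞ g (Φ (x, f x)).1) (hg' : ContDiffAt ℝ ∞ g' (Φ (x, f x)).1)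
    (hfg : MapsGraph Φ f g x) (hhg' : MapsGraph Φ h g' x) :
    jet m g (Φ (x, f x)).1 = jet m g' (Φ (x, f x)).1 := by
  obtain ⟨Ψ, e, hxΨ, hΨf, hΨs, hd, hmem, hinv⟩ := exists_graph_coordinates hΦ hf hs ht
  have hx : f x = h x := by
    have := congrArg Jet.base hfh
    rw [jet_base, jet_base] at this
    exact congrArg Prod.snd this
  rw [jet_eq_iff_isBigO hg hg']
  set w₀ := (Φ (x, f x)).1 with hw₀
  have hO := (jet_eq_iff_isBigO hf hh).1 hfh
  have hcf : ContinuousAt (fun y => (y, f y)) x := continuousAt_id.prodMk hf.continuousAt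
  have hch : ContinuousAt (fun y => (y, h y)) x := continuousAt_id.prodMk hh.continuousAt
  have hΦx := (hΦ.contDiffAt hs)
  have hΦ1 : (fun y => Φ (y, f y) - Φ (y, h y)) =O[𝓝 x] fun y => ‖y - x‖ ^ (m + 1) := by
    have h1 := (hΦx.hasStrictFDerivAt (by simp)).isBigO_sub
    have h2 : Filter.Tendsto (fun y => ((y, f y), (y, h y))) (𝓝 x) (𝓝 ((x, f x), (x, f x))) := by
      have := (hcf.prodMk hch).tendsto
      simpa only [← hx] using this
    refine (h1.comp_tendsto h2).trans (Asymptotics.IsBigO.trans (Asymptotics.IsBigO.of_bound 1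
      (Filter.Eventually.of_forall fun y => ?_)) hO)
    simp [Prod.norm_def]
  have hcσf : Filter.Tendsto (fun y => (Φ (y, f y)).1) (𝓝 x) (𝓝 w₀) :=
    (continuousAt_fst.comp
      (ContinuousAt.comp (f := fun y => (y, f y)) (x := x) hΦx.continuousAt hcf)).tendsto
  have hcσh : Filter.Tendsto (fun y => (Φ (y, h y)).1) (𝓝 x) (𝓝 w₀) := by
    have h1 : ContinuousAt Φ (x, h x) := by rw [← hx]; exact hΦx.continuousAt
    have := continuousAt_fst.comp (ContinuousAt.comp (f := fun y => (y, h y)) (x := x) h1 hch)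
    rw [hw₀, hx]
    exact this
  have hg1 : (fun y => g' (Φ (y, h y)).1 - g' (Φ (y, f y)).1) =O[𝓝 x]
      fun y => ‖y - x‖ ^ (m + 1) := by
    have h1 := (hg'.hasStrictFDerivAt (by simp)).isBigO_sub
    have h2 := h1.comp_tendsto (hcσh.prodMk_nhds hcσf)
    refine h2.trans (Asymptotics.IsBigO.trans (Asymptotics.IsBigO.of_bound 1
      (Filter.Eventually.of_forall fun y => ?_)) hΦ1)
    rw [one_mul, ← norm_neg]
    simp only [Function.comp, neg_sub]
    exact norm_fst_le (Φ (y, f y) - Φ (y, h y))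
  have hρ : (fun y => (Φ (y, f y)).2 - (Φ (y, h y)).2) =O[𝓝 x] fun y => ‖y - x‖ ^ (m + 1) :=
    Asymptotics.IsBigO.trans (Asymptotics.IsBigO.of_bound 1
      (Filter.Eventually.of_forall fun y => by
        rw [one_mul]; exact norm_snd_le (Φ (y, f y) - Φ (y, h y)))) hΦ1
  -- Insert `g' (Φ (y, h y)).1`, which is `(Φ (y, h y)).2`. Both resulting differences are
  -- controlled by `f - h`, since `Φ` and `g'` are Lipschitz near the points in question. It then
  -- remains to pass from `y` to `w = (Φ (y, f y)).1`.
  have hmain : (fun y => g (Φ (y, f y)).1 - g' (Φ (y, f y)).1) =O[𝓝 x]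
      fun y => ‖y - x‖ ^ (m + 1) := by
    refine (hρ.add hg1).congr' ?_ Filter.EventuallyEq.rfl
    filter_upwards [hfg, hhg'] with y hy hy'
    rw [hy, hy']
    abel
  have hc : Filter.Tendsto Ψ.symm (𝓝 w₀) (𝓝 x) := by
    have := hd.continuousAt.tendsto
    rwa [hinv] at this
  have hτ : (fun w => Ψ.symm w - x) =O[𝓝 w₀] fun w => w - w₀ := by
    have := hd.isBigO_sub
    rwa [hinv] at this
  have hfin : (fun w => ‖Ψ.symm w - x‖ ^ (m + 1)) =O[𝓝 w₀] fun w => ‖w - w₀‖ ^ (m + 1) :=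
    hτ.norm_norm.pow (m + 1)
  refine ((hmain.comp_tendsto hc).trans hfin).congr' ?_ Filter.EventuallyEq.rfl
  filter_upwards [Ψ.open_target.mem_nhds hmem] with w hw
  simp only [Function.comp, ← hΨf, Ψ.right_inv hw]

end Transform

/-! ### The prolongation of a change of variables. -/

section JetImage

variable {p q m : ℕ} {Φ : OpenPartialHomeomorph (Base p q) (Base p q)}

/-- The change of variables `Φ` transforms some function with jet `j` into a function with
jet `j'`. -/
def IsJetImage (Φ : OpenPartialHomeomorph (Base p q) (Base p q)) (j j' : Jet p q m) : Prop :=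
  j.base ∈ Φ.source ∧ ∃ f g : (Fin p → ℝ) → (Fin q → ℝ), ContDiffAt ℝ ∞ f j.1 ∧
    jet m f j.1 = j ∧ Transversal Φ f j.1 ∧ ContDiffAt ℝ ∞ g (Φ j.base).1 ∧
    MapsGraph Φ f g j.1 ∧ jet m g (Φ j.base).1 = j'

lemma base_of_jet_eq {f : (Fin p → ℝ) → (Fin q → ℝ)} {j : Jet p q m} (h : jet m f j.1 = j) :
    j.base = (j.1, f j.1) := by
  conv_lhs => rw [← h]
  rw [jet_base]

/-- Preservation of contact makes the image independent of the function chosen to represent the jet.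
-/
lemma IsJetImage.eq_jet (hΦ : IsSmoothChange Φ) {j j' : Jet p q m} (h : IsJetImage Φ j j')
    {f g : (Fin p → ℝ) → (Fin q → ℝ)} (hf : ContDiffAt ℝ ∞ f j.1) (hfj : jet m f j.1 = j)
    (ht : Transversal Φ f j.1) (hg : ContDiffAt ℝ ∞ g (Φ j.base).1) (hfg : MapsGraph Φ f g j.1) :
    jet m g (Φ j.base).1 = j' := by
  obtain ⟨hs, f', g', hf', hf'j, ht', hg', hfg', rfl⟩ := h
  have hb := base_of_jet_eq hfj
  rw [hb] at hs hg hg' ⊢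
  exact jet_eq_of_mapsGraph hΦ hf hf' (hfj.trans hf'j.symm) hs ht hg hg' hfg hfg'

lemma IsJetImage.unique (hΦ : IsSmoothChange Φ) {j j' j'' : Jet p q m} (h : IsJetImage Φ j j')
    (h' : IsJetImage Φ j j'') : j' = j'' := by
  obtain ⟨_, f, g, hf, hfj, ht, hg, hfg, rfl⟩ := h
  exact h'.eq_jet hΦ hf hfj ht hg hfg

lemma IsJetImage.base_eq {j j' : Jet p q m} (h : IsJetImage Φ j j') : j'.base = Φ j.base := by
  obtain ⟨hs, f, g, hf, hfj, ht, hg, hfg, rfl⟩ := h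
  rw [jet_base]
  refine Prod.ext rfl ?_
  rw [base_of_jet_eq hfj]
  exact hfg.self_of_nhds.symm

lemma IsJetImage.symm (hΦ : IsSmoothChange Φ) {j j' : Jet p q m} (h : IsJetImage Φ j j') :
    IsJetImage Φ.symm j' j := by
  have hb' := h.base_eq
  obtain ⟨hs, f, g, hf, hfj, ht, hg, hfg, rfl⟩ := h
  have hb := base_of_jet_eq hfj
  have hs' := hs
  rw [hb] at hs'
  obtain ⟨h1, h2⟩ := mapsGraph_symm hΦ hf hs' ht hfg
  have hinv : Φ.symm (jet m g (Φ j.base).1).base = j.base := by rw [hb', Φ.left_inv hs]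
  refine ⟨?_, g, f, hg, rfl, ?_, ?_, ?_, ?_⟩
  · rw [hb']; exact Φ.map_source hs
  · rw [jet_fst, hb]; exact h2
  · rw [hinv]; exact hf
  · rw [jet_fst, hb]; exact h1
  · rw [hinv]; exact hfj

lemma exists_isJetImage (hΦ : IsSmoothChange Φ) {j : Jet p q m} (hs : j.base ∈ Φ.source)
    {f : (Fin p → ℝ) → (Fin q → ℝ)} (hf : ContDiffAt ℝ ∞ f j.1) (hfj : jet m f j.1 = j)
    (ht : Transversal Φ f j.1) : ∃ g : (Fin p → ℝ) → (Fin q → ℝ),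
      ContDiffAt ℝ ∞ g (Φ j.base).1 ∧ MapsGraph Φ f g j.1 ∧
        IsJetImage Φ j (jet m g (Φ j.base).1) := by
  have hb := base_of_jet_eq hfj
  have hs' := hs
  rw [hb] at hs'
  obtain ⟨g, hfg, hg⟩ := exists_transformed hΦ hf hs' ht
  have hg' : ContDiffAt ℝ ∞ g (Φ j.base).1 := by
    rw [hb]; exact hg.self_of_nhds hf
  exact ⟨g, hg', hfg, hs, f, g, hf, hfj, ht, hg', hfg, rfl⟩

lemma contDiff_rep_uncurried :
    ContDiff ℝ ∞ fun z : Jet p q m × (Fin p → ℝ) => z.1.rep z.2 := by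
  unfold Jet.rep
  fun_prop

lemma contDiff_base : ContDiff ℝ ∞ (Jet.base : Jet p q m → Base p q) := by
  unfold Jet.base
  fun_prop

/-- The image of a jet under a change of variables depends smoothly on the jet. -/
lemma IsJetImage.exists_contDiffAt (hΦ : IsSmoothChange Φ) {j₀ j₀' : Jet p q m}
    (h : IsJetImage Φ j₀ j₀') : ∃ G : Jet p q m → Jet p q m, ContDiffAt ℝ ∞ G j₀ ∧
      ∀ᶠ j in 𝓝 j₀, IsJetImage Φ j (G j) := by
  obtain ⟨hs, f₀, -, hf₀, hfj₀, ht, -, -, -⟩ := h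
  let r : (Fin p → ℝ) → (Fin q → ℝ) := fun y => f₀ y - j₀.rep y
  have hr : ContDiffAt ℝ ∞ r j₀.1 := hf₀.sub (contDiff_rep j₀).contDiffAt
  have hrj : (jet m r j₀.1).2 = 0 := by
    rw [jet_sub hf₀ (contDiff_rep j₀).contDiffAt, hfj₀, jet_rep, sub_self]
  -- A smooth family realising every jet `j` at `j.1` and equal to `f₀` at `j₀`. The translated
  -- remainder `r` is needed because transversality is known only for `f₀`: when `m = 0` it depends
  -- on first derivatives that the jet does not record.
  let k : Jet p q m × (Fin p → ℝ) → (Fin q → ℝ) := fun z => z.1.rep z.2 + r (z.2 + (j₀.1 - z.1.1))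
  have hkd : ∀ j : Jet p q m, ContDiffAt ℝ ∞ k (j, j.1) := by
    intro j
    have h1 : ContDiffAt ℝ ∞ r (j.1 + (j₀.1 - j.1)) := by rw [add_sub_cancel]; exact hr
    have h2 : ContDiff ℝ ∞ fun z : Jet p q m × (Fin p → ℝ) => z.2 + (j₀.1 - z.1.1) := by fun_prop
    exact contDiff_rep_uncurried.contDiffAt.add
      (ContDiffAt.comp (f := fun z : Jet p q m × (Fin p → ℝ) => z.2 + (j₀.1 - z.1.1)) (j, j.1)
        h1 h2.contDiffAt)
  have hks : ∀ j : Jet p q m, ContDiffAt ℝ ∞ (fun y => k (j, y)) j.1 := fun j =>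
    (hkd j).comp (f := fun y : Fin p → ℝ => (j, y)) j.1 (contDiffAt_const.prodMk contDiffAt_id)
  have hkj : ∀ j : Jet p q m, jet m (fun y => k (j, y)) j.1 = j := by
    intro j
    have hr' : ContDiffAt ℝ ∞ (fun y => r (y + (j₀.1 - j.1))) j.1 := by
      have h1 : ContDiffAt ℝ ∞ r (j.1 + (j₀.1 - j.1)) := by rw [add_sub_cancel]; exact hr
      exact h1.comp (f := fun y => y + (j₀.1 - j.1)) j.1 (contDiffAt_id.add contDiffAt_const)
    have h1 := jet_sub (m := m) (hks j) hr'
    rw [jet_comp_add_const, add_sub_cancel, hrj, sub_zero] at h1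
    have h2 : (fun y => k (j, y) - r (y + (j₀.1 - j.1))) = j.rep := by
      funext y; simp [k]
    rw [h2, jet_rep] at h1
    exact Prod.ext rfl h1.symm
  have hk₀ : (fun y => k (j₀, y)) = f₀ := by
    funext y; simp [k, r]
  have hb₀ : j₀.base = (j₀.1, k (j₀, j₀.1)) := base_of_jet_eq (hkj j₀)
  obtain ⟨g, hg⟩ := exists_transformed_family (C := Jet p q m) hΦ (hkd j₀)
    (by rw [← hb₀]; exact hs) (by rw [hk₀]; exact ht)
  have hc : ContinuousAt (fun j : Jet p q m => (j, j.1)) j₀ := by fun_prop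
  have hw : ∀ᶠ j in 𝓝 j₀, j.base ∈ Φ.source :=
    contDiff_base.continuous.continuousAt.eventually (Φ.open_source.mem_nhds hs)
  let W : Jet p q m → Jet p q m × (Fin p → ℝ) := fun j => (j, (Φ j.base).1)
  have hW : ContDiffAt ℝ ∞ W j₀ := contDiffAt_id.prodMk (contDiffAt_fst.comp j₀
    (ContDiffAt.comp (f := Jet.base) j₀ (hΦ.contDiffAt hs) contDiff_base.contDiffAt))
  have hgs : ContDiffAt ℝ ∞ g (W j₀) := by
    have := hg.self_of_nhds.2.2.1 (hkd j₀)
    rwa [← hb₀] at this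
  refine ⟨fun j => jet m (fun y => g (j, y)) (Φ j.base).1, ?_, ?_⟩
  · have h1 : ∀ᶠ j in 𝓝 j₀, jet m (fun y => g (j, y)) (Φ j.base).1 =
        ((Φ j.base).1, fun α (J : MultiIdx p m) => iterDir ((MultiIdx.dirs J.exps).map
          fun v => ((0 : Jet p q m), v)) (fun y => g y α) (W j)) :=
      hW.continuousAt.eventually (jet_slice (m := m) hgs)
    refine ContDiffAt.congr_of_eventuallyEq ?_ h1
    refine (contDiffAt_snd.comp j₀ hW).prodMk (contDiffAt_pi.2 fun α => contDiffAt_pi.2 fun J => ?_)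
    exact ((hgs.jet_component α).iterDir _).comp j₀ hW
  · filter_upwards [hc.eventually hg.eventually_nhds, hw] with j hj hjs
    have hb : j.base = (j.1, k (j, j.1)) := base_of_jet_eq (hkj j)
    have hj0 := hj.self_of_nhds
    have hcj : ContinuousAt (fun y : Fin p → ℝ => (j, y)) j.1 := by fun_prop
    have hgj : ContDiffAt ℝ ∞ g (j, (Φ j.base).1) := by
      have := hj0.2.2.1 (hkd j)
      rwa [← hb] at this
    refine ⟨hjs, fun y => k (j, y), fun y => g (j, y), hks j, hkj j, hj0.2.2.2, ?_, ?_, rfl⟩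
    · exact hgj.comp (f := fun y : Fin p → ℝ => (j, y)) _ (contDiffAt_const.prodMk contDiffAt_id)
    · filter_upwards [hcj.eventually hj] with y hy
      exact hy.2.1

open Classical in
/-- The action of a change of variables on jets. -/
def jetMap (Φ : OpenPartialHomeomorph (Base p q) (Base p q)) (j : Jet p q m) : Jet p q m :=
  if h : ∃ j', IsJetImage Φ j j' then h.choose else j

lemma IsJetImage.jetMap_eq (hΦ : IsSmoothChange Φ) {j j' : Jet p q m} (h : IsJetImage Φ j j') :
    jetMap Φ j = j' := by
  have hex : ∃ j', IsJetImage Φ j j' := ⟨j', h⟩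
  rw [jetMap, dif_pos hex]
  exact hex.choose_spec.unique hΦ h

lemma IsJetImage.eventually (hΦ : IsSmoothChange Φ) {j j' : Jet p q m} (h : IsJetImage Φ j j') :
    ContDiffAt ℝ ∞ (jetMap Φ : Jet p q m → Jet p q m) j ∧
      ∀ᶠ i in 𝓝 j, ∃ i', IsJetImage Φ i i' := by
  obtain ⟨G, hG, hGj⟩ := h.exists_contDiffAt hΦ
  exact ⟨hG.congr_of_eventuallyEq (hGj.mono fun i hi => hi.jetMap_eq hΦ),
    hGj.mono fun i hi => ⟨G i, hi⟩⟩

/-- The prolongation of a change of variables to the jet space. -/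
def jetHomeomorph (m : ℕ) (hΦ : IsSmoothChange Φ) :
    OpenPartialHomeomorph (Jet p q m) (Jet p q m) where
  toFun := jetMap Φ
  invFun := jetMap Φ.symm
  source := {j | ∃ j', IsJetImage Φ j j'}
  target := {j | ∃ j', IsJetImage Φ.symm j j'}
  map_source' := by
    rintro j ⟨j', h⟩
    rw [h.jetMap_eq hΦ]
    exact ⟨j, h.symm hΦ⟩
  map_target' := by
    rintro j ⟨j', h⟩
    rw [h.jetMap_eq hΦ.symm]
    exact ⟨j, by simpa using h.symm hΦ.symm⟩
  left_inv' := by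
    rintro j ⟨j', h⟩
    rw [h.jetMap_eq hΦ, (h.symm hΦ).jetMap_eq hΦ.symm]
  right_inv' := by
    rintro j ⟨j', h⟩
    have h' : IsJetImage Φ j' j := by simpa using h.symm hΦ.symm
    rw [h.jetMap_eq hΦ.symm, h'.jetMap_eq hΦ]
  open_source := isOpen_iff_mem_nhds.2 fun j ⟨_, h⟩ => (h.eventually hΦ).2
  open_target := isOpen_iff_mem_nhds.2 fun j ⟨_, h⟩ => (h.eventually hΦ.symm).2
  continuousOn_toFun := fun j ⟨_, h⟩ => (h.eventually hΦ).1.continuousAt.continuousWithinAt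
  continuousOn_invFun := fun j ⟨_, h⟩ => (h.eventually hΦ.symm).1.continuousAt.continuousWithinAt

lemma isSmoothChange_jetHomeomorph (hΦ : IsSmoothChange Φ) :
    IsSmoothChange (jetHomeomorph m hΦ) :=
  ⟨fun _ ⟨_, h⟩ => (h.eventually hΦ).1.contDiffWithinAt,
    fun _ ⟨_, h⟩ => (h.eventually hΦ.symm).1.contDiffWithinAt⟩

lemma isProlongation_jetHomeomorph (hΦ : IsSmoothChange Φ) :
    IsProlongation Φ (jetHomeomorph m hΦ) := by
  rintro j ⟨j', h⟩
  obtain ⟨hs, f, _, hf, hfj, ht, _⟩ := id h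
  refine ⟨hs, ⟨f, hf, hfj, ht⟩, fun f hf hfj ht => ?_⟩
  obtain ⟨g, hg, hfg, hj⟩ := exists_isJetImage hΦ hs hf hfj ht
  exact ⟨g, hg, hfg, hj.jetMap_eq hΦ⟩

end JetImage

/-! ### The prolonged change of variables carries `X^*` to `∂/∂s`. -/

section Pushforward

variable {n q m : ℕ} {Φ : OpenPartialHomeomorph (Base (n + 1) q) (Base (n + 1) q)}
  {X : Base (n + 1) q → Base (n + 1) q}

/-- The curves `s ↦ Φ⁻¹ (s, z, v)` are integral curves of `X`. -/
lemma Rectifies.fderiv_symm (hΦ : IsSmoothChange Φ) (hX : Rectifies Φ X) {b : Base (n + 1) q}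
    (hb : b ∈ Φ.source) : fderiv ℝ Φ.symm (Φ b) (Pi.single 0 1, 0) = X b := by
  have h1 : HasFDerivAt Φ (fderiv ℝ Φ b) b :=
    ((hΦ.contDiffAt hb).differentiableAt (by simp)).hasFDerivAt
  have h2 : HasFDerivAt Φ.symm (fderiv ℝ Φ.symm (Φ b)) (Φ b) :=
    ((hΦ.symm.contDiffAt (Φ.map_source hb)).differentiableAt (by simp)).hasFDerivAt
  have h3 : HasFDerivAt (Φ.symm ∘ Φ) (ContinuousLinearMap.id ℝ _) b := by
    refine (hasFDerivAt_id b).congr_of_eventuallyEq ?_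
    filter_upwards [Φ.open_source.mem_nhds hb] with y hy
    exact Φ.left_inv hy
  have h4 := congrArg (fun L => L (X b)) ((h2.comp b h1).unique h3)
  have h5 : fderiv ℝ Φ b (X b) = (Pi.single 0 1, 0) := hX b hb
  simp only [ContinuousLinearMap.comp_apply, h5] at h4
  exact h4

lemma Rectifies.hasDerivAt (hΦ : IsSmoothChange Φ) (hX : Rectifies Φ X) {b : Base (n + 1) q}
    (hb : b ∈ Φ.source) : HasDerivAt
      (fun t : ℝ => Φ.symm ((Φ b).1 + t • (Pi.single 0 1 : Fin (n + 1) → ℝ), (Φ b).2)) (X b) 0 := by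
  have h1 : HasDerivAt (fun t : ℝ => ((Φ b).1 + t • (Pi.single 0 1 : Fin (n + 1) → ℝ), (Φ b).2))
      ((Pi.single 0 1 : Fin (n + 1) → ℝ), (0 : Fin q → ℝ)) 0 := by
    have := ((hasDerivAt_id (0 : ℝ)).smul_const (Pi.single 0 1 : Fin (n + 1) → ℝ)).const_add (Φ b).1
    rw [one_smul] at this
    exact this.prodMk (hasDerivAt_const _ _)
  have h2 : HasFDerivAt Φ.symm (fderiv ℝ Φ.symm (Φ b))
      ((Φ b).1 + (0 : ℝ) • (Pi.single 0 1 : Fin (n + 1) → ℝ), (Φ b).2) := by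
    rw [zero_smul, add_zero]
    exact ((hΦ.symm.contDiffAt (Φ.map_source hb)).differentiableAt (by simp)).hasFDerivAt
  have h3 := h2.comp_hasDerivAt (0 : ℝ) h1
  rw [hX.fderiv_symm hΦ hb] at h3
  exact h3

lemma fderiv_eq_sum_pderiv {p : ℕ} {k : (Fin p → ℝ) → ℝ} (x v : Fin p → ℝ) :
    fderiv ℝ k x v = ∑ i, v i * pderiv i k x := by
  have hv : v = ∑ i, v i • (Pi.single i 1 : Fin p → ℝ) := by
    funext l
    simp [Finset.sum_apply, Pi.single_apply]
  conv_lhs => rw [hv]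
  simp [pderiv]

/-- The translates along `∂/∂s` of the transform of a function `f` correspond to a smooth
one-parameter deformation `F` of `f`, whose derivative is given by the characteristic of `X`. -/
lemma exists_deformation (hΦ : IsSmoothChange Φ) (hX : Rectifies Φ X)
    {f g : (Fin (n + 1) → ℝ) → (Fin q → ℝ)} {x : Fin (n + 1) → ℝ} (hf : ContDiffAt ℝ ∞ f x)
    (hs : (x, f x) ∈ Φ.source) (ht : Transversal Φ f x) (hfg : MapsGraph Φ f g x)
    (hg : ContDiffAt ℝ ∞ g (Φ (x, f x)).1) :
    ∃ F : ℝ × (Fin (n + 1) → ℝ) → (Fin q → ℝ), ContDiffAt ℝ ∞ F (0, x) ∧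
      (∀ᶠ y in 𝓝 x, F (0, y) = f y ∧ fderiv ℝ F (0, y) (1, (X (y, f y)).1) = (X (y, f y)).2) ∧
      ∀ᶠ t in 𝓝 (0 : ℝ), IsJetImage Φ.symm
        (jet m g (Φ (x, f x)).1 + t • ((Pi.single 0 1 : Fin (n + 1) → ℝ), 0))
        (jet m (fun y => F (t, y))
          (Φ.symm ((Φ (x, f x)).1 + t • (Pi.single 0 1 : Fin (n + 1) → ℝ), (Φ (x, f x)).2)).1) := by
  set w₀ := (Φ (x, f x)).1 with hw₀
  set e : Fin (n + 1) → ℝ := Pi.single 0 1 with he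
  have hgw : g w₀ = (Φ (x, f x)).2 := hfg.self_of_nhds.symm
  -- The translates of `g` along `∂/∂s`; `F` is the family that `Φ⁻¹` makes of them.
  let k : ℝ × (Fin (n + 1) → ℝ) → (Fin q → ℝ) := fun z => g (z.2 - z.1 • e)
  have hk : ∀ z : ℝ × (Fin (n + 1) → ℝ), z.2 - z.1 • e = w₀ → ContDiffAt ℝ ∞ k z := by
    intro z hz
    have h1 : ContDiff ℝ ∞ fun z : ℝ × (Fin (n + 1) → ℝ) => z.2 - z.1 • e :=
      contDiff_snd.sub (contDiff_fst.smul contDiff_const)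
    have h2 : ContDiffAt ℝ ∞ g (z.2 - z.1 • e) := by rw [hz]; exact hg
    exact ContDiffAt.comp (f := fun z : ℝ × (Fin (n + 1) → ℝ) => z.2 - z.1 • e) z h2 h1.contDiffAt
  have hk0 : (fun w => k (0, w)) = g := by funext w; simp [k]
  have hkt : ∀ (t : ℝ) (w : Fin (n + 1) → ℝ), k (t, w + t • e) = g w := fun t w => by simp [k]
  have hb : (w₀, k (0, w₀)) = Φ (x, f x) := by
    rw [show k (0, w₀) = g w₀ from congrFun hk0 w₀, hgw]
  have htg := (mapsGraph_symm hΦ hf hs ht hfg).2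
  obtain ⟨F, hF⟩ := exists_transformed_family (C := ℝ) (z₀ := (0, w₀)) hΦ.symm
    (hk (0, w₀) (by simp)) (by change (w₀, k (0, w₀)) ∈ _; rw [hb]; exact Φ.map_source hs)
    (by change Transversal Φ.symm (fun w => k (0, w)) w₀; rw [hk0]; exact htg)
  have hFx : ContDiffAt ℝ ∞ F (0, x) := by
    have := hF.self_of_nhds.2.2.1 (hk (0, w₀) (by simp))
    simp only [hb] at this
    rwa [Φ.left_inv hs] at this
  refine ⟨F, hFx, ?_, ?_⟩
  · have hc : ContinuousAt (fun y => ((0 : ℝ), (Φ (y, f y)).1)) x := by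
      have h1 : ContinuousAt (fun y => (y, f y)) x := continuousAt_id.prodMk hf.continuousAt
      exact continuousAt_const.prodMk (continuousAt_fst.comp
        (ContinuousAt.comp (f := fun y => (y, f y)) (x := x) (hΦ.contDiffAt hs).continuousAt h1))
    have hsrc : ∀ᶠ y in 𝓝 x, (y, f y) ∈ Φ.source :=
      (continuousAt_id.prodMk hf.continuousAt).eventually (Φ.open_source.mem_nhds hs)
    have hcx : ContinuousAt (fun y : Fin (n + 1) → ℝ => ((0 : ℝ), y)) x := by fun_prop
    filter_upwards [hc.eventually hF.eventually_nhds, hfg, hsrc,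
      hcx.eventually hFx.eventually_differentiableAt] with y hy hyg hys hyd
    have hgy : (Φ (y, f y)).2 = g (Φ (y, f y)).1 := hyg
    have hF0 : F (0, y) = f y := by
      have h1 := hy.self_of_nhds.2.1
      have h2 : k (0, (Φ (y, f y)).1) = (Φ (y, f y)).2 := by
        rw [hgy]; exact congrFun hk0 _
      simp only [h2, Prod.mk.eta, Φ.left_inv hys] at h1
      exact h1.symm
    refine ⟨hF0, ?_⟩
    have hd := hX.hasDerivAt hΦ hys
    have hd1 := hd.fst
    have hd2 := hd.snd
    have hpt : Φ.symm ((Φ (y, f y)).1 + (0 : ℝ) • e, (Φ (y, f y)).2) = (y, f y) := by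
      rw [zero_smul, add_zero]; exact Φ.left_inv hys
    have h3 : HasFDerivAt F (fderiv ℝ F (0, y))
        ((0 : ℝ), (Φ.symm ((Φ (y, f y)).1 + (0 : ℝ) • e, (Φ (y, f y)).2)).1) := by
      rw [hpt]; exact hyd.hasFDerivAt
    have h4 := h3.comp_hasDerivAt (0 : ℝ) ((hasDerivAt_id (0 : ℝ)).prodMk hd1)
    have hct : ContinuousAt (fun t : ℝ => (t, (Φ (y, f y)).1 + t • e)) 0 := by fun_prop
    have hct' : Filter.Tendsto (fun t : ℝ => (t, (Φ (y, f y)).1 + t • e)) (𝓝 0)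
        (𝓝 (0, (Φ (y, f y)).1)) := by
      have := hct.tendsto
      simpa using this
    -- The integral curve of `X` through `(y, f y)` lies at time `t` on the graph of `F (t, ·)`.
    -- Differentiating this at `t = 0` gives `∂_t F + ∑ ξ_i ∂_i F = φ`.
    have hev : (F ∘ fun t : ℝ => (t, (Φ.symm ((Φ (y, f y)).1 + t • e, (Φ (y, f y)).2)).1))
        =ᶠ[𝓝 0] fun t => (Φ.symm ((Φ (y, f y)).1 + t • e, (Φ (y, f y)).2)).2 := by
      filter_upwards [hct'.eventually hy] with t ht
      have h5 := ht.2.1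
      simp only [hkt, ← hgy] at h5
      exact h5.symm
    have hd3 : HasDerivAt (F ∘ fun t : ℝ => (t, (Φ.symm ((Φ (y, f y)).1 + t • e, (Φ (y, f y)).2)).1))
        (X (y, f y)).2 0 := HasDerivAt.congr_of_eventuallyEq hd2 hev
    exact h4.unique hd3
  · have hct : Filter.Tendsto (fun t : ℝ => (t, w₀ + t • e)) (𝓝 0) (𝓝 (0, w₀)) := by
      have : ContinuousAt (fun t : ℝ => (t, w₀ + t • e)) 0 := by fun_prop
      simpa using this.tendsto
    filter_upwards [hct.eventually hF.eventually_nhds] with t ht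
    have hkz := hk (t, w₀ + t • e) (by simp)
    have hcs : ContDiffAt ℝ ∞ (fun w => k (t, w)) (w₀ + t • e) :=
      hkz.comp (f := fun w : Fin (n + 1) → ℝ => (t, w)) _ (contDiffAt_const.prodMk contDiffAt_id)
    have h0 := ht.self_of_nhds
    have hval : k (t, w₀ + t • e) = (Φ (x, f x)).2 := by rw [hkt, hgw]
    have hjet : jet m (fun w => k (t, w)) (w₀ + t • e) = jet m g w₀ + t • (e, 0) := by
      refine Prod.ext rfl ?_
      have h1 := jet_comp_add_const (m := m) g (-(t • e)) (w₀ + t • e)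
      rw [add_neg_cancel_right] at h1
      have h2 : (fun w => k (t, w)) = fun y => g (y + -(t • e)) := by
        funext w; simp [k, sub_eq_add_neg]
      rw [h2, h1]
      simp
    have hbase : (jet m g w₀ + t • (e, (0 : Fin q → MultiIdx (n + 1) m → ℝ))).base =
        (w₀ + t • e, (Φ (x, f x)).2) := by
      rw [← hjet, jet_base, hval]
    have hF3 : ContDiffAt ℝ ∞ F (t, (Φ.symm (w₀ + t • e, (Φ (x, f x)).2)).1) := by
      have := h0.2.2.1 hkz
      simpa only [hval] using this
    refine ⟨?_, fun w => k (t, w), fun y => F (t, y), hcs, hjet, h0.2.2.2, ?_, ?_, ?_⟩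
    · rw [hbase, ← hval]; exact h0.1
    · rw [hbase]
      exact hF3.comp (f := fun y : Fin (n + 1) → ℝ => (t, y)) _
        (contDiffAt_const.prodMk contDiffAt_id)
    · have hcw : ContinuousAt (fun w : Fin (n + 1) → ℝ => (t, w)) (w₀ + t • e) := by fun_prop
      filter_upwards [hcw.eventually ht] with w hw
      exact hw.2.1
    · rw [hbase]

/-- The prolongation of `Φ⁻¹` maps `∂/∂s` to the prolongation of `X`. -/
theorem fderiv_jetMap_symm (hΦ : IsSmoothChange Φ) (hX : Rectifies Φ X) {j : Jet (n + 1) q m}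
    (hs : j.base ∈ Φ.source) (ht : Transversal Φ j.rep j.1) :
    fderiv ℝ (jetMap Φ.symm) (jetMap Φ j) ((Pi.single 0 1 : Fin (n + 1) → ℝ), 0) =
      prolong X j := by
  have hrep := jet_rep j
  have hrs := (contDiff_rep j).contDiffAt (x := j.1)
  obtain ⟨g, hg, hfg, hji⟩ := exists_isJetImage hΦ hs hrs hrep ht
  have hb := base_of_jet_eq hrep
  rw [hji.jetMap_eq hΦ]
  set f := j.rep with hf
  rw [hb] at hg hji hs ⊢
  obtain ⟨F, hF, hFode, hFjet⟩ := exists_deformation (m := m) hΦ hX hrs hs ht hfg hg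
  set x := j.1 with hx
  set w₀ := (Φ (x, f x)).1 with hw₀
  set e : Fin (n + 1) → ℝ := Pi.single 0 1 with he
  set ξ := (X (x, f x)).1 with hξ
  let c : ℝ → Fin (n + 1) → ℝ := fun t => (Φ.symm (w₀ + t • e, (Φ (x, f x)).2)).1
  have hc0 : c 0 = x := by
    simp only [c, zero_smul, add_zero, hw₀, Prod.mk.eta, Φ.left_inv hs]
  have hcd : HasDerivAt c ξ 0 := (hX.hasDerivAt hΦ hs).fst
  have hleft : HasDerivAt (fun t : ℝ => jetMap Φ.symm (jet m g w₀ + t • (e, 0)))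
      (fderiv ℝ (jetMap Φ.symm) (jet m g w₀) (e, 0)) 0 := by
    have h1 : HasDerivAt (fun t : ℝ => jet m g w₀ +
        t • (e, (0 : Fin q → MultiIdx (n + 1) m → ℝ))) (e, 0) 0 := by
      have := ((hasDerivAt_id (0 : ℝ)).smul_const
        (e, (0 : Fin q → MultiIdx (n + 1) m → ℝ))).const_add (jet m g w₀)
      rw [one_smul] at this
      exact this
    have h2 : HasFDerivAt (jetMap Φ.symm) (fderiv ℝ (jetMap Φ.symm) (jet m g w₀))
        (jet m g w₀ + (0 : ℝ) • (e, 0)) := by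
      rw [zero_smul, add_zero]
      exact ((hji.symm hΦ).eventually hΦ.symm).1.differentiableAt (by simp) |>.hasFDerivAt
    exact h2.comp_hasDerivAt (0 : ℝ) h1
  have hcurve : ContinuousAt (fun t => (t, c t)) 0 := continuousAt_id.prodMk hcd.continuousAt
  have hF' : ContDiffAt ℝ ∞ F (0, c 0) := by rw [hc0]; exact hF
  have hright : (fun t : ℝ => jetMap Φ.symm (jet m g w₀ + t • (e, 0))) =ᶠ[𝓝 0]
      fun t => (c t, fun α (J : MultiIdx (n + 1) m) =>
        iterDir ((MultiIdx.dirs J.exps).map fun v => ((0 : ℝ), v)) (fun y => F y α) (t, c t)) := by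
    filter_upwards [hFjet, hcurve.eventually (jet_slice (m := m) hF')] with t ht ht'
    rw [ht.jetMap_eq hΦ.symm]
    exact ht'
  have hcomp : ∀ (α : Fin q) (J : MultiIdx (n + 1) m), HasDerivAt
      (fun t => iterDir ((MultiIdx.dirs J.exps).map fun v => ((0 : ℝ), v)) (fun y => F y α) (t, c t))
      ((prolong X j).2 α J) 0 := by
    intro α J
    set l := MultiIdx.dirs J.exps with hl
    set l' := l.map fun v => ((0 : ℝ), v) with hl'
    have hFα : ContDiffAt ℝ ∞ (fun y => F y α) (0, x) := hF.jet_component α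
    have h1 : HasFDerivAt (iterDir l' fun y => F y α)
        (fderiv ℝ (iterDir l' fun y => F y α) (0, x)) (0, c 0) := by
      rw [hc0]; exact ((hFα.iterDir l').differentiableAt (by simp)).hasFDerivAt
    have h2 := h1.comp_hasDerivAt (0 : ℝ) ((hasDerivAt_id (0 : ℝ)).prodMk hcd)
    refine h2.congr_deriv ?_
    -- The velocity `(1, ξ)`, with `ξ` frozen at `x`, is a constant direction, so it commutes with
    -- the other derivatives.
    have h3 : fderiv ℝ (iterDir l' fun y => F y α) (0, x) (1, ξ) =
        iterDir l' (dirDeriv (1, ξ) fun y => F y α) (0, x) := by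
      have hp : ((1, ξ) :: l').Perm (l' ++ [(1, ξ)]) := (List.perm_append_singleton _ _).symm
      have := (iterDir_perm hFα hp).self_of_nhds
      rw [iterDir_append] at this
      exact this
    rw [h3]
    have h4 : iterDir l' (dirDeriv (1, ξ) fun y => F y α) (0, x) =
        iterDir l (fun y => dirDeriv (1, ξ) (fun y => F y α) (0, y)) x :=
      (iterDir_slice (hFα.dirDeriv _) l).self_of_nhds.symm
    rw [h4]
    have hfα : ContDiffAt ℝ ∞ (fun y => f y α) x := hrs.jet_component α
    let A : (Fin (n + 1) → ℝ) → ℝ := fun y => dirDeriv (1, ξ) (fun y => F y α) (0, y)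
    let B : (Fin (n + 1) → ℝ) → ℝ := fun y => ∑ i, ξ i * pderiv i (fun y => f y α) y
    have hA : ContDiffAt ℝ ∞ A x := (hFα.dirDeriv _).comp
      (f := fun y : Fin (n + 1) → ℝ => ((0 : ℝ), y)) x (contDiffAt_const.prodMk contDiffAt_id)
    have hpd : ∀ i, ContDiffAt ℝ ∞ (pderiv i fun y => f y α) x := fun i => hfα.dirDeriv _
    have hB : ContDiffAt ℝ ∞ B x := ContDiffAt.sum fun i _ => contDiffAt_const.mul (hpd i)
    -- At `t = 0` the characteristic is `∂_t F`, while `A` is `∂_t F` plus the derivative of `f`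
    -- along the frozen `ξ`, which is `B`. Hence `∂_J A` is `D_J Q + ∑ ξ_i ∂_J ∂_i f`, the component
    -- of the prolongation.
    have hchar : characteristic X f α =ᶠ[𝓝 x] fun y => A y - B y := by
      have hcx : ContinuousAt (fun y : Fin (n + 1) → ℝ => ((0 : ℝ), y)) x := by fun_prop
      filter_upwards [hFode.eventually_nhds, hcx.eventually hF.eventually_differentiableAt]
        with y hy hyd
      have hya : HasFDerivAt (fun y => F y α)
          ((ContinuousLinearMap.proj α).comp (fderiv ℝ F (0, y))) (0, y) :=
        (ContinuousLinearMap.proj (R := ℝ) (φ := fun _ : Fin q => ℝ) α).hasFDerivAt.comp _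
          hyd.hasFDerivAt
      have e1 : fderiv ℝ (fun y => F y α) (0, y) (1, (X (y, f y)).1) = (X (y, f y)).2 α := by
        rw [hya.fderiv]
        exact congrFun hy.self_of_nhds.2 α
      have e2 : ∀ v, fderiv ℝ (fun y => F y α) (0, y) (0, v) =
          ∑ i, v i * pderiv i (fun y => f y α) y := by
        intro v
        rw [← fderiv_eq_sum_pderiv]
        have e3 : (fun y => F (0, y) α) =ᶠ[𝓝 y] fun y => f y α :=
          hy.mono fun y' hy' => congrFun hy'.1 α
        rw [← e3.fderiv_eq]
        have e4 := HasFDerivAt.comp (f := fun y : Fin (n + 1) → ℝ => ((0 : ℝ), y)) y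
          (hya.differentiableAt.hasFDerivAt) (hasFDerivAt_prodMk_right (0 : ℝ) y)
        refine Eq.trans ?_ (congrArg (fun L => L v) e4.fderiv).symm
        simp
      have e5 : A y = (X (y, f y)).2 α +
          ∑ i, (ξ - (X (y, f y)).1) i * pderiv i (fun y => f y α) y := by
        rw [← e1, ← e2, ← map_add]
        simp [A, dirDeriv]
      rw [e5]
      simp only [characteristic, B, Pi.sub_apply, sub_mul, Finset.sum_sub_distrib]
      ring
    have h5 : iterDir l (characteristic X f α) x = iterDir l A x - iterDir l B x :=
      (hchar.iterDir l).self_of_nhds.trans (iterDir_sub hA hB l).self_of_nhds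
    have h6 : iterDir l B x = ∑ i, ξ i * iterDir l (pderiv i fun y => f y α) x := by
      refine (iterDir_sum Finset.univ (fun i => contDiffAt_const.mul (hpd i)) l).self_of_nhds.trans ?_
      refine Finset.sum_congr rfl fun i _ => ?_
      exact (iterDir_clm_comp (ContinuousLinearMap.mul ℝ ℝ (ξ i)) (hpd i) l).self_of_nhds
    change iterDir l A x = mderiv J.exps (characteristic X f α) x +
      ∑ i, (X j.base).1 i * mderiv J.exps (pderiv i fun y => f y α) x
    simp only [mderiv_eq_iterDir]
    rw [h5, h6, hb]
    ring
  have hR : HasDerivAt (fun t => (c t, fun α (J : MultiIdx (n + 1) m) =>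
        iterDir ((MultiIdx.dirs J.exps).map fun v => ((0 : ℝ), v)) (fun y => F y α) (t, c t)))
      (prolong X j) 0 := by
    have h1 : (prolong X j).1 = ξ := by
      change (X j.base).1 = _
      rw [hb]
    have h2 := hcd.prodMk (hasDerivAt_pi.2 fun α => hasDerivAt_pi.2 fun J => hcomp α J)
    rw [← h1] at h2
    exact h2
  exact hleft.unique (hR.congr_of_eventuallyEq hright)

end Pushforward

/-! ### The invariant form of a symmetric system in rectifying coordinates. -/

section InvariantForm

variable {n q m ν : ℕ} {Φ : OpenPartialHomeomorph (Base (n + 1) q) (Base (n + 1) q)}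
  {X : Base (n + 1) q → Base (n + 1) q}

/-- For `∂/∂s` the characteristic is `-∂_s f`, and its derivatives cancel the terms `ξ_i u_{α,J,i}`.
-/
lemma prolong_dds (j : Jet (n + 1) q m) :
    prolong (dds n q) j = ((Pi.single 0 1 : Fin (n + 1) → ℝ), 0) := by
  refine Prod.ext rfl ?_
  funext α J
  have hf : ContDiffAt ℝ ∞ (fun y => j.rep y α) j.1 := (contDiff_rep j).contDiffAt.jet_component α
  have hp : ContDiffAt ℝ ∞ (pderiv 0 fun y => j.rep y α) j.1 := hf.dirDeriv _
  have hs : ∀ a : Fin (n + 1) → ℝ,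
      ∑ i, (Pi.single 0 1 : Fin (n + 1) → ℝ) i * a i = a 0 := fun a => by
    simp [Pi.single_apply]
  have hc : characteristic (dds n q) j.rep α =
      fun y => (-ContinuousLinearMap.id ℝ ℝ) (pderiv 0 (fun y => j.rep y α) y) := by
    funext y
    simp only [characteristic, dds]
    rw [hs fun i => pderiv i (fun y => j.rep y α) y]
    simp
  change mderiv J.exps (characteristic (dds n q) j.rep α) j.1 +
    ∑ i, (Pi.single 0 1 : Fin (n + 1) → ℝ) i * mderiv J.exps (pderiv i fun y => j.rep y α) j.1 = 0
  rw [hs fun i => mderiv J.exps (pderiv i fun y => j.rep y α) j.1, hc, mderiv_eq_iterDir,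
    mderiv_eq_iterDir, (iterDir_clm_comp _ hp _).self_of_nhds]
  simp

lemma eventually_transversal_rep {p : ℕ} {Φ : OpenPartialHomeomorph (Base p q) (Base p q)}
    (hΦ : IsSmoothChange Φ) {j₀ : Jet p q m} (hs : j₀.base ∈ Φ.source)
    (ht : Transversal Φ j₀.rep j₀.1) : ∀ᶠ j in 𝓝 j₀, Transversal Φ j.rep j.1 := by
  rw [base_of_jet_eq (jet_rep j₀)] at hs
  obtain ⟨_, hg⟩ := exists_transformed_family (C := Jet p q m) (z₀ := (j₀, j₀.1)) hΦ
    contDiff_rep_uncurried.contDiffAt hs ht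
  have hc : ContinuousAt (fun j : Jet p q m => (j, j.1)) j₀ := by fun_prop
  exact (hc.eventually hg).mono fun j hj => hj.2.2.2

/-- In rectifying coordinates, a nondegenerate symmetric system has an invariant form near every
jet which is transversal. -/
theorem hasInvariantForm (hΦ : IsSmoothChange Φ) (hX : Rectifies Φ X) {M : Set (Jet (n + 1) q m)}
    (hM : IsOpen M) {Δ : Jet (n + 1) q m → (Fin ν → ℝ)} (hΔ : ContDiffOn ℝ ∞ Δ M)
    (hnd : Nondegenerate Δ M) (hsym : IsSymmetric X Δ M) {j₀ : Jet (n + 1) q m} (hj₀ : j₀ ∈ M)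
    (hs : j₀.base ∈ Φ.source) (ht : Transversal Φ j₀.rep j₀.1) : HasInvariantForm Δ M Φ j₀ := by
  obtain ⟨g₀, -, -, hji⟩ := exists_isJetImage hΦ hs (contDiff_rep j₀).contDiffAt (jet_rep j₀) ht
  set P₀ := jetHomeomorph m hΦ with hP₀
  have hP₀s : IsSmoothChange P₀ := isSmoothChange_jetHomeomorph hΦ
  have hj₀s : j₀ ∈ P₀.source := ⟨_, hji⟩
  obtain ⟨V, hVt, hVo, hVj⟩ := eventually_nhds_iff.1 (eventually_transversal_rep hΦ hs ht)
  let e : Jet (n + 1) q m := ((Pi.single 0 1 : Fin (n + 1) → ℝ), 0)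
  let l : Jet (n + 1) q m →L[ℝ] ℝ := (ContinuousLinearMap.proj 0).comp (ContinuousLinearMap.fst ℝ _ _)
  have hl : l e = 1 := by simp [l, e]
  -- On `V` the polynomial representatives are transversal, as `fderiv_jetMap_symm` requires because
  -- `prolong` is computed on them.
  let O : Set (Jet (n + 1) q m) := P₀.target ∩ P₀.symm ⁻¹' (V ∩ M)
  have hO : IsOpen O := P₀.isOpen_inter_preimage_symm (hVo.inter hM)
  have hpO : P₀ j₀ ∈ O := by
    refine ⟨P₀.map_source hj₀s, ?_⟩
    change P₀.symm (P₀ j₀) ∈ V ∩ M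
    rw [P₀.left_inv hj₀s]
    exact ⟨hVj, hj₀⟩
  have hΔat : ∀ j ∈ M, ContDiffAt ℝ ∞ Δ j := fun j hj => hΔ.contDiffAt (hM.mem_nhds hj)
  let T : Jet (n + 1) q m → (Fin ν → ℝ) := Δ ∘ P₀.symm
  have hTat : ∀ j ∈ O, ContDiffAt ℝ ∞ T j := fun j hj =>
    (hΔat _ hj.2.2).comp j (hP₀s.symm.contDiffAt hj.1)
  have hTfd : ∀ j ∈ O, fderiv ℝ T j = (fderiv ℝ Δ (P₀.symm j)).comp (fderiv ℝ P₀.symm j) :=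
    fun j hj => fderiv_comp j ((hΔat _ hj.2.2).differentiableAt (by simp))
      ((hP₀s.symm.contDiffAt hj.1).differentiableAt (by simp))
  have hTnd : ∀ j ∈ O, T j = 0 → Function.Surjective (fderiv ℝ T j) := by
    intro j hj hTj w
    obtain ⟨v, hv⟩ := hnd _ hj.2.2 hTj w
    have h1 : (T ∘ P₀) =ᶠ[𝓝 (P₀.symm j)] Δ := by
      filter_upwards [P₀.open_source.mem_nhds (P₀.map_target hj.1)] with i hi
      simp only [T, Function.comp, P₀.left_inv hi]
    have h2 : DifferentiableAt ℝ T (P₀ (P₀.symm j)) := by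
      rw [P₀.right_inv hj.1]
      exact (hTat j hj).differentiableAt (by simp)
    have h3 := fderiv_comp (P₀.symm j) h2
      ((hP₀s.contDiffAt (P₀.map_target hj.1)).differentiableAt (by simp))
    rw [h1.fderiv_eq, P₀.right_inv hj.1] at h3
    exact ⟨fderiv ℝ P₀ (P₀.symm j) v, by rw [← hv, h3]; rfl⟩
  have hTinv : ∀ j ∈ O, T j = 0 → fderiv ℝ T j e = 0 := by
    intro j hj hTj
    have hjs := P₀.map_target hj.1
    have h1 := fderiv_jetMap_symm hΦ hX (j := P₀.symm j) hjs.choose_spec.1 (hVt _ hj.2.1)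
    have h2 : jetMap Φ (P₀.symm j) = j := P₀.right_inv hj.1
    rw [h2] at h1
    rw [hTfd j hj, ContinuousLinearMap.comp_apply]
    exact (congrArg _ h1).trans (hsym _ hj.2.2 hTj)
  obtain ⟨U, S, K, hU, hpU, hUO, hS, hSu, hK, hKc⟩ := exists_invariant_form hO hpO
    (fun j hj => (hTat j hj).contDiffWithinAt) l hl hTnd hTinv
  have hKs : ContDiffOn ℝ ∞ K U := by
    refine contDiffOn_pi.2 fun a => ?_
    refine ContDiffOn.congr (f := fun j => ∑ b, S j a b * T j b) ?_ fun j hj => hK j hj a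
    refine ContDiffOn.sum fun b _ => (hS a b).mul ?_
    exact contDiffOn_pi.1 (fun j hj => (hTat j (hUO hj)).contDiffWithinAt) b
  have hKS : ∀ j ∈ U, K j = (S j).mulVec (T j) := fun j hj => funext fun a => hK j hj a
  let P := (P₀.symm.restrOpen U hU).symm
  have hPt : P.target = U := by
    change P₀.target ∩ U = U
    exact Set.inter_eq_right.2 fun j hj => (hUO hj).1
  have hPs : ∀ j ∈ P.source, j ∈ P₀.source ∧ P₀ j ∈ U := by
    intro j hj
    exact ⟨hj.1, hj.2⟩
  refine ⟨P, ?_, ?_, ⟨?_, ?_⟩, ?_, S, K, ?_⟩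
  · exact ⟨hj₀s, hpU⟩
  · intro j hj
    have h1 := (hUO (hPs j hj).2).2.2
    rwa [P₀.left_inv (hPs j hj).1] at h1
  · exact hP₀s.1.mono fun j hj => (hPs j hj).1
  · rw [hPt]
    exact hP₀s.2.mono fun j hj => (hUO hj).1
  · exact fun j hj => isProlongation_jetHomeomorph hΦ j (hPs j hj).1
  · rw [hPt]
    refine ⟨hS, hSu, hKs, hK, fun j hj => ?_, fun j _ => ?_, fun j _ j' _ h h' => ?_⟩
    · have h1 := (hPs j hj).2
      have h2 : T (P₀ j) = Δ j := congrArg Δ (P₀.left_inv (hPs j hj).1)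
      change Δ j = 0 ↔ K (P₀ j) = 0
      rw [hKS _ h1, h2]
      refine ⟨fun h => by rw [h, Matrix.mulVec_zero], fun h => ?_⟩
      exact Matrix.mulVec_injective_of_isUnit (hSu _ h1) (by rw [h, Matrix.mulVec_zero])
    · change fderiv ℝ K j (prolong (dds n q) j) = 0
      rw [prolong_dds]
      by_cases hd : DifferentiableAt ℝ K j
      · have h1 : HasDerivAt (fun t : ℝ => j + t • e) e 0 := by
          have := ((hasDerivAt_id (0 : ℝ)).smul_const e).const_add j
          rw [one_smul] at this
          exact this
        have h2 : HasFDerivAt K (fderiv ℝ K j) (j + (0 : ℝ) • e) := by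
          rw [zero_smul, add_zero]; exact hd.hasFDerivAt
        have h3 := h2.comp_hasDerivAt (0 : ℝ) h1
        have h4 : (K ∘ fun t : ℝ => j + t • e) = fun _ => K j := funext fun t => hKc j t
        rw [h4] at h3
        exact h3.unique (hasDerivAt_const _ _)
      -- Off the points of differentiability `fderiv` is zero by default, so membership in the
      -- domain is not needed.
      · rw [fderiv_zero_of_not_differentiableAt hd]; rfl
    · have h1 : j' = j + (j'.1 0 - j.1 0) • e := by
        refine Prod.ext (funext fun k => ?_) ?_
        · refine Fin.cases ?_ (fun k => ?_) k
          · simp [e]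
          · simp [e, h k]
        · simp [e, h']
      rw [h1, hKc]

end InvariantForm

/-! ### Rectifying changes of variables and their transversality. -/

section Rectification

/-- A map with invertible derivative is a smooth change of variables near the point. -/
lemma exists_isSmoothChange {E : Type} [NormedAddCommGroup E] [NormedSpace ℝ E] [CompleteSpace E]
    {f : E → E} {a : E} (hf : ∀ᶠ z in 𝓝 a, ContDiffAt ℝ ∞ f z) {A : E ≃L[ℝ] E}
    (hA : fderiv ℝ f a = A) {U : Set E} (hU : U ∈ 𝓝 a) :
    ∃ Φ : OpenPartialHomeomorph E E, a ∈ Φ.source ∧ Φ.source ⊆ U ∧ (Φ : E → E) = f ∧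
      IsSmoothChange Φ := by
  obtain ⟨Ψ, ha, hΨU, hΨf, hΨs, -⟩ := exists_openPartialHomeomorph hf.self_of_nhds hA
    (Filter.inter_mem hU hf)
  refine ⟨Ψ, ha, fun z hz => (hΨU hz).1, hΨf, ?_, ?_⟩
  · rw [hΨf]
    intro z hz
    have h1 : ContDiffAt ℝ ∞ f z := (hΨU hz).2
    exact h1.contDiffWithinAt
  · intro w hw
    have h1 := hΨs _ (Ψ.map_target hw) (hΨU (Ψ.map_target hw)).2
    rw [← hΨf, Ψ.right_inv hw] at h1
    exact h1.contDiffWithinAt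

variable {p q n : ℕ}

lemma exists_continuousLinearEquiv_of_injective {E : Type} [NormedAddCommGroup E] [NormedSpace ℝ E]
    [FiniteDimensional ℝ E] {A : E →L[ℝ] E} (h : Function.Injective A) :
    ∃ e : E ≃L[ℝ] E, A = e := by
  have := FiniteDimensional.complete ℝ E
  exact exists_equiv_of_bijective ⟨h, LinearMap.surjective_of_injective (f := A.toLinearMap) h⟩

lemma bijective_of_surjective {E : Type} [NormedAddCommGroup E] [NormedSpace ℝ E]
    [FiniteDimensional ℝ E] {A : E →L[ℝ] E} (h : Function.Surjective A) : Function.Bijective A :=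
  ⟨LinearMap.injective_iff_surjective (f := A.toLinearMap) |>.2 h, h⟩

/-- A change of variables preserving the fibres is transversal to all graphs. -/
lemma FibrePreserving.transversal {Φ : OpenPartialHomeomorph (Base p q) (Base p q)}
    (hΦ : IsSmoothChange Φ) (hfib : FibrePreserving Φ) {f : (Fin p → ℝ) → (Fin q → ℝ)}
    {x : Fin p → ℝ} (hf : DifferentiableAt ℝ f x) (hs : (x, f x) ∈ Φ.source) :
    Transversal Φ f x := by
  have hd : HasFDerivAt Φ (fderiv ℝ Φ (x, f x)) (x, f x) :=
    ((hΦ.contDiffAt hs).differentiableAt (by simp)).hasFDerivAt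
  set D := fderiv ℝ Φ (x, f x) with hD
  have hd2 : HasFDerivAt Φ.symm (fderiv ℝ Φ.symm (Φ (x, f x))) (Φ (x, f x)) :=
    ((hΦ.symm.contDiffAt (Φ.map_source hs)).differentiableAt (by simp)).hasFDerivAt
  have hsurj : ∀ w, ∃ v, D v = w := by
    intro w
    have hd' : HasFDerivAt Φ D (Φ.symm (Φ (x, f x))) := by rw [Φ.left_inv hs]; exact hd
    have h1 := hd'.comp (Φ (x, f x)) hd2
    have h2 : HasFDerivAt (Φ ∘ Φ.symm) (ContinuousLinearMap.id ℝ _) (Φ (x, f x)) := by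
      refine (hasFDerivAt_id _).congr_of_eventuallyEq ?_
      filter_upwards [Φ.open_target.mem_nhds (Φ.map_source hs)] with y hy
      exact Φ.right_inv hy
    exact ⟨_, congrArg (fun L => L w) (h1.unique h2)⟩
  have hvert : ∀ v : Fin q → ℝ, (D (0, v)).1 = 0 := by
    intro v
    have h1 : HasFDerivAt (fun u => (Φ (x, u)).1) _ (f x) :=
      (HasFDerivAt.comp (f := fun u : Fin q → ℝ => (x, u)) (f x) hd
        (hasFDerivAt_prodMk_right x (f x))).fst
    have h2 : HasFDerivAt (fun u => (Φ (x, u)).1) (0 : (Fin q → ℝ) →L[ℝ] (Fin p → ℝ)) (f x) := by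
      refine (hasFDerivAt_const (Φ (x, f x)).1 (f x)).congr_of_eventuallyEq ?_
      have hc : ContinuousAt (fun u : Fin q → ℝ => (x, u)) (f x) := by fun_prop
      filter_upwards [hc.eventually (Φ.open_source.mem_nhds hs)] with u hu
      exact hfib _ hu _ hs rfl
    exact congrArg (fun L => L v) (h1.unique h2)
  have hσ : HasFDerivAt (fun y => (Φ (y, f y)).1) _ x :=
    (HasFDerivAt.comp (f := fun y => (y, f y)) x hd
      ((hasFDerivAt_id x).prodMk hf.hasFDerivAt)).fst
  refine bijective_of_surjective fun w => ?_
  -- Vertical vectors do not affect the first component, so `v` may be replaced by the tangent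
  -- vector to the graph above `v.1`.
  obtain ⟨v, hv⟩ := hsurj (w, 0)
  refine ⟨v.1, ?_⟩
  rw [hσ.fderiv]
  change (D (v.1, fderiv ℝ f x v.1)).1 = w
  have h1 : (v.1, fderiv ℝ f x v.1) = v + (0, fderiv ℝ f x v.1 - v.2) := by
    refine Prod.ext ?_ ?_ <;> simp
  rw [h1, map_add, Prod.fst_add, hvert, hv, add_zero]

lemma exists_rectifies {W : Set (Base (n + 1) q)} (hW : IsOpen W)
    {X : Base (n + 1) q → Base (n + 1) q} {b : Base (n + 1) q} (hb : b ∈ W)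
    {f : Base (n + 1) q → Base (n + 1) q}
    (hf : ∀ᶠ y in 𝓝 b, ContDiffAt ℝ ∞ f y ∧ fderiv ℝ f y (X y) = (Pi.single 0 1, 0))
    {A : Base (n + 1) q ≃L[ℝ] Base (n + 1) q} (hA : fderiv ℝ f b = A) :
    ∃ Φ : OpenPartialHomeomorph (Base (n + 1) q) (Base (n + 1) q), b ∈ Φ.source ∧ Φ.source ⊆ W ∧
      IsSmoothChange Φ ∧ Rectifies Φ X ∧ (Φ : Base (n + 1) q → Base (n + 1) q) = f := by
  obtain ⟨Φ, hbΦ, hΦU, hΦf, hΦ⟩ := exists_isSmoothChange (hf.mono fun y hy => hy.1) hA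
    (Filter.inter_mem (hW.mem_nhds hb) hf)
  refine ⟨Φ, hbΦ, fun y hy => (hΦU hy).1, hΦ, fun y hy => ?_, hΦf⟩
  rw [hΦf]
  exact (hΦU hy).2.2

/-- A projectable vector field with nonvanishing projection is rectified by a change of variables
preserving the fibres. -/
theorem exists_rectifies_fibrePreserving {W : Set (Base (n + 1) q)} (hW : IsOpen W)
    {X : Base (n + 1) q → Base (n + 1) q} (hX : ContDiffOn ℝ ∞ X W) (hproj : Projectable X W)
    {b : Base (n + 1) q} (hb : b ∈ W) (hne : (X b).1 ≠ 0) :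
    ∃ Φ : OpenPartialHomeomorph (Base (n + 1) q) (Base (n + 1) q), b ∈ Φ.source ∧ Φ.source ⊆ W ∧
      IsSmoothChange Φ ∧ Rectifies Φ X ∧ FibrePreserving Φ := by
  let e : Fin (n + 1) → ℝ := Pi.single 0 1
  have he : e ≠ 0 := fun h => by simpa [e] using congrFun h 0
  obtain ⟨A₁, hA₁⟩ := SeparatingDual.exists_continuousLinearEquiv_apply_eq (R := ℝ) hne he
  let φ := (X b).2
  let π : Base (n + 1) q →L[ℝ] ℝ := (ContinuousLinearMap.proj 0).comp
    ((A₁ : (Fin (n + 1) → ℝ) →L[ℝ] (Fin (n + 1) → ℝ)).comp (ContinuousLinearMap.fst ℝ _ _))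
  -- The differential to be prescribed at `b`: `A₁` sends `ξ` to `e`, and the correction by `φ`
  -- makes the `v`-part of the image of `X b` vanish.
  let a : Base (n + 1) q →L[ℝ] Base (n + 1) q :=
    ((A₁ : (Fin (n + 1) → ℝ) →L[ℝ] (Fin (n + 1) → ℝ)).comp (ContinuousLinearMap.fst ℝ _ _)).prod
      (ContinuousLinearMap.snd ℝ _ _ - π.smulRight φ)
  have ha : ∀ y, a y = (A₁ y.1, y.2 - A₁ y.1 0 • φ) := fun y => rfl
  obtain ⟨A, hA⟩ := exists_continuousLinearEquiv_of_injective (A := a)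
    ((injective_iff_map_eq_zero a).2 fun y hy => by
      rw [ha, Prod.ext_iff] at hy
      have h1 : y.1 = 0 := by simpa using hy.1
      have h2 := hy.2
      simp only [h1, map_zero, Pi.zero_apply, zero_smul, sub_zero] at h2
      exact Prod.ext h1 h2)
  have hAX : A (X b) = (e, 0) := by
    change (A : Base (n + 1) q →L[ℝ] Base (n + 1) q) (X b) = _
    rw [← hA, ha, hA₁]
    simp [e, φ]
  obtain ⟨Φ₂, hΦ₂b, hΦ₂⟩ := exists_flowBox (hW.mem_nhds hb) hX A
    ((ContinuousLinearMap.proj 0).comp (ContinuousLinearMap.fst ℝ _ _)) (by simp [e]) hAX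
  have hc : Continuous fun x : Fin (n + 1) → ℝ => (x, b.2) := by fun_prop
  have hW₁ : IsOpen ((fun x : Fin (n + 1) → ℝ => (x, b.2)) ⁻¹' W) := hW.preimage hc
  have hX₁ : ContDiffOn ℝ ∞ (fun x : Fin (n + 1) → ℝ => (X (x, b.2)).1)
      ((fun x : Fin (n + 1) → ℝ => (x, b.2)) ⁻¹' W) :=
    contDiff_fst.comp_contDiffOn
      (hX.comp (contDiff_id.prodMk contDiff_const).contDiffOn fun x hx => hx)
  obtain ⟨Φ₁, hΦ₁b, hΦ₁⟩ := exists_flowBox (hW₁.mem_nhds (x := b.1) hb) hX₁ A₁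
    (ContinuousLinearMap.proj 0) (by simp [e]) hA₁
  -- Take `(s, z)` from a flow box of `ξ` on the slice `u = b.2`, which by projectability rectifies
  -- `ξ` at every `u`, and `v` from a flow box of `X`. Both differentials being prescribed, their
  -- combination has differential `A` at `b`.
  let f : Base (n + 1) q → Base (n + 1) q := fun y => (Φ₁ y.1, (Φ₂ y).2)
  have hfd : ∀ y : Base (n + 1) q, DifferentiableAt ℝ Φ₁ y.1 → DifferentiableAt ℝ Φ₂ y →
      ∀ v, fderiv ℝ f y v = (fderiv ℝ Φ₁ y.1 v.1, (fderiv ℝ Φ₂ y v).2) := by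
    intro y h1 h2 v
    have h3 : HasFDerivAt f _ y :=
      (HasFDerivAt.comp (f := Prod.fst) y h1.hasFDerivAt hasFDerivAt_fst).prodMk h2.hasFDerivAt.snd
    rw [h3.fderiv]
    rfl
  have hfA : fderiv ℝ f b = A := by
    refine ContinuousLinearMap.ext fun v => ?_
    rw [hfd b (hΦ₁.self_of_nhds.1.differentiableAt (by simp))
      (hΦ₂.self_of_nhds.1.differentiableAt (by simp)), hΦ₁b, hΦ₂b, ← hA]
    rfl
  have hf : ∀ᶠ y in 𝓝 b, ContDiffAt ℝ ∞ f y ∧ fderiv ℝ f y (X y) = (Pi.single 0 1, 0) := by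
    have hfst : ContinuousAt (Prod.fst : Base (n + 1) q → _) b := continuousAt_fst
    filter_upwards [hW.mem_nhds hb, hfst.eventually hΦ₁, hΦ₂,
      hfst.eventually (hW₁.mem_nhds (x := b.1) hb)] with y hyW hy₁ hy₂ hyb
    refine ⟨(hy₁.1.comp y contDiffAt_fst).prodMk (contDiffAt_snd.comp y hy₂.1), ?_⟩
    rw [hfd y (hy₁.1.differentiableAt (by simp)) (hy₂.1.differentiableAt (by simp)), hy₂.2,
      hproj y hyW (y.1, b.2) hyb rfl, hy₁.2]
  obtain ⟨Φ, hbΦ, hΦW, hΦ, hΦX, hΦf⟩ := exists_rectifies hW hb hf hfA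
  refine ⟨Φ, hbΦ, hΦW, hΦ, hΦX, fun y _ y' _ h => ?_⟩
  simp only [hΦf, f, h]

/-- A vector field is rectified near a point where it is vertical and nonzero by a change of
variables which is transversal to a given graph. -/
theorem exists_rectifies_transversal {W : Set (Base (n + 1) q)} (hW : IsOpen W)
    {X : Base (n + 1) q → Base (n + 1) q} (hX : ContDiffOn ℝ ∞ X W)
    {f : (Fin (n + 1) → ℝ) → (Fin q → ℝ)} {x : Fin (n + 1) → ℝ} (hf : DifferentiableAt ℝ f x)
    (hb : (x, f x) ∈ W) (h1 : (X (x, f x)).1 = 0) (h2 : (X (x, f x)).2 ≠ 0) :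
    ∃ Φ : OpenPartialHomeomorph (Base (n + 1) q) (Base (n + 1) q), (x, f x) ∈ Φ.source ∧
      Φ.source ⊆ W ∧ IsSmoothChange Φ ∧ Rectifies Φ X ∧ Transversal Φ f x := by
  let e : Fin (n + 1) → ℝ := Pi.single 0 1
  set φ := (X (x, f x)).2 with hφ
  obtain ⟨l, hl⟩ := SeparatingDual.exists_eq_one (R := ℝ) h2
  let L := fderiv ℝ f x
  let r : Base (n + 1) q →L[ℝ] (Fin q → ℝ) :=
    ContinuousLinearMap.snd ℝ _ _ - L.comp (ContinuousLinearMap.fst ℝ _ _)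
  let π : Base (n + 1) q →L[ℝ] ℝ :=
    (ContinuousLinearMap.proj 0).comp (ContinuousLinearMap.fst ℝ _ _)
  -- `r` vanishes on the tangent space of the graph, so there the first component is the identity:
  -- this is transversality. On `(0, φ)` one has `r = φ` and `l φ = 1`, so the image is `(e, 0)`.
  -- The last term restores the direction `φ` removed from the second component, which makes `a`
  -- injective.
  let a : Base (n + 1) q →L[ℝ] Base (n + 1) q :=
    (ContinuousLinearMap.fst ℝ _ _ + (l.comp r).smulRight e).prod
      (r - (l.comp r).smulRight φ + π.smulRight φ)
  have ha : ∀ y, a y = (y.1 + l (y.2 - L y.1) • e,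
      (y.2 - L y.1) - l (y.2 - L y.1) • φ + y.1 0 • φ) := fun y => rfl
  obtain ⟨A, hA⟩ := exists_continuousLinearEquiv_of_injective (A := a)
    ((injective_iff_map_eq_zero a).2 fun y hy => by
      rw [ha, Prod.ext_iff] at hy
      obtain ⟨h3, h4⟩ := hy
      simp only [Prod.fst_zero, Prod.snd_zero] at h3 h4
      have h5 : y.1 0 + l (y.2 - L y.1) = 0 := by simpa [e] using congrFun h3 0
      have h6 := congrArg l h4
      simp only [map_add, map_sub, map_smul, hl, smul_eq_mul, mul_one, map_zero] at h6
      simp only [map_sub] at h5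
      have h7 : l (y.2 - L y.1) = 0 := by rw [map_sub]; linarith
      have h8 : y.1 = 0 := by simpa [h7] using h3
      rw [h7, h8] at h4
      refine Prod.ext h8 ?_
      simpa using h4)
  have hAX : A (X (x, f x)) = (e, 0) := by
    change (A : Base (n + 1) q →L[ℝ] Base (n + 1) q) (X (x, f x)) = _
    rw [← hA, ha, h1, ← hφ]
    simp [hl]
  obtain ⟨Ψ, hΨb, hΨ⟩ := exists_flowBox (hW.mem_nhds hb) hX A
    ((ContinuousLinearMap.proj 0).comp (ContinuousLinearMap.fst ℝ _ _)) (by simp [e]) hAX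
  obtain ⟨Φ, hbΦ, hΦW, hΦ, hΦX, hΦf⟩ := exists_rectifies hW hb hΨ hΨb
  refine ⟨Φ, hbΦ, hΦW, hΦ, hΦX, ?_⟩
  have hd : HasFDerivAt Φ (a : Base (n + 1) q →L[ℝ] Base (n + 1) q) (x, f x) := by
    rw [hΦf, hA, ← hΨb]
    exact (hΨ.self_of_nhds.1.differentiableAt (by simp)).hasFDerivAt
  have hσ : HasFDerivAt (fun y => (Φ (y, f y)).1) _ x :=
    (HasFDerivAt.comp (f := fun y => (y, f y)) x hd
      ((hasFDerivAt_id x).prodMk hf.hasFDerivAt)).fst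
  have hid : ∀ y, fderiv ℝ (fun y => (Φ (y, f y)).1) x y = y := by
    intro y
    rw [hσ.fderiv]
    change (a (y, L y)).1 = y
    rw [ha]
    simp
  exact ⟨fun y y' h => by rwa [hid, hid] at h, fun y => ⟨y, hid y⟩⟩

end Rectification

end PDESymmetry

end

/-! ### The theorem. -/

theorem theorem1 {n q m ν : ℕ}
    (W : Set (PDESymmetry.Base (n + 1) q)) (hW : IsOpen W)
    (X : PDESymmetry.Base (n + 1) q → PDESymmetry.Base (n + 1) q) (hX : ContDiffOn ℝ ∞ X W)
    (hproj : PDESymmetry.Projectable X W)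
    (M : Set (PDESymmetry.Jet (n + 1) q m)) (hM : IsOpen M) (hMW : ∀ j ∈ M, j.base ∈ W)
    (Δ : PDESymmetry.Jet (n + 1) q m → (Fin ν → ℝ)) (hΔ : ContDiffOn ℝ ∞ Δ M)
    (hnd : PDESymmetry.Nondegenerate Δ M) (hsym : PDESymmetry.IsSymmetric X Δ M) :
    (∀ b ∈ W, (X b).1 ≠ 0 →
      ∃ Φ : OpenPartialHomeomorph (PDESymmetry.Base (n + 1) q) (PDESymmetry.Base (n + 1) q),
        b ∈ Φ.source ∧ Φ.source ⊆ W ∧ PDESymmetry.IsSmoothChange Φ ∧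
        PDESymmetry.Rectifies Φ X ∧ PDESymmetry.FibrePreserving Φ ∧
        ∀ j₀ ∈ M, j₀.base ∈ Φ.source → PDESymmetry.HasInvariantForm Δ M Φ j₀) ∧
    (∀ j₀ ∈ M, X j₀.base ≠ 0 →
      ∃ Φ : OpenPartialHomeomorph (PDESymmetry.Base (n + 1) q) (PDESymmetry.Base (n + 1) q),
        j₀.base ∈ Φ.source ∧ Φ.source ⊆ W ∧ PDESymmetry.IsSmoothChange Φ ∧
        PDESymmetry.Rectifies Φ X ∧ PDESymmetry.HasInvariantForm Δ M Φ j₀) := by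
  have key : ∀ b ∈ W, (X b).1 ≠ 0 →
      ∃ Φ : OpenPartialHomeomorph (PDESymmetry.Base (n + 1) q) (PDESymmetry.Base (n + 1) q),
        b ∈ Φ.source ∧ Φ.source ⊆ W ∧ PDESymmetry.IsSmoothChange Φ ∧
        PDESymmetry.Rectifies Φ X ∧ PDESymmetry.FibrePreserving Φ ∧
        ∀ j₀ ∈ M, j₀.base ∈ Φ.source → PDESymmetry.HasInvariantForm Δ M Φ j₀ := by
    intro b hb hne
    obtain ⟨Φ, hbΦ, hΦW, hΦ, hΦX, hfib⟩ :=
      PDESymmetry.exists_rectifies_fibrePreserving hW hX hproj hb hne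
    refine ⟨Φ, hbΦ, hΦW, hΦ, hΦX, hfib, fun j₀ hj₀ hs => ?_⟩
    refine PDESymmetry.hasInvariantForm hΦ hΦX hM hΔ hnd hsym hj₀ hs ?_
    refine hfib.transversal hΦ
      ((PDESymmetry.contDiff_rep j₀).differentiable (by simp)).differentiableAt ?_
    rwa [← PDESymmetry.base_of_jet_eq (PDESymmetry.jet_rep j₀)]
  refine ⟨key, fun j₀ hj₀ hne => ?_⟩
  -- At a point where `ξ = 0` no rectifying change preserves the fibres, since the vertical vector
  -- `X` must be sent to `∂/∂s`. There the change is adapted to the given jet.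
  by_cases h1 : (X j₀.base).1 = 0
  · have h2 : (X j₀.base).2 ≠ 0 := fun h => hne (Prod.ext h1 h)
    have hb := PDESymmetry.base_of_jet_eq (PDESymmetry.jet_rep j₀)
    have hjW := hMW j₀ hj₀
    rw [hb] at h1 h2 hjW
    obtain ⟨Φ, hbΦ, hΦW, hΦ, hΦX, ht⟩ := PDESymmetry.exists_rectifies_transversal hW hX
      ((PDESymmetry.contDiff_rep j₀).differentiable (by simp)).differentiableAt hjW h1 h2
    rw [← hb] at hbΦ
    exact ⟨Φ, hbΦ, hΦW, hΦ, hΦX,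
      PDESymmetry.hasInvariantForm hΦ hΦX hM hΔ hnd hsym hj₀ hbΦ ht⟩
  · obtain ⟨Φ, hbΦ, hΦW, hΦ, hΦX, -, h⟩ := key _ (hMW j₀ hj₀) h1
    exact ⟨Φ, hbΦ, hΦW, hΦ, hΦX, h j₀ hj₀ hbΦ⟩
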